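/- **Setting.** For $j\in\mathbb N_0=\{0,1,2,\dots\}$ let $(X_j,\mathcal G_j,m_j)$ be probability spaces with notions of variation $\mathrm{var}_j\colon L^1(X_j,m_j)\to[0,\infty]$ (real-valued functions). Put $\mathcal B_j=\{\varphi\in L^1(m_j):\mathrm{var}_j(\varphi)<\infty\}$ and $\|\varphi\|_{\mathcal B_j}=\|\varphi\|_{L^1(m_j)}+\mathrm{var}_j(\varphi)$. Assume, for all $j$: $\mathrm{var}_j(t\varphi)=|t|\,\mathrm{var}_j(\varphi)$ for $t\in\mathbb R$; $\mathrm{var}_j(\varphi+\psi)\le\mathrm{var}_j(\varphi)+\mathrm{var}_j(\psi)$; $\mathrm{var}_j(1)<\infty$; $\mathcal B_j$ is complete, and dense in $L^1(m_j)$; and, with a constant $C$ independent of $j$, $\|\varphi\|_{L^\infty(m_j)}\le C\|\varphi\|_{\mathcal B_j}$ for $\varphi \in L^1(m_j)$ and $\mathrm{var}_j(\varphi\psi)\le C(\|\varphi\|_{\infty}\mathrm{var}_j(\psi)+\|\psi\|_\infty\mathrm{var}_j(\varphi))$ for $\varphi,\psi\in\mathcal B_j$. Let $T_j\colon X_j\to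 X_{j+1}$ be measurable with $(T_j)_*m_j\ll m_{j+1}$ and $\sup_j\sup_{\mathrm{var}_{j+1}(h)\le1}\mathrm{var}_j(h\circ T_j)<\infty$. Let $\mathcal L_j\colon L^1(m_j)\to L^1(m_{j+1})$ be the transfer operator: $\int(\mathcal L_j\varphi)\psi\,dm_{j+1}=\int\varphi\,(\psi\circ T_j)\,dm_j$ for $\varphi\in L^1(m_j)$, $\psi\in L^\infty(m_{j+1})$. Put $T_j^{(n)}=T_{j+n-1}\circ\dots\circ T_j$ and $\mathcal L_j^{(n)}=\mathcal L_{j+n-1}\circ\dots\circ\mathcal L_j$, with $T_j^{(0)}=\mathrm{id}$. The sequence $(\mathcal L_j)$ is *admissible* if * there is $K>0$ with $\|\mathcal L_j\varphi\|_{\mathcal B_{j+1}}\le K\|\varphi\|_{\mathcal B_j}$ for all $j$ and $\varphi\in\mathcal B_j$; * there are $N\ge1$, $\alpha\in(0,1)$, $\beta>0$ with $\|\mathcal L_j^{(N)}\varphi\|_{\mathcal B_{j+N}}\le\alpha\|\varphi\|_{\mathcal B_j}+\beta\|\varphi\|_{L^1(m_j)}$ for all $j$ and $\varphi\in\mathcal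 B_j$; * for each $a>0$ there are $c>0$ and $n_0$ such that $\operatorname{ess\,inf}\mathcal L_j^{(n)}\varphi\ge c\|\varphi\|_{L^1(m_j)}$ for all $j$, all $n\ge n_0$ and all $\varphi\in\mathcal B_j$ with $\varphi\ge0$ and $\mathrm{var}_j(\varphi)\le a\int\varphi\,dm_j$. **Theorem.** Let $(\mathcal L_j)$ be admissible, let $F_j\in\mathcal B_j$ with $\sup_j\|F_j\|_{\mathcal B_j}<\infty$, and let $H_j\colon X_j\to\mathbb R$ be measurable with $F_j=H_{j+1}\circ T_j-H_j$ ($m_j$-a.e.) for all $j\in\mathbb N_0$. Then there are functions $U_j,\mathcal M_j\colon X_j\to\mathbb R$ such that for all $j\in\mathbb N_0$ $$F_j=\int_{X_0}F_j\circ T_0^{(j)}\,dm_0+U_{j+1}\circ T_j-U_j+\mathcal M_j\qquad m_j\text{-a.e.},$$ and the following hold. 1. $U_j,\mathcal M_j\in\mathcal B_j$, $\sup_j\|U_j\|_{\mathcal B_j}<\infty$, $\sup_j\|\mathcal M_j\|_{\mathcal B_j}<\infty$ and $\int_{X_0}U_j\circ T_0^{(j)}\,dm_0=0$ for all $j$.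 2. $\mathbb E_{m_0}[\mathcal M_j\circ T_0^{(j)}\mid(T_0^{(j+1)})^{-1}\mathcal G_{j+1}]=0$ for all $j$, and $\sum_{j\ge0}\mathcal M_j\circ T_0^{(j)}$ converges $m_0$-a.s. and in $L^p(m_0)$ for every $1\le p<\infty$. 3. For every $1\le p<\infty$, $\int_{X_0}|H_n\circ T_0^{(n)}|^p\,dm_0<\infty$ for all $n$, and, with $q_n=\int_{X_0}H_n\circ T_0^{(n)}\,dm_0$, $\sup_n\int_{X_0}|H_n\circ T_0^{(n)}-q_n|^p\,dm_0<\infty$. For every $n$, the series $\sum_{k\ge n}\mathcal M_k\circ T_n^{(k-n)}$ converges $m_n$-a.e. and $$H_n=q_n+U_n-\sum_{k=n}^\infty\mathcal M_k\circ T_n^{(k-n)}\qquad m_n\text{-a.e.}$$ In particular $(H_n-U_n)\circ T_0^{(n)}-q_n\to0$ as $n\to\infty$, $m_0$-a.e. and in $L^p(m_0)$ for every $1\le p<\infty$. -/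

import Mathlib

open MeasureTheory Filter Topology
open scoped ENNReal NNReal

noncomputable section

namespace SeqLivsic

/-- The transfer operator of `T : (X, μ) → (Y, ν)` applied to `φ ∈ L¹(μ)`: the density with respect
to `ν` of the push-forward under `T` of the signed measure `φ dμ`. See `transfer_duality` for the
duality relation that characterizes it. -/
def transfer {X Y : Type*} [MeasurableSpace X] [MeasurableSpace Y]
    (μ : Measure X) (ν : Measure Y) (T : X → Y) (φ : X → ℝ) (y : Y) : ℝ :=
  (((μ.withDensity fun x => ENNReal.ofReal (φ x)).map T).rnDeriv ν y).toReal -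
    (((μ.withDensity fun x => ENNReal.ofReal (-φ x)).map T).rnDeriv ν y).toReal

theorem transfer_integrable {X Y : Type*} [MeasurableSpace X] [MeasurableSpace Y]
    {μ : Measure X} {ν : Measure Y} [IsProbabilityMeasure μ] [IsProbabilityMeasure ν]
    {T : X → Y} {φ : X → ℝ} (hφ : Integrable φ μ) :
    Integrable (transfer μ ν T φ) ν := by
  have : IsFiniteMeasure (μ.withDensity fun x => ENNReal.ofReal (φ x)) :=
    isFiniteMeasure_withDensity_ofReal hφ.2
  have : IsFiniteMeasure (μ.withDensity fun x => ENNReal.ofReal (-φ x)) :=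
    isFiniteMeasure_withDensity_ofReal hφ.neg.2
  exact Measure.integrable_toReal_rnDeriv.sub Measure.integrable_toReal_rnDeriv

/-- The duality relation `∫ (𝓛 φ) ψ dν = ∫ φ (ψ ∘ T) dμ` for `φ ∈ L¹(μ)`, `ψ ∈ L^∞(ν)`. -/
theorem transfer_duality {X Y : Type*} [MeasurableSpace X] [MeasurableSpace Y]
    {μ : Measure X} {ν : Measure Y} [IsProbabilityMeasure μ] [IsProbabilityMeasure ν]
    {T : X → Y} (hT : Measure.QuasiMeasurePreserving T μ ν)
    {φ : X → ℝ} (hφ : Integrable φ μ) {ψ : Y → ℝ} (hψ : MemLp ψ ∞ ν) :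
    ∫ y, transfer μ ν T φ y * ψ y ∂ν = ∫ x, φ x * ψ (T x) ∂μ := by
  have key : ∀ f : X → ℝ, Integrable f μ →
      Integrable (fun y => (((μ.withDensity fun x => ENNReal.ofReal (f x)).map T).rnDeriv ν
        y).toReal * ψ y) ν ∧
      ∫ y, (((μ.withDensity fun x => ENNReal.ofReal (f x)).map T).rnDeriv ν y).toReal * ψ y ∂ν
        = ∫ x, max (f x) 0 * ψ (T x) ∂μ := by
    intro f hf
    have : IsFiniteMeasure (μ.withDensity fun x => ENNReal.ofReal (f x)) :=
      isFiniteMeasure_withDensity_ofReal hf.2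
    have hac : (μ.withDensity fun x => ENNReal.ofReal (f x)).map T ≪ ν :=
      ((withDensity_absolutelyContinuous μ _).map hT.measurable).trans hT.absolutelyContinuous
    constructor
    · exact Integrable.mul_of_top_left Measure.integrable_toReal_rnDeriv hψ
    · have h1 := integral_rnDeriv_smul (f := ψ) hac
      simp only [smul_eq_mul] at h1
      rw [h1, integral_map hT.measurable.aemeasurable (hψ.1.mono_ac hac),
        integral_withDensity_eq_integral_toReal_smul₀ hf.1.aemeasurable.ennreal_ofReal
          (Eventually.of_forall fun _ => ENNReal.ofReal_lt_top)]
      simp [ENNReal.toReal_ofReal']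
  obtain ⟨i1, e1⟩ := key φ hφ
  obtain ⟨i2, e2⟩ := key (fun x => -φ x) hφ.neg
  have hψT : MemLp (ψ ∘ T) ∞ μ := by
    refine ⟨hψ.1.comp_quasiMeasurePreserving hT, lt_of_le_of_lt ?_ hψ.2⟩
    rw [eLpNorm_exponent_top, eLpNorm_exponent_top]
    refine essSup_le_of_ae_le _ ?_
    exact hT.ae (ae_le_eLpNormEssSup (f := ψ) (μ := ν))
  have j1 : Integrable (fun x => max (φ x) 0 * ψ (T x)) μ :=
    Integrable.mul_of_top_left hφ.pos_part hψT
  have j2 : Integrable (fun x => max (-φ x) 0 * ψ (T x)) μ :=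
    Integrable.mul_of_top_left hφ.neg_part hψT
  simp only [transfer, sub_mul]
  rw [integral_sub i1 i2, e1, e2, ← integral_sub j1 j2]
  congr 1
  ext x
  rcases le_total 0 (φ x) with h | h
  · simp [h]
  · simp [h]

/-- For `j ≤ k`, the composition `T_{k-1} ∘ ⋯ ∘ T_{j+1} ∘ T_j : X_j → X_k` (the identity if
`j = k`), that is, `T_j^{(k-j)}`. -/
def orbit {X : ℕ → Type*} (T : ∀ j, X j → X (j + 1)) {j k : ℕ} (h : j ≤ k) : X j → X k :=
  Nat.leRecOn h (fun {i} => T i)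

/-- For `j ≤ k`, the composition `𝓛_{k-1} ∘ ⋯ ∘ 𝓛_j` of transfer operators, that is,
`𝓛_j^{(k-j)}`. -/
def transferIter {X : ℕ → Type*} [∀ j, MeasurableSpace (X j)] (m : ∀ j, Measure (X j))
    (T : ∀ j, X j → X (j + 1)) {j k : ℕ} (h : j ≤ k) : (X j → ℝ) → (X k → ℝ) :=
  Nat.leRecOn (C := fun i => X i → ℝ) h (fun {i} φ => transfer (m i) (m (i + 1)) (T i) φ)

/-- The norm `‖φ‖_{L¹(μ)} + var φ`, with values in `[0, ∞]`. -/
def bNorm {X : Type*} [MeasurableSpace X] (μ : Measure X) (var : (X → ℝ) → ℝ≥0∞)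
    (φ : X → ℝ) : ℝ≥0∞ :=
  eLpNorm φ 1 μ + var φ

/-- Membership in the space `𝓑` of functions in `L¹(μ)` with finite variation. -/
def MemB {X : Type*} [MeasurableSpace X] (μ : Measure X) (var : (X → ℝ) → ℝ≥0∞)
    (φ : X → ℝ) : Prop :=
  Integrable φ μ ∧ var φ < ∞

/-- `var j : L¹(X_j, m_j) → [0, ∞]` is a sequence of notions of variation. Elements of `L¹` are
represented by integrable functions, and `var j` respects equality almost everywhere; its values at
non-integrable functions play no role. -/
structure IsVariation {X : ℕ → Type*} [∀ j, MeasurableSpace (X j)] (m : ∀ j, Measure (X j))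
    (var : ∀ j, (X j → ℝ) → ℝ≥0∞) : Prop where
  congr_ae : ∀ j (f g : X j → ℝ), Integrable f (m j) → f =ᵐ[m j] g → var j f = var j g
  smul : ∀ j (t : ℝ) (f : X j → ℝ), Integrable f (m j) →
    var j (fun x => t * f x) = ENNReal.ofReal |t| * var j f
  add_le : ∀ j (f g : X j → ℝ), Integrable f (m j) → Integrable g (m j) →
    var j (fun x => f x + g x) ≤ var j f + var j g
  /-- The supremum norm is controlled by the norm of `𝓑_j`, uniformly in `j`. -/
  sup_le : ∃ C : ℝ≥0, ∀ j (f : X j → ℝ), Integrable f (m j) →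
    eLpNorm f ∞ (m j) ≤ C * bNorm (m j) (var j) f
  one_lt_top : ∀ j, var j (fun _ => 1) < ∞
  /-- `𝓑_j` is dense in `L¹(m_j)`. -/
  dense : ∀ j (f : X j → ℝ), Integrable f (m j) → ∀ ε : ℝ≥0, 0 < ε →
    ∃ g : X j → ℝ, MemB (m j) (var j) g ∧ eLpNorm (fun x => f x - g x) 1 (m j) ≤ ε
  mul_le : ∃ C : ℝ≥0, ∀ j (f g : X j → ℝ), MemB (m j) (var j) f → MemB (m j) (var j) g →
    var j (fun x => f x * g x) ≤
      C * (eLpNorm f ∞ (m j) * var j g + eLpNorm g ∞ (m j) * var j f)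
  /-- `𝓑_j` is a Banach space. -/
  complete : ∀ j (u : ℕ → X j → ℝ), (∀ n, MemB (m j) (var j) (u n)) →
    (∀ ε : ℝ≥0, 0 < ε → ∃ N : ℕ, ∀ a b, N ≤ a → N ≤ b →
      bNorm (m j) (var j) (fun x => u a x - u b x) ≤ ε) →
    ∃ g : X j → ℝ, MemB (m j) (var j) g ∧
      Tendsto (fun n => bNorm (m j) (var j) (fun x => u n x - g x)) atTop (𝓝 0)

/-- The sequence of transfer operators of the maps `T_j : (X_j, m_j) → (X_{j+1}, m_{j+1})` is
admissible. -/
structure IsAdmissible {X : ℕ → Type*} [∀ j, MeasurableSpace (X j)] (m : ∀ j, Measure (X j))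
    (var : ∀ j, (X j → ℝ) → ℝ≥0∞) (T : ∀ j, X j → X (j + 1)) : Prop where
  bounded : ∃ K : ℝ≥0, 0 < K ∧ ∀ j (φ : X j → ℝ), MemB (m j) (var j) φ →
    bNorm (m (j + 1)) (var (j + 1)) (transfer (m j) (m (j + 1)) (T j) φ) ≤
      K * bNorm (m j) (var j) φ
  lasotaYorke : ∃ (N : ℕ) (α β : ℝ≥0), 1 ≤ N ∧ 0 < α ∧ α < 1 ∧ 0 < β ∧
    ∀ j (φ : X j → ℝ), MemB (m j) (var j) φ →
      bNorm (m (j + N)) (var (j + N)) (transferIter m T (Nat.le_add_right j N) φ) ≤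
        α * bNorm (m j) (var j) φ + β * eLpNorm φ 1 (m j)
  /-- For all `φ ≥ 0` in `𝓑_j` with `var_j φ ≤ a ∫ φ dm_j`, one has
  `ess inf 𝓛_j^{(n)} φ ≥ c ‖φ‖_{L¹}` as soon as `n ≥ n₀`. -/
  covering : ∀ a : ℝ, 0 < a → ∃ (c : ℝ) (n₀ : ℕ), 0 < c ∧
    ∀ (j n : ℕ), n₀ ≤ n → ∀ φ : X j → ℝ, MemB (m j) (var j) φ → 0 ≤ᵐ[m j] φ →
      var j φ ≤ ENNReal.ofReal (a * ∫ x, φ x ∂(m j)) →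
      ∀ᵐ y ∂(m (j + n)),
        c * ∫ x, |φ x| ∂(m j) ≤ transferIter m T (Nat.le_add_right j n) φ y

end SeqLivsic

end

open SeqLivsic

/-! Let `h_j = dens m T j` be the density of the law of `T_0^{(j)}` under `m_0`, so that `𝓛_j h_j =
h_{j+1}`. The operator side rests on one contraction (`exists_contraction`): if `φ` has mean zero,
`|φ| ≤ s h_j` and norm at most `R s`, then a fixed number of transfer operators replaces `s` by `γ
s` with `γ < 1`. The covering condition for `s h_j ± φ ≥ 0` improves the domination, and the
Lasota–Yorke inequality improves the norm. Hence the solution of `W_{k+1} = 𝓛_k (W_k + φ_k)`, `W_0 =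
0`, stays bounded if the `φ_k` do (`exists_qLe_cum`).

With `φ_k = h_k (F_k - mean)` and `U_k = W_k / h_k`, the function `M_k = F_k - mean + U_k - U_{k+1}
∘ T_k` satisfies `𝓛_k (h_k M_k) = 0`: the `M_k ∘ T_0^{(k)}` are bounded reverse martingale
differences (`exists_decomposition`). The division stays in `𝓑_k` by `exists_bLe_inv`. As `h_k` is
bounded below only from some `n₀` on, the finitely many earlier steps take `M_k = 0` and solve for
`U_k` backwards.

Put `y_n = H_n - U_n - ∑_{k<n} mean_k`. Then `M_n = y_{n+1} ∘ T_n - y_n`, so `y_0 = Y_n - R_n` with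
`Y_n = y_n ∘ T_0^{(n)}` and `R_n` the martingale sum. The decisive point is that the variances `v_n`
of `R_n` are bounded, although `y_0` is merely measurable (`exists_integral_qsum_le`). The same
recursion with `φ_k = h_k (M_k² - mean)` shows that the conditional variance of `R_n` given
`T_0^{(n)}` differs from `v_n` by a bounded amount. Given `T_0^{(n)}`, `Y_n` is fixed and `R_n` is
centred; for large `v_n` its conditional variance is comparable to `v_n` and its fourth moment is
`O(v_n²)`. By a Paley–Zygmund argument `y_0²` would exceed any given level with probability bounded
below as soon as `v_n` is large, which no single finite function can do.

Bounded variances give almost sure convergence by Kolmogorov's maximal inequality, and the higher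
moment bounds give convergence in `L^p`. So `y_n ∘ T_0^{(n)}` converges; the contraction forces the
limit to be a constant `κ` (`exists_ae_eq_const_of_tendsto`). Thus `y_n` is `κ` minus the sum of `M`
along the forward orbit, which is the formula for `H_n`. -/

namespace SeqLivsic

/-! ### Bounded measurable functions and elementary inequalities. -/

/-- A function that is bounded and measurable with respect to the σ-algebra `𝓜`. -/
def BddMeas {Ω : Type*} (𝓜 : MeasurableSpace Ω) (f : Ω → ℝ) : Prop :=
  Measurable[𝓜] f ∧ ∃ C, ∀ ω, |f ω| ≤ C

namespace BddMeas

variable {Ω : Type*} {𝓜 𝓝' : MeasurableSpace Ω} {f g : Ω → ℝ}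

theorem mono (h : 𝓜 ≤ 𝓝') (hf : BddMeas 𝓜 f) : BddMeas 𝓝' f :=
  ⟨hf.1.mono h le_rfl, hf.2⟩

theorem const (c : ℝ) : BddMeas 𝓜 (fun _ => c) :=
  ⟨measurable_const, |c|, fun _ => le_rfl⟩

theorem add (hf : BddMeas 𝓜 f) (hg : BddMeas 𝓜 g) : BddMeas 𝓜 (fun ω => f ω + g ω) := by
  obtain ⟨hfm, C, hC⟩ := hf
  obtain ⟨hgm, C', hC'⟩ := hg
  exact ⟨hfm.add hgm, C + C', fun ω => (abs_add_le _ _).trans (add_le_add (hC ω) (hC' ω))⟩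

theorem mul (hf : BddMeas 𝓜 f) (hg : BddMeas 𝓜 g) : BddMeas 𝓜 (fun ω => f ω * g ω) := by
  obtain ⟨hfm, C, hC⟩ := hf
  obtain ⟨hgm, C', hC'⟩ := hg
  refine ⟨hfm.mul hgm, C * C', fun ω => ?_⟩
  rw [abs_mul]
  exact mul_le_mul (hC ω) (hC' ω) (abs_nonneg _) ((abs_nonneg _).trans (hC ω))

theorem neg (hf : BddMeas 𝓜 f) : BddMeas 𝓜 (fun ω => - f ω) :=
  ⟨hf.1.neg, hf.2.imp fun C hC ω => by rw [abs_neg]; exact hC ω⟩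

theorem sub (hf : BddMeas 𝓜 f) (hg : BddMeas 𝓜 g) : BddMeas 𝓜 (fun ω => f ω - g ω) := by
  simpa [sub_eq_add_neg] using hf.add hg.neg

theorem pow (hf : BddMeas 𝓜 f) (n : ℕ) : BddMeas 𝓜 (fun ω => f ω ^ n) := by
  induction n with
  | zero => simpa using const (𝓜 := 𝓜) 1
  | succ n ih => simpa [pow_succ] using ih.mul hf

theorem sum {ι : Type*} {s : Finset ι} {F : ι → Ω → ℝ} (h : ∀ i ∈ s, BddMeas 𝓜 (F i)) :
    BddMeas 𝓜 (fun ω => ∑ i ∈ s, F i ω) := by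
  classical
  induction s using Finset.induction_on with
  | empty => simpa using const (𝓜 := 𝓜) 0
  | insert a s ha ih =>
    simp only [Finset.sum_insert ha]
    exact (h a (Finset.mem_insert_self _ _)).add
      (ih fun i hi => h i (Finset.mem_insert_of_mem hi))

theorem integrable [mΩ : MeasurableSpace Ω] {P : Measure Ω} [IsFiniteMeasure P]
    (hf : BddMeas mΩ f) : Integrable f P := by
  obtain ⟨hm, C, hC⟩ := hf
  exact Integrable.of_bound hm.aestronglyMeasurable C (Eventually.of_forall hC)

end BddMeas

theorem pow_succ_sub_pow_succ_le {a b : ℝ} (hb : 0 ≤ b) (hab : b ≤ a) (p : ℕ) :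
    a ^ (p + 1) - b ^ (p + 1) ≤ (p + 1) * a ^ p * (a - b) := by
  induction p with
  | zero => simp
  | succ p ih =>
    have h1 : b ^ (p + 1) ≤ a ^ (p + 1) := pow_le_pow_left₀ hb hab _
    have h2 : a * (a ^ (p + 1) - b ^ (p + 1)) ≤ a * ((p + 1) * a ^ p * (a - b)) :=
      mul_le_mul_of_nonneg_left ih (hb.trans hab)
    have h3 : (a - b) * b ^ (p + 1) ≤ (a - b) * a ^ (p + 1) :=
      mul_le_mul_of_nonneg_left h1 (sub_nonneg.2 hab)
    have e : a ^ (p + 1 + 1) - b ^ (p + 1 + 1)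
        = a * (a ^ (p + 1) - b ^ (p + 1)) + (a - b) * b ^ (p + 1) := by ring
    rw [e]
    push_cast
    calc _ ≤ a * ((p + 1) * a ^ p * (a - b)) + (a - b) * a ^ (p + 1) := add_le_add h2 h3
      _ = _ := by ring

/-- The second-order Taylor remainder of a power, by induction: raising the exponent multiplies the
remainder by `z + x` and adds one quadratic term. -/
theorem abs_taylor_pow_le (q : ℕ) : ∃ c : ℝ, 0 ≤ c ∧ ∀ z x : ℝ,
    |(z + x) ^ (q + 2) - z ^ (q + 2) - (q + 2) * z ^ (q + 1) * x| ≤ c * (|z| + |x|) ^ q * x ^ 2 := by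
  induction q with
  | zero =>
    refine ⟨1, zero_le_one, fun z x => ?_⟩
    have : (z + x) ^ (0 + 2) - z ^ (0 + 2) - ((0 : ℕ) + 2) * z ^ (0 + 1) * x = x ^ 2 := by
      push_cast; ring
    rw [this]
    simp
  | succ q ih =>
    obtain ⟨c, hc, h⟩ := ih
    refine ⟨c + (q + 2), by positivity, fun z x => ?_⟩
    have e : (z + x) ^ (q + 1 + 2) - z ^ (q + 1 + 2) - ((q + 1 : ℕ) + 2) * z ^ (q + 1 + 1) * x
        = (z + x) * ((z + x) ^ (q + 2) - z ^ (q + 2) - (q + 2) * z ^ (q + 1) * x)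
          + (q + 2) * z ^ (q + 1) * x ^ 2 := by push_cast; ring
    rw [e]
    refine (abs_add_le _ _).trans ?_
    rw [abs_mul, abs_mul, abs_mul, abs_pow z, abs_of_nonneg (sq_nonneg x),
      abs_of_nonneg (by positivity : (0 : ℝ) ≤ q + 2)]
    have h1 : |z + x| * |(z + x) ^ (q + 2) - z ^ (q + 2) - (q + 2) * z ^ (q + 1) * x|
        ≤ (|z| + |x|) * (c * (|z| + |x|) ^ q * x ^ 2) :=
      mul_le_mul (abs_add_le _ _) (h z x) (abs_nonneg _) (by positivity)
    have h2 : |z| ^ (q + 1) ≤ (|z| + |x|) ^ (q + 1) :=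
      pow_le_pow_left₀ (abs_nonneg _) (le_add_of_nonneg_right (abs_nonneg _)) _
    have h3 : (q + 2 : ℝ) * |z| ^ (q + 1) * x ^ 2 ≤ (q + 2) * (|z| + |x|) ^ (q + 1) * x ^ 2 := by
      gcongr
    calc _ ≤ _ := add_le_add h1 h3
      _ = _ := by ring

theorem add_add_two_mul_pow_le {a b c : ℝ} (ha : 0 ≤ a) (hb : 0 ≤ b) (hc : 0 ≤ c) (n : ℕ) :
    (a + b + 2 * c) ^ n ≤ 4 ^ n * (a ^ n + b ^ n + c ^ n) := by
  have key : ∀ t : ℝ, 0 ≤ t → a ≤ t → b ≤ t → c ≤ t → (a + b + 2 * c) ^ n ≤ 4 ^ n * t ^ n := by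
    intro t ht h1 h2 h3
    rw [← mul_pow]
    exact pow_le_pow_left₀ (by positivity) (by linarith) _
  have pa := pow_nonneg ha n
  have pb := pow_nonneg hb n
  have pc := pow_nonneg hc n
  have p4 : (0 : ℝ) ≤ 4 ^ n := by positivity
  rcases le_total a b with h1 | h1 <;> rcases le_total b c with h2 | h2 <;>
    rcases le_total a c with h3 | h3
  all_goals first
    | exact (key c hc h3 h2 le_rfl).trans (mul_le_mul_of_nonneg_left (by linarith) p4)
    | exact (key b hb h1 le_rfl h2).trans (mul_le_mul_of_nonneg_left (by linarith) p4)
    | exact (key a ha le_rfl h1 h3).trans (mul_le_mul_of_nonneg_left (by linarith) p4)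
    | exact (key c hc (by linarith) (by linarith) le_rfl).trans
        (mul_le_mul_of_nonneg_left (by linarith) p4)

/-- A form of Young's inequality: the first summand wins if `y ≤ ε a`, the second otherwise. -/
theorem pow_mul_le_young {a y ε : ℝ} (ha : 0 ≤ a) (hy : 0 ≤ y) (hε : 0 < ε) (p : ℕ) :
    a ^ p * y ≤ ε * a ^ (p + 1) + (1 / ε) ^ p * y ^ (p + 1) := by
  rcases le_total y (ε * a) with h | h
  · have : a ^ p * y ≤ a ^ p * (ε * a) := mul_le_mul_of_nonneg_left h (by positivity)
    have h2 : 0 ≤ (1 / ε) ^ p * y ^ (p + 1) := by positivity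
    calc _ ≤ _ := this
      _ = ε * a ^ (p + 1) := by ring
      _ ≤ _ := le_add_of_nonneg_right h2
  · have h1 : a ≤ 1 / ε * y := by
      rw [one_div, ← div_eq_inv_mul, le_div_iff₀ hε]; linarith
    have h2 : a ^ p * y ≤ (1 / ε * y) ^ p * y :=
      mul_le_mul_of_nonneg_right (pow_le_pow_left₀ ha h1 _) hy
    calc _ ≤ _ := h2
      _ = (1 / ε) ^ p * y ^ (p + 1) := by rw [mul_pow]; ring
      _ ≤ _ := le_add_of_nonneg_left (by positivity)

/-- Bounded reverse martingale differences `ξ_k` with respect to a decreasing sequence of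
σ-algebras `𝓖 k`. -/
structure IsRevMartDiff {Ω : Type*} [mΩ : MeasurableSpace Ω] (P : Measure Ω)
    (𝓖 : ℕ → MeasurableSpace Ω) (ξ : ℕ → Ω → ℝ) (D : ℝ) : Prop where
  anti : Antitone 𝓖
  le : ∀ k, 𝓖 k ≤ mΩ
  meas : ∀ k, Measurable[𝓖 k] (ξ k)
  bound : ∀ k ω, |ξ k ω| ≤ D
  orth : ∀ k (g : Ω → ℝ), BddMeas (𝓖 (k + 1)) g → ∫ ω, ξ k ω * g ω ∂P = 0

/-- Partial sums. -/
def psum {Ω : Type*} (ξ : ℕ → Ω → ℝ) (n : ℕ) (ω : Ω) : ℝ := ∑ i ∈ Finset.range n, ξ i ω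

/-- Partial sums of squares. -/
def qsum {Ω : Type*} (ξ : ℕ → Ω → ℝ) (n : ℕ) (ω : Ω) : ℝ := ∑ i ∈ Finset.range n, ξ i ω ^ 2

theorem qsum_nonneg {Ω : Type*} (ξ : ℕ → Ω → ℝ) (n : ℕ) (ω : Ω) : 0 ≤ qsum ξ n ω :=
  Finset.sum_nonneg fun _ _ => sq_nonneg _

/-! ### Moment inequalities for reverse martingales. -/

namespace IsRevMartDiff

universe u

variable {Ω : Type*} [mΩ : MeasurableSpace Ω] {P : Measure Ω}
  {𝓖 : ℕ → MeasurableSpace Ω} {ξ : ℕ → Ω → ℝ} {D : ℝ}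

theorem bddMeas_of_le (h : IsRevMartDiff P 𝓖 ξ D) {k n : ℕ} (hk : n ≤ k) : BddMeas (𝓖 n) (ξ k) :=
  BddMeas.mono (h.anti hk) ⟨h.meas k, D, h.bound k⟩

theorem bddMeas (h : IsRevMartDiff P 𝓖 ξ D) (k : ℕ) : BddMeas mΩ (ξ k) :=
  (h.bddMeas_of_le le_rfl).mono (h.le k)

theorem bddMeas_psum (h : IsRevMartDiff P 𝓖 ξ D) (n : ℕ) : BddMeas mΩ (psum ξ n) :=
  BddMeas.sum fun i _ => h.bddMeas i

theorem bddMeas_qsum (h : IsRevMartDiff P 𝓖 ξ D) (n : ℕ) : BddMeas mΩ (qsum ξ n) :=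
  BddMeas.sum fun i _ => (h.bddMeas i).pow 2

theorem bddMeas_psum_sub (h : IsRevMartDiff P 𝓖 ξ D) {i k : ℕ} (hik : i ≤ k) :
    BddMeas (𝓖 i) (fun ω => psum ξ k ω - psum ξ i ω) := by
  have : (fun ω => psum ξ k ω - psum ξ i ω) = fun ω => ∑ l ∈ Finset.Ico i k, ξ l ω := by
    ext ω
    simp only [psum]
    rw [Finset.sum_Ico_eq_sub _ hik]
  rw [this]
  exact BddMeas.sum fun l hl => h.bddMeas_of_le (Finset.mem_Ico.1 hl).1

variable [IsProbabilityMeasure P]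

theorem integral_psum_mul (h : IsRevMartDiff P 𝓖 ξ D) {n : ℕ} {g : Ω → ℝ} (hg : BddMeas (𝓖 n) g) :
    ∫ ω, psum ξ n ω * g ω ∂P = 0 := by
  have hg' := hg.mono (h.le n)
  simp only [psum, Finset.sum_mul]
  rw [integral_finsetSum _ fun i _ => ((h.bddMeas i).mul hg').integrable]
  refine Finset.sum_eq_zero fun i hi => ?_
  exact h.orth i g (hg.mono (h.anti (Finset.mem_range.1 hi)))

/-- In the expansion of the square, `ξ n * g` is `𝓖 n`-measurable and therefore orthogonal to `psum
ξ n`, so the cross terms vanish. -/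
theorem integral_psum_sq_mul (h : IsRevMartDiff P 𝓖 ξ D) {n : ℕ} {g : Ω → ℝ} (hg : BddMeas (𝓖 n) g) :
    ∫ ω, psum ξ n ω ^ 2 * g ω ∂P = ∫ ω, qsum ξ n ω * g ω ∂P := by
  induction n with
  | zero => simp [psum, qsum]
  | succ n ih =>
    have hgn := hg.mono (h.anti n.le_succ)
    have hg' := hg.mono (h.le (n + 1))
    have hx := h.bddMeas n
    have hR := h.bddMeas_psum n
    have hA := h.bddMeas_qsum n
    have e1 : ∀ ω, psum ξ (n + 1) ω ^ 2 * g ω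
        = psum ξ n ω ^ 2 * g ω + (2 * (psum ξ n ω * (ξ n ω * g ω)) + ξ n ω ^ 2 * g ω) := by
      intro ω; simp only [psum, Finset.sum_range_succ]; ring
    have e2 : ∀ ω, qsum ξ (n + 1) ω * g ω = qsum ξ n ω * g ω + ξ n ω ^ 2 * g ω := by
      intro ω; simp only [qsum, Finset.sum_range_succ]; ring
    simp only [e1, e2]
    have i1 := ((hR.pow 2).mul hg').integrable (P := P)
    have i2 := ((BddMeas.const 2).mul (hR.mul (hx.mul hg'))).integrable (P := P)
    have i3 := ((hx.pow 2).mul hg').integrable (P := P)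
    have i4 := (hA.mul hg').integrable (P := P)
    rw [integral_add i1 (i2.fun_add i3), integral_add i2 i3, integral_add i4 i3, ih hgn,
      integral_const_mul, h.integral_psum_mul ((h.bddMeas_of_le le_rfl).mul hgn)]
    ring

/-- Moments of the square function are controlled by its conditional expectations. -/
theorem integral_qsum_pow_mul_le (p : ℕ) : ∃ C : ℝ, 0 ≤ C ∧
    ∀ {Ω : Type u} [MeasurableSpace Ω] {P : Measure Ω} [IsProbabilityMeasure P]
      {𝓖 : ℕ → MeasurableSpace Ω} {ξ : ℕ → Ω → ℝ} {D : ℝ}, IsRevMartDiff P 𝓖 ξ D →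
      ∀ (N : ℕ) (B : ℝ), D ^ 2 ≤ B →
      (∀ k ≤ N, ∀ g : Ω → ℝ, BddMeas (𝓖 k) g → (∀ ω, 0 ≤ g ω) →
        ∫ ω, qsum ξ k ω * g ω ∂P ≤ B * ∫ ω, g ω ∂P) →
      ∀ k ≤ N, ∀ g : Ω → ℝ, BddMeas (𝓖 k) g → (∀ ω, 0 ≤ g ω) →
        ∫ ω, qsum ξ k ω ^ p * g ω ∂P ≤ C * B ^ p * ∫ ω, g ω ∂P := by
  induction p with
  | zero => exact ⟨1, zero_le_one, fun _ _ _ _ _ k _ g _ _ => by simp⟩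
  | succ p ih =>
    obtain ⟨C, hC, ih⟩ := ih
    refine ⟨(p + 1) * 2 ^ (p - 1) * (C + 1), by positivity, ?_⟩
    intro Ω mΩ P _ 𝓖 ξ D h N B hDB hB k hk g hg hg0
    have hB0 : 0 ≤ B := (sq_nonneg D).trans hDB
    have hg' := hg.mono (h.le k)
    have hξB : ∀ i ω, ξ i ω ^ 2 ≤ B := fun i ω =>
      (sq_le_sq' (by linarith [neg_abs_le (ξ i ω), h.bound i ω])
        (by linarith [le_abs_self (ξ i ω), h.bound i ω])).trans hDB
    set c : ℝ := (p + 1) * 2 ^ (p - 1) with hc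
    have hc0 : 0 ≤ c := by positivity
    -- Telescoping in `i` leaves `qsum ξ (i + 1) ^ p * ξ i ^ 2`; splitting off the last square from
    -- the power costs the factor `2 ^ (p - 1)` and the term `B ^ p`.
    have hpt : ∀ ω, qsum ξ k ω ^ (p + 1) * g ω ≤
        ∑ i ∈ Finset.range k, (c * (qsum ξ i ω ^ p * (ξ i ω ^ 2 * g ω))
          + c * B ^ p * (ξ i ω ^ 2 * g ω)) := by
      intro ω
      have tel : qsum ξ k ω ^ (p + 1) = ∑ i ∈ Finset.range k,
          (qsum ξ (i + 1) ω ^ (p + 1) - qsum ξ i ω ^ (p + 1)) := by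
        rw [Finset.sum_range_sub (fun i => qsum ξ i ω ^ (p + 1))]
        simp [qsum]
      rw [tel, Finset.sum_mul]
      refine Finset.sum_le_sum fun i _ => ?_
      have e : qsum ξ (i + 1) ω = qsum ξ i ω + ξ i ω ^ 2 := by
        simp [qsum, Finset.sum_range_succ]
      have q0 := qsum_nonneg ξ i ω
      have x0 := sq_nonneg (ξ i ω)
      have h1 := pow_succ_sub_pow_succ_le q0 (by linarith : qsum ξ i ω ≤ qsum ξ (i + 1) ω) p
      have h2 : qsum ξ (i + 1) ω ^ p ≤ 2 ^ (p - 1) * (qsum ξ i ω ^ p + B ^ p) := by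
        rw [e]
        refine (add_pow_le q0 x0 p).trans ?_
        have := pow_le_pow_left₀ x0 (hξB i ω) p
        gcongr
      have h3 : qsum ξ (i + 1) ω - qsum ξ i ω = ξ i ω ^ 2 := by rw [e]; ring
      rw [h3] at h1
      have h4 : ((p : ℝ) + 1) * qsum ξ (i + 1) ω ^ p * ξ i ω ^ 2 ≤
          (p + 1) * (2 ^ (p - 1) * (qsum ξ i ω ^ p + B ^ p)) * ξ i ω ^ 2 := by gcongr
      calc _ ≤ ((p + 1) * (2 ^ (p - 1) * (qsum ξ i ω ^ p + B ^ p)) * ξ i ω ^ 2) * g ω :=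
            mul_le_mul_of_nonneg_right (h1.trans h4) (hg0 ω)
        _ = _ := by rw [hc]; ring
    have bx : ∀ i, BddMeas mΩ fun ω => ξ i ω ^ 2 * g ω := fun i => ((h.bddMeas i).pow 2).mul hg'
    have b1 : ∀ i, Integrable (fun ω => c * (qsum ξ i ω ^ p * (ξ i ω ^ 2 * g ω))) P := fun i =>
      ((BddMeas.const c).mul (((h.bddMeas_qsum i).pow p).mul (bx i))).integrable
    have b2 : ∀ i, Integrable (fun ω => c * B ^ p * (ξ i ω ^ 2 * g ω)) P := fun i =>
      ((BddMeas.const (c * B ^ p)).mul (bx i)).integrable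
    have hsum : ∑ i ∈ Finset.range k, ∫ ω, ξ i ω ^ 2 * g ω ∂P ≤ B * ∫ ω, g ω ∂P := by
      refine le_trans (le_of_eq ?_) (hB k hk g hg hg0)
      rw [← integral_finsetSum _ fun i _ => (bx i).integrable]
      simp only [qsum, Finset.sum_mul]
    calc ∫ ω, qsum ξ k ω ^ (p + 1) * g ω ∂P
        ≤ ∫ ω, ∑ i ∈ Finset.range k, (c * (qsum ξ i ω ^ p * (ξ i ω ^ 2 * g ω))
          + c * B ^ p * (ξ i ω ^ 2 * g ω)) ∂P :=
          integral_mono (((h.bddMeas_qsum k).pow _).mul hg').integrable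
            (integrable_finsetSum _ fun i _ => (b1 i).add (b2 i)) hpt
      _ = ∑ i ∈ Finset.range k, (c * ∫ ω, qsum ξ i ω ^ p * (ξ i ω ^ 2 * g ω) ∂P
          + c * B ^ p * ∫ ω, ξ i ω ^ 2 * g ω ∂P) := by
          rw [integral_finsetSum _ fun i _ => (b1 i).fun_add (b2 i)]
          refine Finset.sum_congr rfl fun i _ => ?_
          rw [integral_add (b1 i) (b2 i), integral_const_mul, integral_const_mul]
      _ ≤ ∑ i ∈ Finset.range k, (c * (C * B ^ p * ∫ ω, ξ i ω ^ 2 * g ω ∂P)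
          + c * B ^ p * ∫ ω, ξ i ω ^ 2 * g ω ∂P) := by
          refine Finset.sum_le_sum fun i hi => ?_
          have hik := (Finset.mem_range.1 hi).le
          -- The weight `ξ i ^ 2 * g` is nonnegative and `𝓖 i`-measurable, hence a legitimate test
          -- function at time `i`. Summing these weights over `i` then uses `hB` once more.
          have := ih h N B hDB hB i (hik.trans hk) _
            (((h.bddMeas_of_le le_rfl).pow 2).mul (hg.mono (h.anti hik)))
            (fun ω => mul_nonneg (sq_nonneg _) (hg0 ω))
          gcongr
      _ = c * (C + 1) * B ^ p * ∑ i ∈ Finset.range k, ∫ ω, ξ i ω ^ 2 * g ω ∂P := by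
          rw [Finset.mul_sum]
          exact Finset.sum_congr rfl fun i _ => by ring
      _ ≤ c * (C + 1) * B ^ p * (B * ∫ ω, g ω ∂P) := by gcongr
      _ = _ := by ring

/-- Even moments of the partial sums are controlled by conditional second moments. -/
theorem integral_psum_pow_mul_le (p : ℕ) : ∃ C : ℝ, 0 ≤ C ∧
    ∀ {Ω : Type u} [MeasurableSpace Ω] {P : Measure Ω} [IsProbabilityMeasure P]
      {𝓖 : ℕ → MeasurableSpace Ω} {ξ : ℕ → Ω → ℝ} {D : ℝ}, IsRevMartDiff P 𝓖 ξ D →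
      ∀ (N : ℕ) (B : ℝ), D ^ 2 ≤ B →
      (∀ k ≤ N, ∀ g : Ω → ℝ, BddMeas (𝓖 k) g → (∀ ω, 0 ≤ g ω) →
        ∫ ω, qsum ξ k ω * g ω ∂P ≤ B * ∫ ω, g ω ∂P) →
      ∀ k ≤ N, ∀ g : Ω → ℝ, BddMeas (𝓖 k) g → (∀ ω, 0 ≤ g ω) →
        ∫ ω, psum ξ k ω ^ (2 * p) * g ω ∂P ≤ C * B ^ p * ∫ ω, g ω ∂P := by
  induction p with
  | zero => exact ⟨1, zero_le_one, fun _ _ _ _ _ k _ g _ _ => by simp⟩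
  | succ p ih =>
    obtain ⟨C, hC, ih⟩ := ih
    obtain ⟨t, ht, tay⟩ := abs_taylor_pow_le (2 * p)
    obtain ⟨a, ha, hA⟩ := integral_qsum_pow_mul_le.{u} (p + 1)
    -- The Taylor constant times the cost of `add_add_two_mul_pow_le`; `t + 1` instead of `t` makes
    -- `c` positive, since it is inverted below.
    set c : ℝ := (t + 1) * 4 ^ (2 * p) with hc
    have hc0 : 0 < c := by positivity
    refine ⟨2 * (c * ((2 * c) ^ p * a) + c * (C + 1)), by positivity, ?_⟩
    intro Ω mΩ P _ 𝓖 ξ D h N B hDB hB k hk g hg hg0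
    have hB0 : 0 ≤ B := (sq_nonneg D).trans hDB
    have hg' := hg.mono (h.le k)
    have hξB : ∀ i ω, ξ i ω ^ 2 ≤ B := fun i ω =>
      (sq_le_sq' (by linarith [neg_abs_le (ξ i ω), h.bound i ω])
        (by linarith [le_abs_self (ξ i ω), h.bound i ω])).trans hDB
    -- The sum of `ξ l` over `i ≤ l < k` is `𝓖 i`-measurable, unlike `psum ξ i`. The power of `psum
    -- ξ k` is telescoped along these tails, with a Taylor expansion of `Z i = Z (i + 1) + ξ i` at
    -- `Z (i + 1)`.
    set Z : ℕ → Ω → ℝ := fun i ω => psum ξ k ω - psum ξ i ω with hZ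
    have hpt : ∀ ω, psum ξ k ω ^ (2 * (p + 1)) * g ω ≤
        ∑ i ∈ Finset.range k, ((2 * p + 2 : ℝ) * (ξ i ω * (Z (i + 1) ω ^ (2 * p + 1) * g ω))
          + c * (psum ξ k ω ^ (2 * p) * (ξ i ω ^ 2 * g ω))
          + c * (psum ξ i ω ^ (2 * p) * (ξ i ω ^ 2 * g ω))
          + c * B ^ p * (ξ i ω ^ 2 * g ω)) := by
      intro ω
      have tel : psum ξ k ω ^ (2 * p + 2) = ∑ i ∈ Finset.range k,
          (Z i ω ^ (2 * p + 2) - Z (i + 1) ω ^ (2 * p + 2)) := by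
        rw [Finset.sum_range_sub' (fun i => Z i ω ^ (2 * p + 2))]
        simp [hZ, psum]
      rw [show 2 * (p + 1) = 2 * p + 2 by ring, tel, Finset.sum_mul]
      refine Finset.sum_le_sum fun i _ => ?_
      have e : Z i ω = Z (i + 1) ω + ξ i ω := by
        simp only [hZ, psum, Finset.sum_range_succ]
        ring
      have h1 := (le_abs_self _).trans (tay (Z (i + 1) ω) (ξ i ω))
      rw [← e] at h1
      push_cast at h1
      have h2 : |Z (i + 1) ω| + |ξ i ω| ≤ |psum ξ k ω| + |psum ξ i ω| + 2 * |ξ i ω| := by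
        have e' : Z (i + 1) ω = psum ξ k ω - psum ξ i ω - ξ i ω := by
          have : Z i ω = psum ξ k ω - psum ξ i ω := rfl
          linarith
        rw [e']
        have := abs_sub (psum ξ k ω - psum ξ i ω) (ξ i ω)
        have := abs_sub (psum ξ k ω) (psum ξ i ω)
        linarith
      have h3 : (|Z (i + 1) ω| + |ξ i ω|) ^ (2 * p) ≤
          4 ^ (2 * p) * (psum ξ k ω ^ (2 * p) + psum ξ i ω ^ (2 * p) + B ^ p) := by
        refine (pow_le_pow_left₀ (by positivity) h2 _).trans
          ((add_add_two_mul_pow_le (abs_nonneg _) (abs_nonneg _) (abs_nonneg _) _).trans ?_)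
        have e1 : |psum ξ k ω| ^ (2 * p) = psum ξ k ω ^ (2 * p) := Even.pow_abs (even_two_mul p) _
        have e2 : |psum ξ i ω| ^ (2 * p) = psum ξ i ω ^ (2 * p) := Even.pow_abs (even_two_mul p) _
        have e3 : |ξ i ω| ^ (2 * p) = (ξ i ω ^ 2) ^ p := by
          rw [Even.pow_abs (even_two_mul p), pow_mul]
        rw [e1, e2, e3]
        have := pow_le_pow_left₀ (sq_nonneg (ξ i ω)) (hξB i ω) p
        gcongr
      have h4 : t * (|Z (i + 1) ω| + |ξ i ω|) ^ (2 * p) * ξ i ω ^ 2 ≤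
          (t + 1) * (4 ^ (2 * p) * (psum ξ k ω ^ (2 * p) + psum ξ i ω ^ (2 * p) + B ^ p))
            * ξ i ω ^ 2 := by
        gcongr
        linarith
      have h5 := mul_le_mul_of_nonneg_right (h1.trans h4) (hg0 ω)
      rw [hc]
      linarith
    have bx : ∀ i, BddMeas mΩ fun ω => ξ i ω ^ 2 * g ω := fun i => ((h.bddMeas i).pow 2).mul hg'
    have hR := h.bddMeas_psum
    have bZ : ∀ i, BddMeas mΩ (Z i) := fun i => (hR k).sub (hR i)
    have b0 : ∀ i, Integrable
        (fun ω => (2 * p + 2 : ℝ) * (ξ i ω * (Z (i + 1) ω ^ (2 * p + 1) * g ω))) P := fun i =>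
      ((BddMeas.const _).mul ((h.bddMeas i).mul (((bZ (i + 1)).pow _).mul hg'))).integrable
    have b1 : ∀ i, Integrable (fun ω => c * (psum ξ k ω ^ (2 * p) * (ξ i ω ^ 2 * g ω))) P :=
      fun i => ((BddMeas.const c).mul (((hR k).pow _).mul (bx i))).integrable
    have b2 : ∀ i, Integrable (fun ω => c * (psum ξ i ω ^ (2 * p) * (ξ i ω ^ 2 * g ω))) P :=
      fun i => ((BddMeas.const c).mul (((hR i).pow _).mul (bx i))).integrable
    have b3 : ∀ i, Integrable (fun ω => c * B ^ p * (ξ i ω ^ 2 * g ω)) P := fun i =>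
      ((BddMeas.const (c * B ^ p)).mul (bx i)).integrable
    have bRA : BddMeas mΩ fun ω => psum ξ k ω ^ (2 * p) * (qsum ξ k ω * g ω) :=
      ((hR k).pow _).mul ((h.bddMeas_qsum k).mul hg')
    have bR : BddMeas mΩ fun ω => psum ξ k ω ^ (2 * (p + 1)) * g ω := ((hR k).pow _).mul hg'
    have bA : BddMeas mΩ fun ω => qsum ξ k ω ^ (p + 1) * g ω :=
      ((h.bddMeas_qsum k).pow _).mul hg'
    have hsum : ∑ i ∈ Finset.range k, ∫ ω, ξ i ω ^ 2 * g ω ∂P ≤ B * ∫ ω, g ω ∂P := by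
      refine le_trans (le_of_eq ?_) (hB k hk g hg hg0)
      rw [← integral_finsetSum _ fun i _ => (bx i).integrable]
      simp only [qsum, Finset.sum_mul]
    have hsum2 : ∑ i ∈ Finset.range k, ∫ ω, psum ξ k ω ^ (2 * p) * (ξ i ω ^ 2 * g ω) ∂P
        = ∫ ω, psum ξ k ω ^ (2 * p) * (qsum ξ k ω * g ω) ∂P := by
      rw [← integral_finsetSum _ fun i _ => (((hR k).pow _).mul (bx i)).integrable]
      simp only [qsum, Finset.sum_mul, Finset.mul_sum]
    have main : ∫ ω, psum ξ k ω ^ (2 * (p + 1)) * g ω ∂P ≤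
        c * ∫ ω, psum ξ k ω ^ (2 * p) * (qsum ξ k ω * g ω) ∂P
          + c * (C + 1) * B ^ p * (B * ∫ ω, g ω ∂P) := by
      calc _ ≤ ∫ ω, ∑ i ∈ Finset.range k,
            ((2 * p + 2 : ℝ) * (ξ i ω * (Z (i + 1) ω ^ (2 * p + 1) * g ω))
            + c * (psum ξ k ω ^ (2 * p) * (ξ i ω ^ 2 * g ω))
            + c * (psum ξ i ω ^ (2 * p) * (ξ i ω ^ 2 * g ω))
            + c * B ^ p * (ξ i ω ^ 2 * g ω)) ∂P :=
            integral_mono bR.integrable (integrable_finsetSum _ fun i _ =>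
              (((b0 i).add (b1 i)).add (b2 i)).add (b3 i)) hpt
        _ = ∑ i ∈ Finset.range k, (c * ∫ ω, psum ξ k ω ^ (2 * p) * (ξ i ω ^ 2 * g ω) ∂P
            + c * ∫ ω, psum ξ i ω ^ (2 * p) * (ξ i ω ^ 2 * g ω) ∂P
            + c * B ^ p * ∫ ω, ξ i ω ^ 2 * g ω ∂P) := by
            rw [integral_finsetSum _ fun i _ => (((b0 i).fun_add (b1 i)).fun_add (b2 i)).fun_add (b3 i)]
            refine Finset.sum_congr rfl fun i hi => ?_
            have hik := Finset.mem_range.1 hi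
            -- The linear Taylor term integrates to zero, because `Z (i + 1) ^ (2 * p + 1) * g` is
            -- `𝓖 (i + 1)`-measurable.
            rw [integral_add (((b0 i).fun_add (b1 i)).fun_add (b2 i)) (b3 i),
              integral_add ((b0 i).fun_add (b1 i)) (b2 i), integral_add (b0 i) (b1 i),
              integral_const_mul, integral_const_mul, integral_const_mul, integral_const_mul,
              h.orth i _ (((h.bddMeas_psum_sub hik).pow _).mul (hg.mono (h.anti hik)))]
            ring
        _ ≤ ∑ i ∈ Finset.range k, (c * ∫ ω, psum ξ k ω ^ (2 * p) * (ξ i ω ^ 2 * g ω) ∂P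
            + c * (C * B ^ p * ∫ ω, ξ i ω ^ 2 * g ω ∂P)
            + c * B ^ p * ∫ ω, ξ i ω ^ 2 * g ω ∂P) := by
            refine Finset.sum_le_sum fun i hi => ?_
            have hik := (Finset.mem_range.1 hi).le
            have := ih h N B hDB hB i (hik.trans hk) _
              (((h.bddMeas_of_le le_rfl).pow 2).mul (hg.mono (h.anti hik)))
              (fun ω => mul_nonneg (sq_nonneg _) (hg0 ω))
            gcongr
        _ = c * ∑ i ∈ Finset.range k, ∫ ω, psum ξ k ω ^ (2 * p) * (ξ i ω ^ 2 * g ω) ∂P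
            + c * (C + 1) * B ^ p * ∑ i ∈ Finset.range k, ∫ ω, ξ i ω ^ 2 * g ω ∂P := by
            rw [Finset.mul_sum, Finset.mul_sum, ← Finset.sum_add_distrib]
            exact Finset.sum_congr rfl fun i _ => by ring
        _ ≤ _ := by rw [hsum2]; gcongr
    -- With `ε = 1 / (2 * c)`, half of the left side of `main` reappears on the right and is
    -- absorbed; the rest is a moment of `qsum`, already controlled.
    have young : ∫ ω, psum ξ k ω ^ (2 * p) * (qsum ξ k ω * g ω) ∂P ≤
        (1 / (2 * c)) * ∫ ω, psum ξ k ω ^ (2 * (p + 1)) * g ω ∂P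
          + (2 * c) ^ p * ∫ ω, qsum ξ k ω ^ (p + 1) * g ω ∂P := by
      rw [← integral_const_mul, ← integral_const_mul, ← integral_add
        ((BddMeas.const _).mul bR).integrable ((BddMeas.const _).mul bA).integrable]
      refine integral_mono bRA.integrable (((BddMeas.const _).mul bR).add
        ((BddMeas.const _).mul bA)).integrable fun ω => ?_
      have := pow_mul_le_young (sq_nonneg (psum ξ k ω)) (qsum_nonneg ξ k ω)
        (by positivity : (0 : ℝ) < 1 / (2 * c)) p
      rw [← pow_mul, ← pow_mul, one_div_one_div] at this
      have := mul_le_mul_of_nonneg_right this (hg0 ω)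
      simp only
      linarith
    have hA' := hA h N B hDB hB k hk g hg hg0
    have h1 : c * ∫ ω, psum ξ k ω ^ (2 * p) * (qsum ξ k ω * g ω) ∂P ≤
        c * ((1 / (2 * c)) * ∫ ω, psum ξ k ω ^ (2 * (p + 1)) * g ω ∂P
          + (2 * c) ^ p * (a * B ^ (p + 1) * ∫ ω, g ω ∂P)) := by
      refine mul_le_mul_of_nonneg_left (young.trans ?_) hc0.le
      gcongr
    have e : c * ((1 / (2 * c)) * ∫ ω, psum ξ k ω ^ (2 * (p + 1)) * g ω ∂P
          + (2 * c) ^ p * (a * B ^ (p + 1) * ∫ ω, g ω ∂P)) =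
        (1 / 2) * ∫ ω, psum ξ k ω ^ (2 * (p + 1)) * g ω ∂P
          + c * ((2 * c) ^ p * a) * (B ^ (p + 1) * ∫ ω, g ω ∂P) := by
      field_simp
    have e2 : c * (C + 1) * B ^ p * (B * ∫ ω, g ω ∂P)
        = c * (C + 1) * (B ^ (p + 1) * ∫ ω, g ω ∂P) := by ring
    rw [e] at h1
    rw [e2] at main
    linarith

end IsRevMartDiff

end SeqLivsic

/-! ### Bounded variances and almost sure convergence. -/

namespace SeqLivsic

/-- Tightness of a single finite function: its superlevel sets decrease to the empty set. -/
theorem exists_measureReal_le_sq_lt {Ω : Type*} [MeasurableSpace Ω] {P : Measure Ω}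
    [IsProbabilityMeasure P] {G : Ω → ℝ} (hG : Measurable G) {ε : ℝ} (hε : 0 < ε) :
    ∃ L : ℝ, 0 < L ∧ P.real {ω | L ≤ G ω ^ 2} < ε := by
  have hanti : Antitone fun n : ℕ => {ω | (n : ℝ) + 1 ≤ G ω ^ 2} := by
    intro a b hab ω hω
    have : (a : ℝ) ≤ b := by exact_mod_cast hab
    simp only [Set.mem_ofPred_eq] at hω ⊢
    linarith
  have hempty : ⋂ n : ℕ, {ω | (n : ℝ) + 1 ≤ G ω ^ 2} = ∅ := by
    ext ω
    simp only [Set.mem_iInter, Set.mem_ofPred_eq, Set.mem_empty_iff_false, iff_false, not_forall,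
      not_le]
    obtain ⟨n, hn⟩ := exists_nat_gt (G ω ^ 2)
    exact ⟨n, by linarith⟩
  have ht := tendsto_measure_iInter_atTop (μ := P)
    (fun n : ℕ => (measurableSet_le measurable_const (hG.pow_const 2) :
      MeasurableSet {ω | (n : ℝ) + 1 ≤ G ω ^ 2}).nullMeasurableSet)
    hanti ⟨0, measure_ne_top _ _⟩
  rw [hempty, measure_empty] at ht
  have ht' : Tendsto (fun n : ℕ => P.real {ω | (n : ℝ) + 1 ≤ G ω ^ 2}) atTop (𝓝 0) := by
    simpa [Measure.real, Function.comp_def] using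
      (ENNReal.tendsto_toReal ENNReal.zero_ne_top).comp ht
  obtain ⟨n, hn⟩ := (ht'.eventually_lt_const hε).exists
  exact ⟨n + 1, by positivity, hn⟩

namespace IsRevMartDiff

variable {Ω : Type*} [mΩ : MeasurableSpace Ω] {P : Measure Ω} [IsProbabilityMeasure P]
  {𝓖 : ℕ → MeasurableSpace Ω} {ξ : ℕ → Ω → ℝ} {D : ℝ}

theorem integral_qsum_mono (h : IsRevMartDiff P 𝓖 ξ D) {k n : ℕ} (hkn : k ≤ n) :
    ∫ ω, qsum ξ k ω ∂P ≤ ∫ ω, qsum ξ n ω ∂P := by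
  refine integral_mono (h.bddMeas_qsum k).integrable (h.bddMeas_qsum n).integrable fun ω => ?_
  exact Finset.sum_le_sum_of_subset_of_nonneg (Finset.range_mono hkn) fun _ _ _ => sq_nonneg _

/-- If a bounded reverse martingale is a coboundary and its conditional variances are comparable to
its variances, then the variances are bounded. -/
theorem exists_integral_qsum_le (h : IsRevMartDiff P 𝓖 ξ D) {s : ℝ} (hs : 0 ≤ s)
    (hvar : ∀ n (g : Ω → ℝ), BddMeas (𝓖 n) g → (∀ ω, 0 ≤ g ω) →
      |∫ ω, qsum ξ n ω * g ω ∂P - (∫ ω, qsum ξ n ω ∂P) * ∫ ω, g ω ∂P| ≤ s * ∫ ω, g ω ∂P)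
    {G : Ω → ℝ} (hG : Measurable G) {Y : ℕ → Ω → ℝ} (hY : ∀ n, Measurable[𝓖 n] (Y n))
    (hGY : ∀ n, ∀ᵐ ω ∂P, G ω = Y n ω - psum ξ n ω) :
    ∃ B, ∀ n, ∫ ω, qsum ξ n ω ∂P ≤ B := by
  obtain ⟨C, hC, hmom⟩ := integral_psum_pow_mul_le 2
  -- `κ` bounds the normalised fourth moment in `up`, and `1 / (16 * κ)` is the lower bound on the
  -- probability that `hind` yields.
  set κ : ℝ := 8 * (1 + 4 * C) with hκ
  have hκ0 : 0 < κ := by positivity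
  obtain ⟨L, hL, hPL⟩ := exists_measureReal_le_sq_lt (P := P) hG
    (by positivity : (0 : ℝ) < 1 / (16 * κ))
  -- A variance `v` above this value satisfies `L / v ≤ 1 / 4`, `v - s ≥ v / 2`, and `D ^ 2 ≤ 2 *
  -- v`, the three facts needed for the contradiction.
  refine ⟨4 * L + 2 * s + D ^ 2 + 1, fun n => ?_⟩
  by_contra! hcon
  set v : ℝ := ∫ ω, qsum ξ n ω ∂P with hv
  have hD := sq_nonneg D
  have hv0 : 0 < v := by linarith
  set X : Ω → ℝ := fun ω => Y n ω - psum ξ n ω with hX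
  -- Normalisation by the approximate conditional second moment `v + Y ^ 2` of `X = Y - psum`. It is
  -- `𝓖 n`-measurable, and it makes the products with the possibly unbounded `Y` bounded, hence
  -- integrable.
  set w : Ω → ℝ := fun ω => 1 / (v + Y n ω ^ 2) with hw
  have hden : ∀ ω, 0 < v + Y n ω ^ 2 := fun ω => by positivity
  have hw0 : ∀ ω, 0 ≤ w ω := fun ω => by have := hden ω; positivity
  have hwv : ∀ ω, v * w ω + Y n ω ^ 2 * w ω = 1 := fun ω => by
    have := (hden ω).ne'
    simp only [hw]; field_simp
  have hYw0 : ∀ ω, 0 ≤ Y n ω ^ 2 * w ω := fun ω => mul_nonneg (sq_nonneg _) (hw0 ω)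
  have hvw0 : ∀ ω, 0 ≤ v * w ω := fun ω => mul_nonneg hv0.le (hw0 ω)
  have mY := hY n
  have mw : Measurable[𝓖 n] w := (measurable_const.add (mY.pow_const 2)).const_div 1
  have bw : BddMeas (𝓖 n) w := by
    refine ⟨mw, 1 / v, fun ω => ?_⟩
    rw [abs_of_nonneg (hw0 ω), le_div_iff₀ hv0]
    linarith [hwv ω, hYw0 ω]
  have bY2 : BddMeas (𝓖 n) fun ω => Y n ω ^ 2 * w ω := by
    refine ⟨(mY.pow_const 2).mul mw, 1, fun ω => ?_⟩
    rw [abs_of_nonneg (hYw0 ω)]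
    linarith [hwv ω, hvw0 ω]
  have bY : BddMeas (𝓖 n) fun ω => Y n ω * w ω := by
    refine ⟨mY.mul mw, 1 / v + 1, fun ω => ?_⟩
    rw [abs_mul, abs_of_nonneg (hw0 ω)]
    have h1 : |Y n ω| ≤ 1 + Y n ω ^ 2 := by
      rw [← sq_abs]; nlinarith [sq_nonneg (|Y n ω| - 1)]
    have h2 : w ω ≤ 1 / v := by
      rw [le_div_iff₀ hv0]; linarith [hwv ω, hYw0 ω]
    nlinarith [mul_le_mul_of_nonneg_right h1 (hw0 ω), hwv ω, hvw0 ω]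
  have bw' := bw.mono (h.le n)
  have bY2' := bY2.mono (h.le n)
  have bY' := bY.mono (h.le n)
  have bR := h.bddMeas_psum n
  have bXw : BddMeas mΩ fun ω => X ω ^ 2 * w ω := by
    have : (fun ω => X ω ^ 2 * w ω) = fun ω => (Y n ω ^ 2 * w ω
        - 2 * (psum ξ n ω * (Y n ω * w ω))) + psum ξ n ω ^ 2 * w ω := by
      ext ω; simp only [hX]; ring
    rw [this]
    exact (bY2'.sub ((BddMeas.const 2).mul (bR.mul bY'))).add ((bR.pow 2).mul bw')
  -- Given `𝓖 n` the cross term vanishes and `psum ^ 2` can be replaced by `qsum`, whose conditional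
  -- mean is at least `v - s ≥ v / 2`.
  have low : 1 / 2 ≤ ∫ ω, X ω ^ 2 * w ω ∂P := by
    have e : ∀ ω, X ω ^ 2 * w ω = (Y n ω ^ 2 * w ω
        - 2 * (psum ξ n ω * (Y n ω * w ω))) + psum ξ n ω ^ 2 * w ω := by
      intro ω; simp only [hX]; ring
    simp only [e]
    rw [integral_add (bY2'.sub ((BddMeas.const 2).mul (bR.mul bY'))).integrable
      ((bR.pow 2).mul bw').integrable, integral_sub bY2'.integrable
      ((BddMeas.const 2).mul (bR.mul bY')).integrable, integral_const_mul,
      h.integral_psum_mul bY, h.integral_psum_sq_mul bw]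
    have h1 := (abs_le.1 (hvar n w bw hw0)).1
    have h2 : 1 ≤ v * ∫ ω, w ω ∂P + ∫ ω, Y n ω ^ 2 * w ω ∂P := by
      rw [← integral_const_mul, ← integral_add ((BddMeas.const v).mul bw').integrable
        bY2'.integrable]
      simp [hwv]
    have h3 : 0 ≤ ∫ ω, w ω ∂P := integral_nonneg hw0
    have h4 : 0 ≤ ∫ ω, Y n ω ^ 2 * w ω ∂P := integral_nonneg hYw0
    nlinarith
  -- `X ^ 4 ≤ 8 * (Y ^ 4 + psum ^ 4)`, where `Y ^ 4 * w ^ 2 ≤ 1` and the weighted fourth moment of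
  -- `psum` is at most `C * (2 * v) ^ 2 * ∫ w ^ 2 ≤ 4 * C`.
  have up : ∫ ω, (X ω ^ 2 * w ω) ^ 2 ∂P ≤ κ := by
    have b4 : BddMeas mΩ fun ω => psum ξ n ω ^ (2 * 2) * w ω ^ 2 := (bR.pow _).mul (bw'.pow 2)
    have h1 : ∫ ω, (X ω ^ 2 * w ω) ^ 2 ∂P ≤
        ∫ ω, (8 + 8 * (psum ξ n ω ^ (2 * 2) * w ω ^ 2)) ∂P := by
      refine integral_mono (bXw.pow 2).integrable
        ((BddMeas.const 8).add ((BddMeas.const 8).mul b4)).integrable fun ω => ?_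
      have e1 : X ω ^ 4 ≤ 8 * (Y n ω ^ 4 + psum ξ n ω ^ 4) := by
        simp only [hX]
        nlinarith [sq_nonneg (Y n ω + psum ξ n ω), sq_nonneg (Y n ω - psum ξ n ω),
          sq_nonneg (Y n ω ^ 2 - psum ξ n ω ^ 2), sq_nonneg ((Y n ω - psum ξ n ω) ^ 2 - (Y n ω + psum ξ n ω) ^ 2),
          mul_nonneg (sq_nonneg (Y n ω + psum ξ n ω)) (sq_nonneg (Y n ω - psum ξ n ω)),
          sq_nonneg ((Y n ω + psum ξ n ω) ^ 2)]
      have e2 : (Y n ω ^ 2 * w ω) ^ 2 ≤ 1 := by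
        have := hYw0 ω
        have : Y n ω ^ 2 * w ω ≤ 1 := by linarith [hwv ω, hvw0 ω]
        exact pow_le_one₀ (hYw0 ω) this
      have e3 := mul_le_mul_of_nonneg_right e1 (sq_nonneg (w ω))
      have e4 : (X ω ^ 2 * w ω) ^ 2 = X ω ^ 4 * w ω ^ 2 := by ring
      have e5 : (Y n ω ^ 2 * w ω) ^ 2 = Y n ω ^ 4 * w ω ^ 2 := by ring
      have e6 : psum ξ n ω ^ (2 * 2) = psum ξ n ω ^ 4 := by norm_num
      simp only [e4, e6]
      rw [e5] at e2
      linarith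
    have h2 : ∫ ω, psum ξ n ω ^ (2 * 2) * w ω ^ 2 ∂P ≤ C * (2 * v) ^ 2 * ∫ ω, w ω ^ 2 ∂P := by
      refine hmom h n (2 * v) (by linarith) ?_ n le_rfl _ (bw.pow 2) fun ω => sq_nonneg _
      intro k hk g hg hg0
      have h3 := (abs_le.1 (hvar k g hg hg0)).2
      have h4 := h.integral_qsum_mono hk
      have h5 : 0 ≤ ∫ ω, g ω ∂P := integral_nonneg hg0
      have h6 := mul_le_mul_of_nonneg_right h4 h5
      nlinarith
    have h3 : v ^ 2 * ∫ ω, w ω ^ 2 ∂P ≤ 1 := by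
      rw [← integral_const_mul]
      have : ∫ ω, v ^ 2 * w ω ^ 2 ∂P ≤ ∫ _, (1 : ℝ) ∂P := by
        refine integral_mono ((BddMeas.const _).mul (bw'.pow 2)).integrable
          (integrable_const _) fun ω => ?_
        have : v * w ω ≤ 1 := by linarith [hwv ω, hYw0 ω]
        simpa [mul_pow] using pow_le_one₀ (n := 2) (hvw0 ω) this
      simpa using this
    rw [integral_add (integrable_const _) ((BddMeas.const 8).mul b4).integrable,
      integral_const_mul] at h1
    simp only [integral_const, probReal_univ, smul_eq_mul, one_mul] at h1
    have h4 : C * (v ^ 2 * ∫ ω, w ω ^ 2 ∂P) ≤ C * 1 := mul_le_mul_of_nonneg_left h3 hC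
    rw [hκ]
    nlinarith
  have hset : P.real {ω | L ≤ G ω ^ 2} = P.real {ω | L ≤ X ω ^ 2} := by
    refine measureReal_congr ?_
    filter_upwards [hGY n] with ω hω
    change (L ≤ G ω ^ 2) = (L ≤ X ω ^ 2)
    rw [hω]
  have mX : Measurable X := (mY.mono (h.le n) le_rfl).sub bR.1
  have mS : MeasurableSet {ω | L ≤ X ω ^ 2} := measurableSet_le measurable_const (mX.pow_const 2)
  -- Paley–Zygmund in pointwise form: with `u = X ^ 2 * w` and `a = u / (4 * κ)`, one has `2 * a - a
  -- ^ 2 ≤ 1` where `L ≤ X ^ 2`, and `2 * a ≤ L * w / (2 * κ)` elsewhere.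
  have hind : (1 / (2 * κ)) * ∫ ω, X ω ^ 2 * w ω ∂P - (1 / (2 * κ)) * (L * ∫ ω, w ω ∂P)
      - (1 / (16 * κ ^ 2)) * ∫ ω, (X ω ^ 2 * w ω) ^ 2 ∂P ≤ P.real {ω | L ≤ X ω ^ 2} := by
    rw [← integral_indicator_one mS, ← integral_const_mul, ← integral_const_mul L,
      ← integral_const_mul, ← integral_const_mul, ← integral_sub, ← integral_sub]
    · refine integral_mono ?_ ?_ fun ω => ?_
      · exact ((((BddMeas.const _).mul bXw).sub ((BddMeas.const _).mul
          ((BddMeas.const _).mul bw'))).sub ((BddMeas.const _).mul (bXw.pow 2))).integrable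
      · exact (integrable_const (1 : ℝ)).indicator mS
      · simp only
        set u := X ω ^ 2 * w ω with hu
        have hu0 : 0 ≤ u := mul_nonneg (sq_nonneg _) (hw0 ω)
        have e : 1 / (2 * κ) * u - 1 / (2 * κ) * (L * w ω) - 1 / (16 * κ ^ 2) * u ^ 2
            = (u / (4 * κ)) * 2 - (u / (4 * κ)) ^ 2 - 1 / (2 * κ) * (L * w ω) := by
          field_simp; ring
        rw [e]
        by_cases hω : L ≤ X ω ^ 2
        · rw [Set.indicator_of_mem (show ω ∈ {ω | L ≤ X ω ^ 2} from hω)]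
          have : 0 ≤ 1 / (2 * κ) * (L * w ω) := by have := hw0 ω; positivity
          simp only [Pi.one_apply]
          nlinarith [sq_nonneg (u / (4 * κ) - 1)]
        · rw [Set.indicator_of_notMem (show ω ∉ {ω | L ≤ X ω ^ 2} from hω)]
          push Not at hω
          have h1 : u ≤ L * w ω := mul_le_mul_of_nonneg_right hω.le (hw0 ω)
          have h2 : 1 / (2 * κ) * u ≤ 1 / (2 * κ) * (L * w ω) := by gcongr
          have h3 : (u / (4 * κ)) * 2 = 1 / (2 * κ) * u := by field_simp; ring
          nlinarith [sq_nonneg (u / (4 * κ))]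
    · exact (((BddMeas.const _).mul bXw).sub ((BddMeas.const _).mul
          ((BddMeas.const _).mul bw'))).integrable
    · exact ((BddMeas.const _).mul (bXw.pow 2)).integrable
    · exact ((BddMeas.const _).mul bXw).integrable
    · exact ((BddMeas.const _).mul ((BddMeas.const _).mul bw')).integrable
  have hLw : L * ∫ ω, w ω ∂P ≤ 1 / 4 := by
    have : ∫ ω, w ω ∂P ≤ ∫ _, 1 / v ∂P := by
      refine integral_mono bw'.integrable (integrable_const _) fun ω => ?_
      simp only
      rw [le_div_iff₀ hv0]; linarith [hwv ω, hYw0 ω]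
    simp only [integral_const, probReal_univ, smul_eq_mul, one_mul] at this
    calc L * ∫ ω, w ω ∂P ≤ L * (1 / v) := by gcongr
      _ ≤ 1 / 4 := by rw [mul_one_div, div_le_div_iff₀ hv0 (by norm_num)]; linarith
  rw [hset] at hPL
  have f1 : 1 / (2 * κ) * (1 / 2) ≤ (1 / (2 * κ)) * ∫ ω, X ω ^ 2 * w ω ∂P := by gcongr
  have f2 : (1 / (2 * κ)) * (L * ∫ ω, w ω ∂P) ≤ 1 / (2 * κ) * (1 / 4) := by gcongr
  have f3 : (1 / (16 * κ ^ 2)) * ∫ ω, (X ω ^ 2 * w ω) ^ 2 ∂P ≤ (1 / (16 * κ ^ 2)) * κ := by gcongr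
  have f4 : 1 / (2 * κ) * (1 / 2) - 1 / (2 * κ) * (1 / 4) - (1 / (16 * κ ^ 2)) * κ
      = 1 / (16 * κ) := by field_simp; ring
  linarith

/-- Kolmogorov's maximal inequality for reverse martingales. -/
theorem sq_mul_measureReal_le (h : IsRevMartDiff P 𝓖 ξ D) {lam : ℝ} (hlam : 0 < lam) (n d : ℕ) :
    lam ^ 2 * P.real {ω | ∃ i ∈ Set.Icc n (n + d), lam ≤ |psum ξ (n + d) ω - psum ξ i ω|} ≤
      ∫ ω, (psum ξ (n + d) ω - psum ξ n ω) ^ 2 ∂P := by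
  classical
  -- Seen from the end `m`, the tails `psum m - psum i` form a forward martingale as `i` decreases.
  -- `I` is a `𝓖 n`-measurable indicator that equals `1` wherever some tail has reached `lam`; the
  -- induction adds one index on the left.
  suffices H : ∀ d n m, n + d = m → ∃ I : Ω → ℝ, BddMeas (𝓖 n) I ∧ (∀ ω, 0 ≤ I ω) ∧
      (∀ ω, I ω ≤ 1) ∧
      (∀ ω, (∃ i ∈ Set.Icc n m, lam ≤ |psum ξ m ω - psum ξ i ω|) → I ω = 1) ∧
      (∀ ω, I ω = 0 ∨ I ω = 1) ∧
      lam ^ 2 * ∫ ω, I ω ∂P ≤ ∫ ω, (psum ξ m ω - psum ξ n ω) ^ 2 * I ω ∂P by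
    obtain ⟨I, hI, hI0, hI1, hmem, -, hle⟩ := H d n _ rfl
    have hI' := hI.mono (h.le n)
    have bZ : BddMeas mΩ fun ω => psum ξ (n + d) ω - psum ξ n ω :=
      (h.bddMeas_psum _).sub (h.bddMeas_psum _)
    have mS : MeasurableSet
        {ω | ∃ i ∈ Set.Icc n (n + d), lam ≤ |psum ξ (n + d) ω - psum ξ i ω|} := by
      have : {ω | ∃ i ∈ Set.Icc n (n + d), lam ≤ |psum ξ (n + d) ω - psum ξ i ω|}
          = ⋃ i ∈ Set.Icc n (n + d), {ω | lam ≤ |psum ξ (n + d) ω - psum ξ i ω|} := by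
        ext ω; simp
      rw [this]
      refine MeasurableSet.biUnion (Set.to_countable _) fun i _ => ?_
      exact measurableSet_le measurable_const
        ((h.bddMeas_psum _).1.sub (h.bddMeas_psum _).1).abs
    calc _ ≤ lam ^ 2 * ∫ ω, I ω ∂P := by
          rw [← integral_indicator_one mS]
          refine mul_le_mul_of_nonneg_left ?_ (by positivity)
          refine integral_mono ((integrable_const (1 : ℝ)).indicator mS) hI'.integrable fun ω => ?_
          by_cases hω : ω ∈ {ω | ∃ i ∈ Set.Icc n (n + d), lam ≤ |psum ξ (n + d) ω - psum ξ i ω|}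
          · simp only [Set.indicator_of_mem hω, hmem ω hω, Pi.one_apply, le_refl]
          · simp only [Set.indicator_of_notMem hω, hI0 ω]
      _ ≤ _ := hle
      _ ≤ _ := integral_mono ((bZ.pow 2).mul hI').integrable (bZ.pow 2).integrable fun ω =>
          mul_le_of_le_one_right (sq_nonneg _) (hI1 ω)
  intro d
  induction d with
  | zero =>
    rintro n m rfl
    refine ⟨fun _ => 0, BddMeas.const 0, fun _ => le_rfl, fun _ => zero_le_one, ?_,
      fun _ => Or.inl rfl, by simp⟩
    rintro ω ⟨i, ⟨hi, hi'⟩, h1⟩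
    have : i = n := le_antisymm hi' hi
    subst this
    simp at h1
    linarith
  | succ d ih =>
    intro n m hm
    obtain ⟨I, hI, hI0, hI1, hmem, h01, hle⟩ := ih (n + 1) m (by omega)
    have hnm : n ≤ m := by omega
    have hnm' : n + 1 ≤ m := by omega
    set J : Ω → ℝ := fun ω => if lam ≤ |psum ξ m ω - psum ξ n ω| then 1 else I ω with hJ
    have bZ := h.bddMeas_psum_sub hnm
    have hIn := hI.mono (h.anti n.le_succ)
    have hJ01 : ∀ ω, J ω = 0 ∨ J ω = 1 := fun ω => by
      simp only [hJ]; split_ifs; exacts [Or.inr rfl, h01 ω]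
    have bJ : BddMeas (𝓖 n) J := by
      refine ⟨Measurable.ite (measurableSet_le measurable_const
        (measurable_norm.comp bZ.1)) measurable_const hIn.1, 1, fun ω => ?_⟩
      rcases hJ01 ω with e | e <;> simp [e]
    refine ⟨J, bJ, fun ω => ?_, fun ω => ?_, ?_, hJ01, ?_⟩
    · rcases hJ01 ω with e | e <;> simp [e]
    · rcases hJ01 ω with e | e <;> simp [e]
    · rintro ω ⟨i, ⟨hi, hi'⟩, h1⟩
      simp only [hJ]
      split_ifs with h2
      · rfl
      · refine hmem ω ⟨i, ⟨?_, hi'⟩, h1⟩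
        rcases hi.eq_or_lt with h3 | h3
        · subst h3; exact absurd h1 h2
        · exact h3
    · have bJ' := bJ.mono (h.le n)
      have bI' := hI.mono (h.le _)
      have bZ0 := bZ.mono (h.le n)
      have bZ1 := h.bddMeas_psum_sub hnm'
      have bZ1' := bZ1.mono (h.le _)
      have bξ := h.bddMeas n
      -- On the old event, which is `𝓖 (n + 1)`-measurable, adding the orthogonal increment `ξ n`
      -- can only increase the second moment.
      have s1 : lam ^ 2 * ∫ ω, I ω ∂P ≤ ∫ ω, (psum ξ m ω - psum ξ n ω) ^ 2 * I ω ∂P := by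
        refine hle.trans ?_
        have e : ∀ ω, (psum ξ m ω - psum ξ n ω) ^ 2 * I ω
            = (psum ξ m ω - psum ξ (n + 1) ω) ^ 2 * I ω
              + (2 * (ξ n ω * ((psum ξ m ω - psum ξ (n + 1) ω) * I ω)) + ξ n ω ^ 2 * I ω) := by
          intro ω; simp only [psum, Finset.sum_range_succ]; ring
        simp only [e]
        have i2 := ((BddMeas.const 2).mul (bξ.mul (bZ1'.mul bI'))).integrable (P := P)
        have i3 := ((bξ.pow 2).mul bI').integrable (P := P)
        rw [integral_add ((bZ1'.pow 2).mul bI').integrable (i2.fun_add i3), integral_add i2 i3,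
          integral_const_mul, h.orth n _ (bZ1.mul hI)]
        have : 0 ≤ ∫ ω, ξ n ω ^ 2 * I ω ∂P :=
          integral_nonneg fun ω => mul_nonneg (sq_nonneg _) (hI0 ω)
        linarith
      -- Where `J` newly equals `1`, the square of the tail is at least `lam ^ 2`.
      have s2 : ∫ ω, (psum ξ m ω - psum ξ n ω) ^ 2 * I ω ∂P - lam ^ 2 * ∫ ω, I ω ∂P ≤
          ∫ ω, (psum ξ m ω - psum ξ n ω) ^ 2 * J ω ∂P - lam ^ 2 * ∫ ω, J ω ∂P := by
        rw [← integral_const_mul, ← integral_const_mul, ← integral_sub, ← integral_sub]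
        · refine integral_mono (((bZ0.pow 2).mul bI').sub
            ((BddMeas.const _).mul bI')).integrable (((bZ0.pow 2).mul bJ').sub
            ((BddMeas.const _).mul bJ')).integrable fun ω => ?_
          simp only [hJ]
          split_ifs with h2
          · have h3 : lam ^ 2 ≤ (psum ξ m ω - psum ξ n ω) ^ 2 := by
              rw [← sq_abs (psum ξ m ω - psum ξ n ω)]
              exact pow_le_pow_left₀ hlam.le h2 2
            nlinarith [hI1 ω, hI0 ω]
          · exact le_rfl
        · exact ((bZ0.pow 2).mul bJ').integrable
        · exact ((BddMeas.const _).mul bJ').integrable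
        · exact ((bZ0.pow 2).mul bI').integrable
        · exact ((BddMeas.const _).mul bI').integrable
      linarith

/-- Dropping the first `n` terms leaves reverse martingale differences, to which
`integral_psum_sq_mul` with `g = 1` applies. -/
theorem integral_psum_sub_sq (h : IsRevMartDiff P 𝓖 ξ D) (n d : ℕ) :
    ∫ ω, (psum ξ (n + d) ω - psum ξ n ω) ^ 2 ∂P =
      ∑ i ∈ Finset.range d, ∫ ω, ξ (n + i) ω ^ 2 ∂P := by
  have hsh : IsRevMartDiff P (fun k => 𝓖 (n + k)) (fun k => ξ (n + k)) D :=
    ⟨fun a b hab => h.anti (by omega), fun k => h.le _, fun k => h.meas _, fun k => h.bound _,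
      fun k g hg => h.orth (n + k) g hg⟩
  have e : ∀ ω, psum ξ (n + d) ω - psum ξ n ω = psum (fun k => ξ (n + k)) d ω := fun ω => by
    simp only [psum]
    rw [Finset.sum_range_add]
    ring
  have := hsh.integral_psum_sq_mul (n := d) (BddMeas.const 1)
  simp only [mul_one] at this
  simp only [e, this, qsum]
  exact integral_finsetSum _ fun i _ => ((h.bddMeas (n + i)).pow 2).integrable

theorem summable_integral_sq (h : IsRevMartDiff P 𝓖 ξ D) {B : ℝ}
    (hB : ∀ n, ∫ ω, qsum ξ n ω ∂P ≤ B) : Summable fun k => ∫ ω, ξ k ω ^ 2 ∂P := by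
  refine summable_of_sum_range_le (c := B) (fun k => integral_nonneg fun ω => sq_nonneg _)
    fun n => ?_
  rw [← integral_finsetSum _ fun i _ => ((h.bddMeas i).pow 2).integrable]
  exact hB n

/-- A reverse martingale with bounded variances converges almost surely. -/
theorem ae_exists_tendsto_psum (h : IsRevMartDiff P 𝓖 ξ D) {B : ℝ}
    (hB : ∀ n, ∫ ω, qsum ξ n ω ∂P ≤ B) :
    ∀ᵐ ω ∂P, ∃ s, Tendsto (fun n => psum ξ n ω) atTop (𝓝 s) := by
  have hsum := h.summable_integral_sq hB
  set V : ℕ → ℝ := fun n => ∑' i, ∫ ω, ξ (i + n) ω ^ 2 ∂P with hV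
  have hV0 : Tendsto V atTop (𝓝 0) := tendsto_sum_nat_add fun k => ∫ ω, ξ k ω ^ 2 ∂P
  have hle : ∀ n d, ∫ ω, (psum ξ (n + d) ω - psum ξ n ω) ^ 2 ∂P ≤ V n := by
    intro n d
    rw [h.integral_psum_sub_sq]
    have := ((summable_nat_add_iff n).2 hsum).sum_le_tsum (Finset.range d)
      (fun i _ => integral_nonneg fun ω => sq_nonneg (ξ (i + n) ω))
    simpa only [add_comm n] using this
  -- The maximal inequality measures deviations from the last partial sum. If `psum k` and `psum n`
  -- are `2 * lam` apart, then one of them is at least `lam` away from `psum (n + d)`; the events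
  -- increase with `d`.
  have bound : ∀ lam : ℝ, 0 < lam → ∀ n,
      P {ω | ∃ k ≥ n, 2 * lam ≤ |psum ξ k ω - psum ξ n ω|} ≤ ENNReal.ofReal (V n / lam ^ 2) := by
    intro lam hlam n
    have hU : {ω | ∃ k ≥ n, 2 * lam ≤ |psum ξ k ω - psum ξ n ω|} =
        ⋃ d : ℕ, {ω | ∃ k ∈ Set.Icc n (n + d), 2 * lam ≤ |psum ξ k ω - psum ξ n ω|} := by
      ext ω
      simp only [Set.mem_ofPred_eq, Set.mem_iUnion]
      constructor
      · rintro ⟨k, hk, h1⟩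
        exact ⟨k - n, k, ⟨hk, by omega⟩, h1⟩
      · rintro ⟨d, k, hk, h1⟩
        exact ⟨k, hk.1, h1⟩
    have hmono : Monotone fun d : ℕ =>
        {ω | ∃ k ∈ Set.Icc n (n + d), 2 * lam ≤ |psum ξ k ω - psum ξ n ω|} := by
      rintro a b hab ω ⟨k, hk, h1⟩
      exact ⟨k, ⟨hk.1, hk.2.trans (by omega)⟩, h1⟩
    rw [hU, hmono.measure_iUnion]
    refine iSup_le fun d => ?_
    have hsub : {ω | ∃ k ∈ Set.Icc n (n + d), 2 * lam ≤ |psum ξ k ω - psum ξ n ω|} ⊆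
        {ω | ∃ i ∈ Set.Icc n (n + d), lam ≤ |psum ξ (n + d) ω - psum ξ i ω|} := by
      rintro ω ⟨k, hk, h1⟩
      by_contra hcon
      simp only [Set.mem_ofPred_eq, not_exists, not_and, not_le] at hcon
      have h2 := hcon k hk
      have h3 := hcon n ⟨le_rfl, by omega⟩
      rw [abs_lt] at h2 h3
      rcases le_abs.1 h1 with h4 | h4 <;> linarith
    refine (measure_mono hsub).trans ?_
    rw [← ofReal_measureReal]
    refine ENNReal.ofReal_le_ofReal ?_
    rw [le_div_iff₀ (by positivity), mul_comm]
    exact (h.sq_mul_measureReal_le hlam n d).trans (hle n d)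
  have hnull : ∀ l : ℕ, ∀ᵐ ω ∂P, ∃ n, ∀ k ≥ n,
      |psum ξ k ω - psum ξ n ω| < 2 * (1 / ((l : ℝ) + 1)) := by
    intro l
    have hl : (0 : ℝ) < 1 / ((l : ℝ) + 1) := by positivity
    rw [ae_iff]
    have ht : Tendsto (fun n => ENNReal.ofReal (V n / (1 / ((l : ℝ) + 1)) ^ 2)) atTop (𝓝 0) := by
      have := ENNReal.tendsto_ofReal (hV0.div_const ((1 / ((l : ℝ) + 1)) ^ 2))
      simpa using this
    refine le_antisymm (ge_of_tendsto' ht fun n => ?_) zero_le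
    refine (measure_mono ?_).trans (bound _ hl n)
    intro ω hω
    simp only [Set.mem_ofPred_eq] at hω ⊢
    push Not at hω
    exact hω n
  rw [← ae_all_iff] at hnull
  filter_upwards [hnull] with ω hω
  refine cauchySeq_tendsto_of_complete (Metric.cauchySeq_iff'.2 fun ε hε => ?_)
  obtain ⟨l, hl⟩ := exists_nat_one_div_lt (half_pos hε)
  obtain ⟨n, hn⟩ := hω l
  exact ⟨n, fun k hk => by rw [Real.dist_eq]; have := hn k hk; linarith⟩

end IsRevMartDiff

end SeqLivsic

/-! ### Convergence in `L^p`. -/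

namespace SeqLivsic

/-- Hölder's inequality on a set `s` gains the factor `P s ^ (1/p - 1/(2p))`. -/
theorem unifIntegrable_of_eLpNorm_two_mul_le {Ω ι : Type*} [MeasurableSpace Ω] {P : Measure Ω}
    {f : ι → Ω → ℝ} {p : ℝ≥0∞} (hp1 : 1 ≤ p) (hp : p ≠ ∞)
    (hf : ∀ i, AEStronglyMeasurable (f i) P) {K : ℝ≥0}
    (hK : ∀ i, eLpNorm (f i) (2 * p) P ≤ K) : UnifIntegrable f p P := by
  intro ε hε
  set r : ℝ := 1 / p.toReal - 1 / (2 * p).toReal with hr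
  have hp0 : 0 < p.toReal := ENNReal.toReal_pos (by positivity) hp
  have hr0 : 0 < r := by
    rw [hr, ENNReal.toReal_mul]
    simp only [ENNReal.toReal_ofNat]
    rw [sub_pos]
    exact one_div_lt_one_div_of_lt hp0 (by linarith)
  refine ⟨(ε / (K + 1)) ^ (1 / r), by positivity, fun i s hs hPs => ?_⟩
  rw [eLpNorm_indicator_eq_eLpNorm_restrict hs]
  have hpp : p ≤ 2 * p := by
    rw [two_mul]; exact le_self_add
  calc eLpNorm (f i) p (P.restrict s)
      ≤ eLpNorm (f i) (2 * p) (P.restrict s) * (P.restrict s Set.univ) ^ r :=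
        eLpNorm_le_eLpNorm_mul_rpow_measure_univ hpp (hf i).restrict
    _ ≤ K * (ENNReal.ofReal ((ε / (K + 1)) ^ (1 / r))) ^ r := by
        rw [Measure.restrict_apply_univ]
        gcongr
        exact (eLpNorm_restrict_le _ _ _ _).trans (hK i)
    _ = ENNReal.ofReal (K * (ε / (K + 1))) := by
        rw [ENNReal.ofReal_rpow_of_nonneg (by positivity) hr0.le, ← Real.rpow_mul (by positivity),
          one_div_mul_cancel hr0.ne', Real.rpow_one, ENNReal.ofReal_mul (by positivity)]
        simp
    _ ≤ ENNReal.ofReal ε := by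
        refine ENNReal.ofReal_le_ofReal ?_
        rw [mul_div_assoc', div_le_iff₀ (by positivity)]
        nlinarith [K.coe_nonneg]

namespace IsRevMartDiff

variable {Ω : Type*} [mΩ : MeasurableSpace Ω] {P : Measure Ω} [IsProbabilityMeasure P]
  {𝓖 : ℕ → MeasurableSpace Ω} {ξ : ℕ → Ω → ℝ} {D : ℝ}

/-- On a probability space it suffices to bound an even moment of higher order, which is
`integral_psum_pow_mul_le` with `g = 1`. -/
theorem exists_eLpNorm_psum_le (h : IsRevMartDiff P 𝓖 ξ D) {s : ℝ} (hs : 0 ≤ s)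
    (hvar : ∀ n (g : Ω → ℝ), BddMeas (𝓖 n) g → (∀ ω, 0 ≤ g ω) →
      |∫ ω, qsum ξ n ω * g ω ∂P - (∫ ω, qsum ξ n ω ∂P) * ∫ ω, g ω ∂P| ≤ s * ∫ ω, g ω ∂P)
    {B : ℝ} (hB : ∀ n, ∫ ω, qsum ξ n ω ∂P ≤ B) {p : ℝ≥0∞} (hp : p ≠ ∞) :
    ∃ K : ℝ≥0, ∀ n, eLpNorm (psum ξ n) p P ≤ K := by
  obtain ⟨q, hq⟩ := ENNReal.exists_nat_gt hp
  obtain ⟨C, hC, hmom⟩ := integral_psum_pow_mul_le (q + 1)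
  have hB0 : 0 ≤ B := (integral_nonneg fun ω => qsum_nonneg ξ 0 ω).trans (hB 0)
  set b : ℝ := B + s + D ^ 2 with hb
  have hqpos : (((2 * (q + 1) : ℕ) : ℝ≥0∞)) ≠ 0 := by
    exact_mod_cast (by omega : 2 * (q + 1) ≠ 0)
  refine ⟨((C * b ^ (q + 1)) ^ (((2 * (q + 1) : ℕ) : ℝ≥0∞).toReal)⁻¹).toNNReal, fun n => ?_⟩
  have hm := (h.bddMeas_psum n).1
  have hle : p ≤ ((2 * (q + 1) : ℕ) : ℝ≥0∞) := hq.le.trans (by exact_mod_cast by omega)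
  obtain ⟨c, hc⟩ := (h.bddMeas_psum n).2
  refine (eLpNorm_le_eLpNorm_of_exponent_le hle hm.aestronglyMeasurable).trans ?_
  rw [MemLp.eLpNorm_eq_integral_rpow_norm hqpos (ENNReal.natCast_ne_top _)
    (MemLp.of_bound hm.aestronglyMeasurable c (Eventually.of_forall hc))]
  refine ENNReal.ofReal_le_ofReal (Real.rpow_le_rpow (integral_nonneg fun ω => by positivity) ?_
    (by positivity))
  have h1 := hmom h n b (by rw [hb]; linarith) (fun k _ g hg hg0 => by
    have h3 := (abs_le.1 (hvar k g hg hg0)).2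
    have h5 : 0 ≤ ∫ ω, g ω ∂P := integral_nonneg hg0
    have h6 := mul_le_mul_of_nonneg_right (hB k) h5
    have h7 := mul_nonneg (sq_nonneg D) h5
    rw [hb]
    linarith) n le_rfl (fun _ => 1) (BddMeas.const 1) (fun _ => zero_le_one)
  simp only [mul_one, integral_const, probReal_univ, smul_eq_mul] at h1
  refine le_trans (le_of_eq (integral_congr_ae (Eventually.of_forall fun ω => ?_))) h1
  simp only [Real.norm_eq_abs, ENNReal.toReal_natCast, Real.rpow_natCast]
  exact Even.pow_abs (even_two_mul (q + 1)) _

/-- A bounded reverse martingale that is a coboundary, and whose conditional variances are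
comparable to its variances, converges almost surely and in `L^p`. -/
theorem exists_limit (h : IsRevMartDiff P 𝓖 ξ D) {s : ℝ} (hs : 0 ≤ s)
    (hvar : ∀ n (g : Ω → ℝ), BddMeas (𝓖 n) g → (∀ ω, 0 ≤ g ω) →
      |∫ ω, qsum ξ n ω * g ω ∂P - (∫ ω, qsum ξ n ω ∂P) * ∫ ω, g ω ∂P| ≤ s * ∫ ω, g ω ∂P)
    {G : Ω → ℝ} (hG : Measurable G) {Y : ℕ → Ω → ℝ} (hY : ∀ n, Measurable[𝓖 n] (Y n))
    (hGY : ∀ n, ∀ᵐ ω ∂P, G ω = Y n ω - psum ξ n ω) :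
    ∃ S : Ω → ℝ, (∀ᵐ ω ∂P, Tendsto (fun n => psum ξ n ω) atTop (𝓝 (S ω))) ∧
      ∀ p : ℝ≥0∞, 1 ≤ p → p ≠ ∞ → MemLp S p P ∧
        (∃ K : ℝ≥0, ∀ n, eLpNorm (psum ξ n) p P ≤ K) ∧
        Tendsto (fun n => eLpNorm (fun ω => psum ξ n ω - S ω) p P) atTop (𝓝 0) := by
  obtain ⟨B, hB⟩ := h.exists_integral_qsum_le hs hvar hG hY hGY
  have hlim := h.ae_exists_tendsto_psum hB
  have hm : ∀ n, AEStronglyMeasurable (psum ξ n) P := fun n =>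
    (h.bddMeas_psum n).1.aestronglyMeasurable
  obtain ⟨S, hS⟩ : ∃ S : Ω → ℝ, ∀ᵐ ω ∂P, Tendsto (fun n => psum ξ n ω) atTop (𝓝 (S ω)) := by
    classical
    refine ⟨fun ω => if hω : ∃ s, Tendsto (fun n => psum ξ n ω) atTop (𝓝 s) then hω.choose else 0,
      ?_⟩
    filter_upwards [hlim] with ω hω
    rw [dif_pos hω]
    exact hω.choose_spec
  refine ⟨S, hS, fun p hp1 hp => ?_⟩
  obtain ⟨K, hK⟩ := h.exists_eLpNorm_psum_le hs hvar hB hp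
  -- The exponent `2 * p` supplies the uniform integrability required by Vitali's theorem at
  -- exponent `p`.
  obtain ⟨K', hK'⟩ := h.exists_eLpNorm_psum_le hs hvar hB
    (ENNReal.mul_ne_top ENNReal.ofNat_ne_top hp : 2 * p ≠ ∞)
  have hSm : MemLp S p P := by
    refine ⟨aestronglyMeasurable_of_tendsto_ae atTop hm hS, ?_⟩
    refine lt_of_le_of_lt ((Lp.eLpNorm_lim_le_liminf_eLpNorm hm S hS).trans
      (liminf_le_of_le (h := fun b hb => ?_))) (ENNReal.coe_lt_top (r := K))
    obtain ⟨n, hn⟩ := hb.exists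
    exact hn.trans (hK n)
  exact ⟨hSm, ⟨K, hK⟩, tendsto_Lp_finite_of_tendsto_ae hp1 hp hm hSm
    (unifIntegrable_of_eLpNorm_two_mul_le hp1 hp hm hK') hS⟩

end IsRevMartDiff

end SeqLivsic

/-! ### Transfer operators and their iterates. -/

namespace SeqLivsic

theorem mul_indicator_one {Y : Type*} (f : Y → ℝ) (s : Set Y) (y : Y) :
    f y * s.indicator (fun _ => (1 : ℝ)) y = s.indicator f y := by
  by_cases hy : y ∈ s <;> simp [hy]

section Transfer

variable {X Y : Type*} [MeasurableSpace X] [MeasurableSpace Y] {μ : Measure X} {ν : Measure Y}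
  {T : X → Y} {φ φ' : X → ℝ}

/-- The equality holds everywhere, because `φ` enters only through the measures with densities its
positive and negative parts. -/
theorem transfer_congr (h : φ =ᵐ[μ] φ') : transfer μ ν T φ = transfer μ ν T φ' := by
  have h1 : (μ.withDensity fun x => ENNReal.ofReal (φ x)) =
      μ.withDensity fun x => ENNReal.ofReal (φ' x) :=
    withDensity_congr_ae (h.mono fun x hx => by simp only [hx])
  have h2 : (μ.withDensity fun x => ENNReal.ofReal (-φ x)) =
      μ.withDensity fun x => ENNReal.ofReal (-φ' x) :=
    withDensity_congr_ae (h.mono fun x hx => by simp only [hx])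
  ext y
  simp only [transfer, h1, h2]

theorem memLp_top_indicator {s : Set Y} (hs : MeasurableSet s) :
    MemLp (s.indicator fun _ => (1 : ℝ)) ∞ ν :=
  memLp_top_of_bound (stronglyMeasurable_const.indicator hs).aestronglyMeasurable 1
    (Eventually.of_forall fun y => by
      by_cases hy : y ∈ s <;> simp [hy])

theorem integrable_mul_comp (hT : Measure.QuasiMeasurePreserving T μ ν) (hφ : Integrable φ μ)
    {ψ : Y → ℝ} (hψ : MemLp ψ ∞ ν) : Integrable (fun x => φ x * ψ (T x)) μ := by
  have hψT : MemLp (ψ ∘ T) ∞ μ := by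
    refine ⟨hψ.1.comp_quasiMeasurePreserving hT, lt_of_le_of_lt ?_ hψ.2⟩
    rw [eLpNorm_exponent_top, eLpNorm_exponent_top]
    exact essSup_le_of_ae_le _ (hT.ae (ae_le_eLpNormEssSup (f := ψ) (μ := ν)))
  exact Integrable.mul_of_top_left hφ hψT

variable [IsProbabilityMeasure μ] [IsProbabilityMeasure ν]

/-- Testing duality on indicators determines an integrable function. Linearity and the composition
rule are derived from this uniqueness instead of from the density formula. -/
theorem ae_eq_transfer (hT : Measure.QuasiMeasurePreserving T μ ν) (hφ : Integrable φ μ)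
    {f : Y → ℝ} (hf : Integrable f ν)
    (h : ∀ ψ : Y → ℝ, MemLp ψ ∞ ν → ∫ y, f y * ψ y ∂ν = ∫ x, φ x * ψ (T x) ∂μ) :
    f =ᵐ[ν] transfer μ ν T φ := by
  refine Integrable.ae_eq_of_forall_setIntegral_eq _ _ hf (transfer_integrable hφ) fun s hs _ => ?_
  have h1 := h _ (memLp_top_indicator hs)
  rw [← transfer_duality hT hφ (memLp_top_indicator hs)] at h1
  simpa only [mul_indicator_one, integral_indicator hs] using h1

theorem transfer_add (hT : Measure.QuasiMeasurePreserving T μ ν) (hφ : Integrable φ μ)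
    (hφ' : Integrable φ' μ) :
    transfer μ ν T (fun x => φ x + φ' x) =ᵐ[ν]
      fun y => transfer μ ν T φ y + transfer μ ν T φ' y := by
  refine (ae_eq_transfer hT (hφ.add hφ')
    ((transfer_integrable hφ).add (transfer_integrable hφ')) fun ψ hψ => ?_).symm
  simp only [Pi.add_apply, add_mul]
  have i1 : Integrable (fun y => transfer μ ν T φ y * ψ y) ν :=
    Integrable.mul_of_top_left (transfer_integrable hφ) hψ
  have i2 : Integrable (fun y => transfer μ ν T φ' y * ψ y) ν :=
    Integrable.mul_of_top_left (transfer_integrable hφ') hψ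
  rw [integral_add i1 i2, integral_add (integrable_mul_comp hT hφ hψ) (integrable_mul_comp hT hφ' hψ),
    transfer_duality hT hφ hψ, transfer_duality hT hφ' hψ]

theorem transfer_const_mul (hT : Measure.QuasiMeasurePreserving T μ ν) (hφ : Integrable φ μ)
    (c : ℝ) :
    transfer μ ν T (fun x => c * φ x) =ᵐ[ν] fun y => c * transfer μ ν T φ y := by
  refine (ae_eq_transfer hT (hφ.const_mul c)
    ((transfer_integrable hφ).const_mul c) fun ψ hψ => ?_).symm
  simp only [mul_assoc]
  rw [integral_const_mul, integral_const_mul, transfer_duality hT hφ hψ]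

theorem transfer_sub (hT : Measure.QuasiMeasurePreserving T μ ν) (hφ : Integrable φ μ)
    (hφ' : Integrable φ' μ) :
    transfer μ ν T (fun x => φ x - φ' x) =ᵐ[ν]
      fun y => transfer μ ν T φ y - transfer μ ν T φ' y := by
  have h1 := transfer_add (φ' := fun x => (-1) * φ' x) hT hφ (hφ'.const_mul (-1))
  have h2 := transfer_const_mul hT hφ' (-1)
  have e : (fun x => φ x - φ' x) = fun x => φ x + (-1) * φ' x := by ext x; ring
  rw [e]
  filter_upwards [h1, h2] with y h1 h2
  rw [h1, h2]; ring

theorem transfer_nonneg (hT : Measure.QuasiMeasurePreserving T μ ν) (hφ : Integrable φ μ)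
    (h0 : 0 ≤ᵐ[μ] φ) : 0 ≤ᵐ[ν] transfer μ ν T φ := by
  refine ae_nonneg_of_forall_setIntegral_nonneg (transfer_integrable hφ) fun s hs _ => ?_
  have h1 := transfer_duality hT hφ (memLp_top_indicator (ν := ν) hs)
  simp only [mul_indicator_one, integral_indicator hs] at h1
  rw [h1]
  refine integral_nonneg_of_ae (h0.mono fun x hx => ?_)
  exact mul_nonneg hx (Set.indicator_nonneg (fun _ _ => zero_le_one) _)

theorem transfer_mono (hT : Measure.QuasiMeasurePreserving T μ ν) (hφ : Integrable φ μ)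
    (hφ' : Integrable φ' μ) (h : φ ≤ᵐ[μ] φ') : transfer μ ν T φ ≤ᵐ[ν] transfer μ ν T φ' := by
  have h1 := transfer_nonneg hT (hφ'.sub hφ) (h.mono fun x hx => by simpa using hx)
  have h2 := transfer_sub hT hφ' hφ
  filter_upwards [h1, h2] with y h1 h2
  have h3 : (0 : ℝ) ≤ transfer μ ν T (fun x => φ' x - φ x) y := h1
  rw [h2] at h3
  linarith

theorem integral_transfer (hT : Measure.QuasiMeasurePreserving T μ ν) (hφ : Integrable φ μ) :
    ∫ y, transfer μ ν T φ y ∂ν = ∫ x, φ x ∂μ := by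
  simpa using transfer_duality hT hφ (memLp_const 1 : MemLp (fun _ : Y => (1 : ℝ)) ∞ ν)

theorem abs_transfer_le (hT : Measure.QuasiMeasurePreserving T μ ν) (hφ : Integrable φ μ)
    (hφ' : Integrable φ' μ) (h : ∀ᵐ x ∂μ, |φ x| ≤ φ' x) :
    ∀ᵐ y ∂ν, |transfer μ ν T φ y| ≤ transfer μ ν T φ' y := by
  have h1 := transfer_mono hT hφ hφ' (h.mono fun x hx => (le_abs_self _).trans hx)
  have h2 := transfer_mono hT (hφ'.const_mul (-1)) hφ
    (h.mono fun x hx => by have := neg_abs_le (φ x); simp only; linarith)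
  filter_upwards [h1, h2, transfer_const_mul (ν := ν) hT hφ' (-1)] with y h1 h2 h3
  rw [h3] at h2
  exact abs_le.2 ⟨by linarith, h1⟩

end Transfer

section Iterates

variable {X : ℕ → Type*} (T : ∀ j, X j → X (j + 1))

@[simp]
theorem orbit_self {j : ℕ} (h : j ≤ j) (x : X j) : orbit T h x = x :=
  Nat.leRecOn_self x

theorem orbit_succ {j k : ℕ} (h : j ≤ k) (h' : j ≤ k + 1) (x : X j) :
    orbit T h' x = T k (orbit T h x) :=
  Nat.leRecOn_succ h x

theorem orbit_trans {i j k : ℕ} (h : i ≤ j) (h' : j ≤ k) (h'' : i ≤ k) (x : X i) :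
    orbit T h'' x = orbit T h' (orbit T h x) :=
  Nat.leRecOn_trans h h' x

theorem orbit_succ_left {j k : ℕ} (h : j ≤ k) (h' : j + 1 ≤ k) (x : X j) :
    orbit T h x = orbit T h' (T j x) := by
  rw [orbit_trans T (Nat.le_succ j) h' h, orbit_succ T le_rfl (Nat.le_succ j), orbit_self]

variable [∀ j, MeasurableSpace (X j)] (m : ∀ j, Measure (X j))

@[simp]
theorem transferIter_self {j : ℕ} (h : j ≤ j) (φ : X j → ℝ) : transferIter m T h φ = φ :=
  Nat.leRecOn_self (C := fun i => X i → ℝ) φ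

theorem transferIter_succ {j k : ℕ} (h : j ≤ k) (h' : j ≤ k + 1) (φ : X j → ℝ) :
    transferIter m T h' φ = transfer (m k) (m (k + 1)) (T k) (transferIter m T h φ) :=
  Nat.leRecOn_succ (C := fun i => X i → ℝ) h φ

theorem transferIter_trans {i j k : ℕ} (h : i ≤ j) (h' : j ≤ k) (h'' : i ≤ k) (φ : X i → ℝ) :
    transferIter m T h'' φ = transferIter m T h' (transferIter m T h φ) :=
  Nat.leRecOn_trans (C := fun i => X i → ℝ) h h' φ

variable {T m}

theorem quasiMeasurePreserving_orbit
    (hT : ∀ j, Measure.QuasiMeasurePreserving (T j) (m j) (m (j + 1))) {j k : ℕ} (h : j ≤ k) :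
    Measure.QuasiMeasurePreserving (orbit T h) (m j) (m k) := by
  induction k, h using Nat.le_induction with
  | base =>
    have : orbit T (le_refl j) = id := by ext x; simp
    rw [this]
    exact Measure.QuasiMeasurePreserving.id _
  | succ k h ih =>
    have : orbit T (Nat.le_succ_of_le h) = T k ∘ orbit T h := by
      ext x; exact orbit_succ T h _ x
    rw [this]
    exact (hT k).comp ih

/-- The density of the law of `T_0^{(j)}` under `m_0`. -/
noncomputable def dens (m : ∀ j, Measure (X j)) (T : ∀ j, X j → X (j + 1)) (j : ℕ) : X j → ℝ :=
  transferIter m T (Nat.zero_le j) fun _ => 1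

theorem dens_succ (j : ℕ) :
    dens m T (j + 1) = transfer (m j) (m (j + 1)) (T j) (dens m T j) :=
  transferIter_succ T m (Nat.zero_le j) _ _

theorem dens_zero : dens m T 0 = fun _ => 1 := transferIter_self T m _ _

theorem transferIter_dens {j k : ℕ} (h : j ≤ k) : transferIter m T h (dens m T j) = dens m T k :=
  (transferIter_trans T m (Nat.zero_le j) h (Nat.zero_le k) _).symm

variable [∀ j, IsProbabilityMeasure (m j)]

theorem transferIter_integrable {j k : ℕ} (h : j ≤ k) {φ : X j → ℝ} (hφ : Integrable φ (m j)) :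
    Integrable (transferIter m T h φ) (m k) := by
  induction k, h using Nat.le_induction with
  | base => simpa
  | succ k h ih =>
    rw [transferIter_succ T m h]
    exact transfer_integrable ih

/-- The iterate satisfies the duality relation of the composed map, so linearity, positivity and
domination pass from `transfer` to iterates. -/
theorem transferIter_ae_eq
    (hT : ∀ j, Measure.QuasiMeasurePreserving (T j) (m j) (m (j + 1))) {j k : ℕ} (h : j ≤ k)
    {φ : X j → ℝ} (hφ : Integrable φ (m j)) :
    transferIter m T h φ =ᵐ[m k] transfer (m j) (m k) (orbit T h) φ := by
  refine ae_eq_transfer (quasiMeasurePreserving_orbit hT h) hφ (transferIter_integrable h hφ) ?_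
  induction k, h using Nat.le_induction with
  | base => intro ψ _; simp
  | succ k h ih =>
    intro ψ hψ
    have hψT : MemLp (fun x => ψ (T k x)) ∞ (m k) := by
      refine ⟨hψ.1.comp_quasiMeasurePreserving (hT k), lt_of_le_of_lt ?_ hψ.2⟩
      rw [eLpNorm_exponent_top, eLpNorm_exponent_top]
      exact essSup_le_of_ae_le _ ((hT k).ae (ae_le_eLpNormEssSup (f := ψ) (μ := m (k + 1))))
    rw [transferIter_succ T m h, transfer_duality (hT k) (transferIter_integrable h hφ) hψ,
      ih (fun x => ψ (T k x)) hψT]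
    simp only [orbit_succ T h]

theorem integral_transferIter_mul
    (hT : ∀ j, Measure.QuasiMeasurePreserving (T j) (m j) (m (j + 1))) {j k : ℕ} (h : j ≤ k)
    {φ : X j → ℝ} (hφ : Integrable φ (m j)) {ψ : X k → ℝ} (hψ : MemLp ψ ∞ (m k)) :
    ∫ y, transferIter m T h φ y * ψ y ∂(m k) = ∫ x, φ x * ψ (orbit T h x) ∂(m j) := by
  rw [← transfer_duality (quasiMeasurePreserving_orbit hT h) hφ hψ]
  exact integral_congr_ae ((transferIter_ae_eq hT h hφ).mono fun y hy => by simp only [hy])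

theorem dens_integrable (j : ℕ) : Integrable (dens m T j) (m j) :=
  transferIter_integrable _ (integrable_const _)

theorem integral_dens_mul
    (hT : ∀ j, Measure.QuasiMeasurePreserving (T j) (m j) (m (j + 1))) (j : ℕ)
    {ψ : X j → ℝ} (hψ : MemLp ψ ∞ (m j)) :
    ∫ y, dens m T j y * ψ y ∂(m j) = ∫ x, ψ (orbit T (Nat.zero_le j) x) ∂(m 0) := by
  simpa [dens] using integral_transferIter_mul hT (Nat.zero_le j) (integrable_const (1 : ℝ)) hψ

theorem integral_dens
    (hT : ∀ j, Measure.QuasiMeasurePreserving (T j) (m j) (m (j + 1))) (j : ℕ) :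
    ∫ y, dens m T j y ∂(m j) = 1 := by
  simpa using integral_dens_mul hT j (memLp_const (1 : ℝ))

theorem dens_nonneg
    (hT : ∀ j, Measure.QuasiMeasurePreserving (T j) (m j) (m (j + 1))) (j : ℕ) :
    ∀ᵐ y ∂(m j), 0 ≤ dens m T j y := by
  have h1 := transferIter_ae_eq hT (Nat.zero_le j) (integrable_const (1 : ℝ))
  have h2 := transfer_nonneg (quasiMeasurePreserving_orbit hT (Nat.zero_le j))
    (integrable_const (1 : ℝ)) (Eventually.of_forall fun _ => zero_le_one)
  filter_upwards [h1, h2] with y h1 h2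
  exact (h1.symm ▸ h2 : (0 : ℝ) ≤ transferIter m T (Nat.zero_le j) (fun _ => 1) y)

end Iterates

/-! ### Calculus in the spaces `𝓑_j`. -/

section Norm

variable {X : ℕ → Type*} [∀ j, MeasurableSpace (X j)] {m : ∀ j, Measure (X j)}
  {var : ∀ j, (X j → ℝ) → ℝ≥0∞}

/-- `φ ∈ 𝓑_j` with norm at most `b`. -/
def BLe (m : ∀ j, Measure (X j)) (var : ∀ j, (X j → ℝ) → ℝ≥0∞) (j : ℕ) (φ : X j → ℝ)
    (b : ℝ≥0) : Prop :=
  Integrable φ (m j) ∧ bNorm (m j) (var j) φ ≤ b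

/-- A common constant in the sup-norm bound and in the product inequality. -/
structure IsVarConst (m : ∀ j, Measure (X j)) (var : ∀ j, (X j → ℝ) → ℝ≥0∞) (C : ℝ≥0) :
    Prop where
  one_le : 1 ≤ C
  sup : ∀ j (f : X j → ℝ), Integrable f (m j) → eLpNorm f ∞ (m j) ≤ C * bNorm (m j) (var j) f
  mul : ∀ j (f g : X j → ℝ), MemB (m j) (var j) f → MemB (m j) (var j) g →
    var j (fun x => f x * g x) ≤
      C * (eLpNorm f ∞ (m j) * var j g + eLpNorm g ∞ (m j) * var j f)

theorem IsVariation.exists_isVarConst (hv : IsVariation m var) : ∃ C, IsVarConst m var C := by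
  obtain ⟨C, hC⟩ := hv.sup_le
  obtain ⟨C', hC'⟩ := hv.mul_le
  refine ⟨1 + C + C', ?_, fun j f hf => (hC j f hf).trans ?_,
    fun j f g hf hg => (hC' j f g hf hg).trans ?_⟩
  · rw [add_assoc]; exact le_self_add
  · gcongr
    rw [add_comm 1 C, add_assoc]; exact le_self_add
  · gcongr
    exact le_add_self

namespace BLe

variable {j : ℕ} {f g : X j → ℝ} {a b C : ℝ≥0}

theorem mono (hf : BLe m var j f a) (h : a ≤ b) : BLe m var j f b :=
  ⟨hf.1, hf.2.trans (by exact_mod_cast h)⟩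

theorem memB (hf : BLe m var j f a) : MemB (m j) (var j) f :=
  ⟨hf.1, (le_add_self.trans hf.2).trans_lt ENNReal.coe_lt_top⟩

theorem var_le (hf : BLe m var j f a) : var j f ≤ a := le_add_self.trans hf.2

theorem eLpNorm_one_le (hf : BLe m var j f a) : eLpNorm f 1 (m j) ≤ a := le_self_add.trans hf.2

theorem congr_ae (hv : IsVariation m var) (hf : BLe m var j f a) (h : f =ᵐ[m j] g) :
    BLe m var j g a := by
  refine ⟨hf.1.congr h, le_of_eq_of_le ?_ hf.2⟩
  rw [bNorm, bNorm, hv.congr_ae j f g hf.1 h, eLpNorm_congr_ae h]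

theorem add (hv : IsVariation m var) (hf : BLe m var j f a) (hg : BLe m var j g b) :
    BLe m var j (fun x => f x + g x) (a + b) := by
  refine ⟨hf.1.add hg.1, ?_⟩
  have h1 : eLpNorm (fun x => f x + g x) 1 (m j) ≤ eLpNorm f 1 (m j) + eLpNorm g 1 (m j) :=
    eLpNorm_add_le hf.1.1 hg.1.1 le_rfl
  calc bNorm (m j) (var j) (fun x => f x + g x)
      ≤ (eLpNorm f 1 (m j) + eLpNorm g 1 (m j)) + (var j f + var j g) :=
        add_le_add h1 (hv.add_le j f g hf.1 hg.1)
    _ = bNorm (m j) (var j) f + bNorm (m j) (var j) g := by simp only [bNorm]; ring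
    _ ≤ _ := by push_cast; exact add_le_add hf.2 hg.2

theorem const_mul (hv : IsVariation m var) (hf : BLe m var j f a) (t : ℝ) :
    BLe m var j (fun x => t * f x) (‖t‖₊ * a) := by
  refine ⟨hf.1.const_mul t, ?_⟩
  have h1 : eLpNorm (fun x => t * f x) 1 (m j) = ‖t‖ₑ * eLpNorm f 1 (m j) :=
    eLpNorm_const_smul t f 1 (m j)
  have h2 : ENNReal.ofReal |t| = ‖t‖ₑ := (Real.enorm_eq_ofReal_abs t).symm
  rw [bNorm, h1, hv.smul j t f hf.1, h2, ← mul_add]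
  push_cast
  exact mul_le_mul_right hf.2 _

theorem sub (hv : IsVariation m var) (hf : BLe m var j f a) (hg : BLe m var j g b) :
    BLe m var j (fun x => f x - g x) (a + b) := by
  have := hf.add hv (hg.const_mul hv (-1))
  simpa [sub_eq_add_neg] using this

theorem ae_abs_le (hC : IsVarConst m var C) (hf : BLe m var j f a) :
    ∀ᵐ x ∂(m j), |f x| ≤ C * a := by
  have h1 : eLpNormEssSup f (m j) ≤ (C * a : ℝ≥0) := by
    rw [← eLpNorm_exponent_top]
    refine (hC.sup j f hf.1).trans ?_
    push_cast
    exact mul_le_mul_right hf.2 _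
  filter_upwards [ae_le_eLpNormEssSup (f := f) (μ := m j)] with x hx
  have h2 := hx.trans h1
  rw [enorm_eq_nnnorm] at h2
  exact_mod_cast h2

theorem eLpNorm_top_le (hC : IsVarConst m var C) (hf : BLe m var j f a) :
    eLpNorm f ∞ (m j) ≤ C * a :=
  (hC.sup j f hf.1).trans (mul_le_mul_right hf.2 _)

theorem memLp_top (hC : IsVarConst m var C) (hf : BLe m var j f a) : MemLp f ∞ (m j) :=
  memLp_top_of_bound hf.1.1 _ (hf.ae_abs_le hC)

theorem mul (hC : IsVarConst m var C) (hf : BLe m var j f a) (hg : BLe m var j g b) :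
    BLe m var j (fun x => f x * g x) (3 * C ^ 2 * (a * b)) := by
  refine ⟨Integrable.mul_of_top_left hf.1 (hg.memLp_top hC), ?_⟩
  have h1 : eLpNorm (fun x => f x * g x) 1 (m j) ≤ C * a * b :=
    calc _ ≤ eLpNorm f ∞ (m j) * eLpNorm g 1 (m j) := by
          have := eLpNorm_smul_le_mul_eLpNorm (p := ∞) (q := 1) (r := 1) hg.1.1 hf.1.1
          exact this
      _ ≤ _ := mul_le_mul' (hf.eLpNorm_top_le hC) hg.eLpNorm_one_le
  have h2 : var j (fun x => f x * g x) ≤ C * (C * a * b + C * b * a) := by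
    refine (hC.mul j f g hf.memB hg.memB).trans ?_
    gcongr
    exacts [hf.eLpNorm_top_le hC, hg.var_le, hg.eLpNorm_top_le hC, hf.var_le]
  refine (add_le_add h1 h2).trans ?_
  have h3 : C * a * b + C * (C * a * b + C * b * a) ≤ 3 * C ^ 2 * (a * b) := by
    have h4 : C * (a * b) ≤ C ^ 2 * (a * b) := by
      rw [sq]
      exact mul_le_mul_left (le_mul_of_one_le_left' hC.one_le) _
    calc _ = C * (a * b) + 2 * C ^ 2 * (a * b) := by ring
      _ ≤ C ^ 2 * (a * b) + 2 * C ^ 2 * (a * b) := by gcongr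
      _ = _ := by ring
  exact_mod_cast h3

theorem of_memB (hf : MemB (m j) (var j) f) :
    BLe m var j f (bNorm (m j) (var j) f).toNNReal := by
  refine ⟨hf.1, ?_⟩
  rw [ENNReal.coe_toNNReal]
  exact (ENNReal.add_lt_top.2 ⟨(memLp_one_iff_integrable.2 hf.1).2, hf.2⟩).ne

/-- The sup-norm bound controls the `L¹` part. The hypothesis on the variation concerns functions of
variation at most `1`, so `f` is rescaled and homogeneity undoes it. -/
theorem comp [∀ j, IsProbabilityMeasure (m j)] {T : ∀ j, X j → X (j + 1)}
    (hT : ∀ j, Measure.QuasiMeasurePreserving (T j) (m j) (m (j + 1)))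
    (hv : IsVariation m var) (hC : IsVarConst m var C) {c : ℝ≥0}
    (hc : ∀ j (h : X (j + 1) → ℝ), Integrable h (m (j + 1)) →
      var (j + 1) h ≤ 1 → var j (fun x => h (T j x)) ≤ c)
    {f : X (j + 1) → ℝ} (hf : BLe m var (j + 1) f a) :
    BLe m var j (fun x => f (T j x)) (C * a + (a + 1) * c) := by
  have hm : AEStronglyMeasurable (fun x => f (T j x)) (m j) :=
    hf.1.1.comp_quasiMeasurePreserving (hT j)
  have hb : ∀ᵐ x ∂(m j), |f (T j x)| ≤ C * a := (hT j).ae (hf.ae_abs_le hC)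
  have hi : Integrable (fun x => f (T j x)) (m j) := Integrable.of_bound hm _ hb
  refine ⟨hi, ?_⟩
  have h1 : eLpNorm (fun x => f (T j x)) 1 (m j) ≤ (C * a : ℝ≥0) := by
    refine (eLpNorm_le_of_ae_bound (C := C * a) hb).trans ?_
    rw [← NNReal.coe_mul, ENNReal.ofReal_coe_nnreal]
    simp
  -- Scaling by `a + 1` rather than `a` covers the case `a = 0`.
  have ha : ‖((a : ℝ) + 1)⁻¹‖₊ * a ≤ 1 := by
    rw [← NNReal.coe_le_coe]
    push_cast
    rw [norm_inv, Real.norm_of_nonneg (by positivity), inv_mul_le_iff₀ (by positivity)]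
    linarith
  have h2 := hc j (fun x => ((a : ℝ) + 1)⁻¹ * f x) (hf.1.const_mul _)
    (((hf.const_mul hv _).mono ha).var_le.trans (by simp))
  have h3 : var j (fun x => f (T j x)) ≤ ((a + 1) * c : ℝ≥0) := by
    have e : (fun x => f (T j x)) = fun x => ((a : ℝ) + 1) * (((a : ℝ) + 1)⁻¹ * f (T j x)) := by
      ext x; field_simp
    rw [e, hv.smul j _ _ (hi.const_mul _)]
    push_cast
    refine mul_le_mul' (le_of_eq ?_) h2
    rw [abs_of_nonneg (by positivity)]
    rw [ENNReal.ofReal_add (by positivity) zero_le_one]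
    simp
  rw [bNorm]
  exact (add_le_add h1 h3).trans (by push_cast; rfl)

end BLe

end Norm

end SeqLivsic

/-! ### Uniform inverses in `𝓑_j`. -/

namespace SeqLivsic

section Inverse

variable {X : ℕ → Type*} [∀ j, MeasurableSpace (X j)] {m : ∀ j, Measure (X j)}
  {var : ∀ j, (X j → ℝ) → ℝ≥0∞} {C : ℝ≥0}

theorem BLe.sum (hv : IsVariation m var) {j : ℕ} {f : ℕ → X j → ℝ} {a : ℕ → ℝ≥0}
    (h : ∀ i, BLe m var j (f i) (a i)) (s : Finset ℕ) :
    BLe m var j (fun x => ∑ i ∈ s, f i x) (∑ i ∈ s, a i) := by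
  classical
  induction s using Finset.induction_on with
  | empty =>
    have := (h 0).const_mul hv 0
    simpa using this
  | insert i s hi ih =>
    simp only [Finset.sum_insert hi]
    exact (h i).add hv ih

variable [∀ j, IsProbabilityMeasure (m j)]

theorem eLpNorm_le_coe_of_ae_abs_le {Y : Type*} [MeasurableSpace Y] {μ : Measure Y}
    [IsProbabilityMeasure μ] {f : Y → ℝ} {a : ℝ≥0} (h : ∀ᵐ x ∂μ, |f x| ≤ a) (p : ℝ≥0∞) :
    eLpNorm f p μ ≤ a := by
  refine (eLpNorm_le_of_ae_bound (C := a) h).trans ?_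
  simp

theorem BLe.of_bound {j : ℕ} {f : X j → ℝ} {a v : ℝ≥0} (hf : Integrable f (m j))
    (ha : ∀ᵐ x ∂(m j), |f x| ≤ a) (hv : var j f ≤ v) : BLe m var j f (a + v) :=
  ⟨hf, by push_cast; exact add_le_add (eLpNorm_le_coe_of_ae_abs_le ha 1) hv⟩

theorem IsVarConst.var_mul_le (hC : IsVarConst m var C) {j : ℕ} {f g : X j → ℝ} {a b u v : ℝ≥0}
    (hf : MemB (m j) (var j) f) (hg : MemB (m j) (var j) g) (ha : ∀ᵐ x ∂(m j), |f x| ≤ a)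
    (hb : ∀ᵐ x ∂(m j), |g x| ≤ b) (hu : var j f ≤ u) (hv : var j g ≤ v) :
    var j (fun x => f x * g x) ≤ (C * (a * v + b * u) : ℝ≥0) := by
  refine (hC.mul j f g hf hg).trans ?_
  push_cast
  gcongr
  exacts [eLpNorm_le_coe_of_ae_abs_le ha _, eLpNorm_le_coe_of_ae_abs_le hb _]

theorem BLe.const_one (hv : IsVariation m var) (j : ℕ) :
    ∃ a, BLe m var j (fun _ => (1 : ℝ)) a :=
  ⟨_, BLe.of_memB ⟨integrable_const _, hv.one_lt_top j⟩⟩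

/-- The norm of `1` is controlled by the norm of a function that is bounded below. -/
theorem exists_bLe_one (hv : IsVariation m var) (hC : IsVarConst m var C) (b c : ℝ≥0)
    (hc : 0 < c) : ∃ (n : ℕ) (M K : ℝ≥0), 0 < M ∧ ∀ j (h : X j → ℝ), BLe m var j h b →
      (∀ᵐ x ∂(m j), (c : ℝ) ≤ h x) →
      BLe m var j (fun _ => (1 : ℝ)) K ∧ BLe m var j (fun x => (1 - h x / M) ^ n) K ∧
      ∀ᵐ x ∂(m j), 0 ≤ (1 - h x / M) ^ n ∧ (1 - h x / M) ^ n ≤ 1 / (4 * C) := by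
  have hC1 : (1 : ℝ) ≤ C := by exact_mod_cast hC.one_le
  -- `M` exceeds the sup-norm of `h`, so `1 - h / M` takes values in `[0, q]` with `q = 1 - c / M <
  -- 1`, and a high power is below `1 / (4 * C)`.
  set M : ℝ≥0 := C * b + c with hM
  have hM0 : (0 : ℝ) < M := by
    rw [hM]; push_cast; have : (0 : ℝ) < c := hc; positivity
  have hcM : (c : ℝ) ≤ M := by
    rw [hM]; push_cast; have : (0 : ℝ) ≤ C * b := by positivity
    linarith
  set q : ℝ := 1 - c / M with hq
  have hq0 : 0 ≤ q := by
    rw [hq, sub_nonneg, div_le_one hM0]; exact hcM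
  have hq1 : q < 1 := by
    have : (0 : ℝ) < c / M := div_pos hc hM0
    linarith
  obtain ⟨n, hn⟩ := exists_pow_lt_of_lt_one (by positivity : (0 : ℝ) < 1 / (4 * C)) hq1
  -- `1 - (1 - h / M) ^ k` is a polynomial in `h` without constant term, so its norm is controlled
  -- without a bound on the norm of `1`, which is only known to be finite for each `j`.
  have hu : ∀ k : ℕ, ∃ β : ℝ≥0, ∀ j (h : X j → ℝ), BLe m var j h b →
      BLe m var j (fun x => 1 - (1 - h x / M) ^ k) β := by
    intro k
    induction k with
    | zero =>
      refine ⟨0, fun j h hh => ?_⟩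
      have := hh.const_mul hv 0
      simpa using this
    | succ k ih =>
      obtain ⟨β, hβ⟩ := ih
      set b' : ℝ≥0 := ‖(M : ℝ)⁻¹‖₊ * b with hb'
      refine ⟨β + b' + 3 * C ^ 2 * (β * b'), fun j h hh => ?_⟩
      have h1 := hh.const_mul hv (M : ℝ)⁻¹
      have h2 := ((hβ j h hh).add hv h1).sub hv ((hβ j h hh).mul hC h1)
      convert h2 using 2 with x
      rw [pow_succ]; ring
  obtain ⟨β, hβ⟩ := hu n
  set E : ℝ≥0 := β + 3 * C ^ 2 * (β * β) with hE
  refine ⟨n, M, 1 + 2 * E + β, hM0, fun j h hh hch => ?_⟩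
  have hw : ∀ᵐ x ∂(m j), 0 ≤ (1 - h x / M) ^ n ∧ (1 - h x / M) ^ n ≤ 1 / (4 * C) := by
    filter_upwards [hch, hh.ae_abs_le hC] with x h1 h2
    have h3 : h x ≤ M := by
      rw [hM]; push_cast; have := le_abs_self (h x); have : (0 : ℝ) < c := hc; linarith
    have h4 : 0 ≤ 1 - h x / M := by rw [sub_nonneg, div_le_one hM0]; exact h3
    have h5 : 1 - h x / M ≤ q := by rw [hq]; gcongr
    exact ⟨pow_nonneg h4 n, (pow_le_pow_left₀ h4 h5 n).trans hn.le⟩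
  set w : X j → ℝ := fun x => (1 - h x / M) ^ n with hwdef
  have he := hβ j h hh
  obtain ⟨a1, ha1⟩ := BLe.const_one hv j
  obtain ⟨V0, hV0⟩ : ∃ a, BLe m var j w a := by
    refine ⟨_, (ha1.sub hv he).congr_ae hv (Eventually.of_forall fun x => ?_)⟩
    simp [hwdef]
  have hVfin : var j w ≠ ∞ := hV0.memB.2.ne
  set V : ℝ≥0 := (var j w).toNNReal with hVdef
  have hV : var j w = V := (ENNReal.coe_toNNReal hVfin).symm
  set δ : ℝ≥0 := 1 / (4 * C) with hδ
  have hwδ : ∀ᵐ x ∂(m j), |w x| ≤ δ := by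
    filter_upwards [hw] with x hx
    rw [abs_of_nonneg hx.1]
    exact hx.2.trans (le_of_eq (by rw [hδ]; push_cast; rfl))
  have h1 : var j (fun x => w x * w x) ≤ (C * (δ * V + δ * V) : ℝ≥0) :=
    hC.var_mul_le hV0.memB hV0.memB hwδ hwδ hV.le hV.le
  have hee := he.sub hv (he.mul hC he)
  have hww := hV0.mul hC hV0
  -- With `e = 1 - w` one has `w = w ^ 2 + (e - e ^ 2)`. As `w ≤ 1 / (4 * C)`, the variation of `w ^
  -- 2` is at most `V / 2`, which is absorbed because `V` is finite. Then `1 = w + e` is bounded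
  -- too.
  have h2 : V ≤ C * (δ * V + δ * V) + E := by
    rw [← ENNReal.coe_le_coe, ← hV]
    have e : w = fun x => w x * w x + ((1 - (1 - h x / M) ^ n) -
        (1 - (1 - h x / M) ^ n) * (1 - (1 - h x / M) ^ n)) := by
      ext x; simp only [hwdef]; ring
    calc var j w = _ := by conv_lhs => rw [e]
      _ ≤ _ := hv.add_le j _ _ hww.1 hee.1
      _ ≤ _ := by push_cast; exact add_le_add (by exact_mod_cast h1) (by exact_mod_cast hee.var_le)
  have h3 : V ≤ 2 * E := by
    rw [← NNReal.coe_le_coe] at h2 ⊢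
    push_cast at h2 ⊢
    have : (C : ℝ) * (δ * V + δ * V) = V / 2 := by
      rw [hδ]; push_cast; field_simp; ring
    linarith
  have hδ1 : δ ≤ 1 := by
    rw [← NNReal.coe_le_coe, hδ]; push_cast
    rw [div_le_one (by positivity)]; linarith
  have hwB : BLe m var j w (1 + 2 * E) :=
    (BLe.of_bound hV0.1 hwδ hV.le).mono (add_le_add hδ1 h3)
  refine ⟨?_, hwB.mono le_self_add, hw⟩
  have h4 := hwB.add hv he
  refine h4.congr_ae hv (Eventually.of_forall fun x => ?_)
  simp [hwdef]

/-- The Neumann series of a function that is small in the sup-norm. -/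
theorem exists_bLe_one_sub_inv (hv : IsVariation m var) (hC : IsVarConst m var C) (K : ℝ≥0) :
    ∃ K' : ℝ≥0, ∀ j (w : X j → ℝ), BLe m var j (fun _ => (1 : ℝ)) K → BLe m var j w K →
      (∀ᵐ x ∂(m j), 0 ≤ w x ∧ w x ≤ 1 / (4 * C)) →
      BLe m var j (fun x => (1 - w x)⁻¹) K' := by
  have hC1 : (1 : ℝ) ≤ C := by exact_mod_cast hC.one_le
  set B : ℝ≥0 := 4 * C * K + K with hB
  refine ⟨(1 + B) * 2 + 1, fun j w h1 hwK hw => ?_⟩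
  have hw4 : ∀ᵐ x ∂(m j), 0 ≤ w x ∧ w x ≤ 1 / 4 := by
    filter_upwards [hw] with x hx
    refine ⟨hx.1, hx.2.trans ?_⟩
    rw [div_le_div_iff₀ (by positivity) (by norm_num)]
    linarith
  -- Smallness in the sup-norm alone suffices: in `w * w ^ k` the factor `C * (1 / (4 * C))` meets
  -- the variation of `w ^ k`, while the variation of `w` meets `(1 / 4) ^ k`. The choice `B ≥ 4 * C
  -- * K` makes the rate `1 / 2` persist.
  have hpow : ∀ k : ℕ, BLe m var j (fun x => w x ^ k) ((1 + B) * (1 / 2) ^ k) ∧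
      var j (fun x => w x ^ k) ≤ (B * (1 / 2) ^ k : ℝ≥0) := by
    intro k
    have hbd : ∀ k : ℕ, ∀ᵐ x ∂(m j), |w x ^ k| ≤ ((1 / 4) ^ k : ℝ≥0) := by
      intro k
      filter_upwards [hw4] with x hx
      rw [abs_of_nonneg (pow_nonneg hx.1 k)]
      push_cast
      exact pow_le_pow_left₀ hx.1 hx.2 k
    have fin : ∀ k : ℕ, Integrable (fun x => w x ^ k) (m j) → ∀ v : ℝ≥0,
        var j (fun x => w x ^ k) ≤ v → v ≤ B * (1 / 2) ^ k →
        BLe m var j (fun x => w x ^ k) ((1 + B) * (1 / 2) ^ k) := by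
      intro k hi v hv1 hv2
      refine (BLe.of_bound hi (hbd k) hv1).mono ?_
      rw [add_mul, one_mul]
      refine add_le_add (pow_le_pow_left' ?_ k) hv2
      rw [← NNReal.coe_le_coe]; push_cast; norm_num
    induction k with
    | zero =>
      have hv1 : var j (fun x => w x ^ 0) ≤ (B * (1 / 2) ^ 0 : ℝ≥0) := by
        simp only [pow_zero, mul_one]
        refine h1.var_le.trans ?_
        exact_mod_cast (le_add_self : K ≤ 4 * C * K + K)
      exact ⟨fin 0 (by simp) _ hv1 le_rfl, hv1⟩
    | succ k ih =>
      have hwδ : ∀ᵐ x ∂(m j), |w x| ≤ (1 / (4 * C) : ℝ≥0) := by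
        filter_upwards [hw] with x hx
        rw [abs_of_nonneg hx.1]
        push_cast
        exact hx.2
      have hv1 : var j (fun x => w x ^ (k + 1)) ≤ (B * (1 / 2) ^ (k + 1) : ℝ≥0) := by
        simp only [pow_succ' (w _)]
        refine (hC.var_mul_le hwK.memB ih.1.memB hwδ (hbd k) hwK.var_le ih.2).trans ?_
        rw [ENNReal.coe_le_coe, ← NNReal.coe_le_coe]
        push_cast
        have e : (C : ℝ) * (1 / (4 * C) * (B * (1 / 2) ^ k) + (1 / 4) ^ k * K)
            = B * (1 / 2) ^ k / 4 + (C * K) * (1 / 4) ^ k := by field_simp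
        have h3 : ((1 : ℝ) / 4) ^ k ≤ (1 / 2) ^ k :=
          pow_le_pow_left₀ (by norm_num) (by norm_num) k
        have h4 : (C * K : ℝ) ≤ B / 4 := by
          rw [hB]; push_cast; have : (0 : ℝ) ≤ K := K.2; linarith
        have h5 : (C * K : ℝ) * (1 / 4) ^ k ≤ B / 4 * (1 / 2) ^ k :=
          mul_le_mul h4 h3 (by positivity) (by positivity)
        rw [e, pow_succ]
        linarith
      have hi : Integrable (fun x => w x ^ (k + 1)) (m j) := by
        simp only [pow_succ' (w _)]
        exact (hwK.mul hC ih.1).1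
      exact ⟨fin (k + 1) hi _ hv1 le_rfl, hv1⟩
  set s : ℕ → X j → ℝ := fun k x => ∑ i ∈ Finset.range k, w x ^ i with hs
  have hgeom : ∀ a b : ℕ, a ≤ b → ∑ i ∈ Finset.Ico a b, (1 + B) * (1 / 2 : ℝ≥0) ^ i
      ≤ (1 + B) * (2 * (1 / 2) ^ a) := by
    intro a b hab
    rw [← Finset.mul_sum]
    gcongr
    rw [← NNReal.coe_le_coe]
    push_cast
    have h2 := geom_sum_Ico (x := (1 / 2 : ℝ)) (by norm_num) hab
    rw [h2]
    have : (0 : ℝ) ≤ (1 / 2) ^ b := by positivity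
    rw [div_le_iff_of_neg (by norm_num)]
    linarith
  have hsub : ∀ a b : ℕ, a ≤ b →
      BLe m var j (fun x => s b x - s a x) ((1 + B) * (2 * (1 / 2) ^ a)) := by
    intro a b hab
    have h2 := (BLe.sum hv (fun i => (hpow i).1) (Finset.Ico a b)).mono (hgeom a b hab)
    refine h2.congr_ae hv (Eventually.of_forall fun x => ?_)
    simp only [hs]
    exact Finset.sum_Ico_eq_sub _ hab
  have hsB : ∀ k, BLe m var j (s k) ((1 + B) * 2) := by
    intro k
    have h2 := hsub 0 k (Nat.zero_le k)
    simpa [hs] using h2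
  have hsym : ∀ a b : ℕ, bNorm (m j) (var j) (fun x => s a x - s b x)
      ≤ ((1 + B) * (2 * (1 / 2) ^ (min a b)) : ℝ≥0) := by
    intro a b
    rcases le_total a b with hab | hab
    · have h2 := (hsub a b hab).const_mul hv (-1)
      rw [min_eq_left hab]
      have h3 : BLe m var j (fun x => s a x - s b x) ((1 + B) * (2 * (1 / 2) ^ a)) := by
        convert h2 using 1
        · ext x; ring
        · simp
      exact h3.2
    · rw [min_eq_right hab]
      exact (hsub b a hab).2
  have hlim0 : Tendsto (fun k : ℕ => (1 + B) * (2 * (1 / 2 : ℝ≥0) ^ k)) atTop (𝓝 0) := by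
    have h2 : Tendsto (fun k : ℕ => (1 / 2 : ℝ≥0) ^ k) atTop (𝓝 0) :=
      NNReal.tendsto_pow_atTop_nhds_zero_of_lt_one (by rw [← NNReal.coe_lt_coe]; push_cast; norm_num)
    simpa using (h2.const_mul 2).const_mul (1 + B)
  obtain ⟨g, hg, hgt⟩ := hv.complete j s (fun k => (hsB k).memB) (fun ε hε => by
    obtain ⟨N, hN⟩ := (hlim0.eventually_le_const hε).exists_forall_of_atTop
    refine ⟨N, fun a b ha hb => (hsym a b).trans ?_⟩
    exact_mod_cast hN _ (le_min ha hb))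
  have hgB : BLe m var j g ((1 + B) * 2 + 1) := by
    obtain ⟨k, hk⟩ := (hgt.eventually_le_const one_pos).exists
    have h2 : BLe m var j (fun x => s k x - g x) 1 := ⟨(hsB k).1.sub hg.1, by simpa using hk⟩
    refine ((hsB k).sub hv h2).congr_ae hv (Eventually.of_forall fun x => ?_)
    simp
  refine hgB.congr_ae hv ?_
  have hinv : Integrable (fun x => (1 - w x)⁻¹) (m j) := by
    refine Integrable.of_bound (C := 2)
      (aestronglyMeasurable_const.sub hwK.1.1).aemeasurable.inv.aestronglyMeasurable ?_
    filter_upwards [hw4] with x hx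
    rw [Real.norm_of_nonneg (inv_nonneg.2 (by linarith [hx.2]))]
    exact inv_le_of_inv_le₀ (by norm_num) (by linarith [hx.2])
  have hdiff : ∀ k : ℕ, eLpNorm (fun x => s k x - (1 - w x)⁻¹) 1 (m j)
      ≤ (2 * (1 / 4) ^ k : ℝ≥0) := by
    intro k
    refine eLpNorm_le_coe_of_ae_abs_le ?_ 1
    filter_upwards [hw4] with x hx
    have hx1 : 0 < 1 - w x := by linarith [hx.2]
    have e : s k x - (1 - w x)⁻¹ = - (w x ^ k * (1 - w x)⁻¹) := by
      have h2 := mul_neg_geom_sum (w x) k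
      have h3 : s k x = (1 - w x ^ k) * (1 - w x)⁻¹ := by
        rw [← h2]; simp only [hs]; field_simp
      rw [h3]; ring
    rw [e, abs_neg, abs_of_nonneg (mul_nonneg (pow_nonneg hx.1 k) (inv_nonneg.2 hx1.le))]
    push_cast
    have h4 : (1 - w x)⁻¹ ≤ 2 := inv_le_of_inv_le₀ (by norm_num) (by linarith [hx.2])
    have h5 : w x ^ k ≤ (1 / 4) ^ k := pow_le_pow_left₀ hx.1 hx.2 k
    rw [mul_comm]
    exact mul_le_mul h4 h5 (pow_nonneg hx.1 k) (by norm_num)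
  have hdt : Tendsto (fun k : ℕ => eLpNorm (fun x => s k x - (1 - w x)⁻¹) 1 (m j)) atTop
      (𝓝 0) := by
    have h2 : Tendsto (fun k : ℕ => 2 * (1 / 4 : ℝ≥0) ^ k) atTop (𝓝 0) := by
      simpa using (NNReal.tendsto_pow_atTop_nhds_zero_of_lt_one
        (by rw [← NNReal.coe_lt_coe]; push_cast; norm_num : (1 / 4 : ℝ≥0) < 1)).const_mul 2
    refine tendsto_of_tendsto_of_tendsto_of_le_of_le tendsto_const_nhds
      (ENNReal.tendsto_coe.2 h2) (fun _ => zero_le) hdiff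
  have hgt1 : Tendsto (fun k : ℕ => eLpNorm (fun x => s k x - g x) 1 (m j)) atTop (𝓝 0) :=
    tendsto_of_tendsto_of_tendsto_of_le_of_le tendsto_const_nhds hgt (fun _ => zero_le)
      fun k => le_self_add
  -- Completeness only gives some limit `g` in `𝓑_j`; it is identified with `(1 - w)⁻¹` through `L¹`
  -- limits of the geometric sums.
  have hz : eLpNorm (fun x => g x - (1 - w x)⁻¹) 1 (m j) = 0 := by
    refine le_antisymm (ge_of_tendsto' (by simpa using hdt.add hgt1) fun k => ?_) zero_le
    have h2 : (fun x => g x - (1 - w x)⁻¹) =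
        (fun x => s k x - (1 - w x)⁻¹) - fun x => s k x - g x := by
      ext x; simp
    rw [h2]
    exact eLpNorm_sub_le ((hsB k).1.sub hinv).1 ((hsB k).1.sub hg.1).1 le_rfl
  have hz' := (eLpNorm_eq_zero_iff (f := fun x => g x - (1 - w x)⁻¹) (hg.1.sub hinv).1
    one_ne_zero).1 hz
  filter_upwards [hz'] with x hx
  simp only [Pi.zero_apply] at hx
  linarith

/-- Functions bounded below by a positive constant are invertible in `𝓑`, uniformly. -/
theorem exists_bLe_inv (hv : IsVariation m var) (hC : IsVarConst m var C) (b c : ℝ≥0)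
    (hc : 0 < c) : ∃ K : ℝ≥0, ∀ j (h : X j → ℝ), BLe m var j h b →
      (∀ᵐ x ∂(m j), (c : ℝ) ≤ h x) →
      BLe m var j (fun _ => (1 : ℝ)) K ∧ BLe m var j (fun x => (h x)⁻¹) K := by
  obtain ⟨n, M, K, hM, hK⟩ := exists_bLe_one hv hC b c hc
  obtain ⟨K', hK'⟩ := exists_bLe_one_sub_inv hv hC K
  have hM0 : (0 : ℝ) < M := hM
  have hP : ∀ k : ℕ, ∃ β : ℝ≥0, ∀ j (h : X j → ℝ), BLe m var j h b →
      BLe m var j (fun _ => (1 : ℝ)) K →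
      BLe m var j (fun x => ∑ i ∈ Finset.range k, (1 - h x / M) ^ i) β := by
    intro k
    induction k with
    | zero =>
      refine ⟨0, fun j h hh _ => ?_⟩
      have := hh.const_mul hv 0
      simpa using this
    | succ k ih =>
      obtain ⟨β, hβ⟩ := ih
      refine ⟨3 * C ^ 2 * (β * (K + ‖(M : ℝ)⁻¹‖₊ * b)) + K, fun j h hh h1 => ?_⟩
      have h2 := ((hβ j h hh h1).mul hC (h1.sub hv (hh.const_mul hv (M : ℝ)⁻¹))).add hv h1
      refine h2.congr_ae hv (Eventually.of_forall fun x => ?_)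
      simp only
      rw [Finset.sum_range_succ', Finset.sum_mul, pow_zero]
      congr 1
      refine Finset.sum_congr rfl fun i _ => ?_
      rw [pow_succ]; ring
  obtain ⟨β, hβ⟩ := hP n
  refine ⟨K + ‖(M : ℝ)⁻¹‖₊ * (3 * C ^ 2 * (β * K')), fun j h hh hch => ?_⟩
  obtain ⟨h1, h2, h3⟩ := hK j h hh hch
  refine ⟨h1.mono le_self_add, ?_⟩
  -- With `w = (1 - h / M) ^ n`, the geometric sum `S` satisfies `(h / M) * S = 1 - w`, whence `1 /
  -- h = M⁻¹ * S * (1 - w)⁻¹`.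
  have h4 := ((hβ j h hh h1).mul hC (hK' j _ h1 h2 h3)).const_mul hv (M : ℝ)⁻¹
  refine (h4.mono le_add_self).congr_ae hv ?_
  have hC1 : (1 : ℝ) ≤ C := by exact_mod_cast hC.one_le
  filter_upwards [h3, hch] with x hx hcx
  have hx0 : 0 < h x := lt_of_lt_of_le hc hcx
  have h5 : (1 - h x / M) ^ n < 1 := by
    refine lt_of_le_of_lt hx.2 ?_
    rw [div_lt_one (by positivity)]; linarith
  have h6 : (1 - (1 - h x / M) ^ n) ≠ 0 := by linarith
  have h7 := mul_neg_geom_sum (1 - h x / M) n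
  rw [show (1 - (1 - h x / M)) = h x / M by ring] at h7
  rw [← h7] at h6 ⊢
  have h8 := right_ne_zero_of_mul h6
  generalize ∑ i ∈ Finset.range n, (1 - h x / M) ^ i = S at h8
  field_simp

end Inverse

end SeqLivsic

/-! ### Contraction of mean-zero functions. -/

namespace SeqLivsic

/-- An upper bound preserved by `x ↦ α * x + β`; it closes the inductions with steps of fixed
length. -/
theorem exists_le_and_mul_add_le {α : ℝ≥0} (hα : α < 1) (a β : ℝ≥0) :
    ∃ x : ℝ≥0, a ≤ x ∧ α * x + β ≤ x := by
  have hα' : (0 : ℝ) < 1 - α := sub_pos.2 (by exact_mod_cast hα)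
  have e : ((1 - α : ℝ≥0) : ℝ) = 1 - α := by rw [NNReal.coe_sub hα.le, NNReal.coe_one]
  refine ⟨a + β / (1 - α), le_self_add, ?_⟩
  rw [← NNReal.coe_le_coe]
  push_cast
  rw [e]
  have h1 : (β : ℝ) / (1 - α) * (1 - α) = β := div_mul_cancel₀ _ hα'.ne'
  have h2 : (0 : ℝ) ≤ a * (1 - α) := by positivity
  linarith

section QLe

variable {X : ℕ → Type*} [∀ j, MeasurableSpace (X j)] {m : ∀ j, Measure (X j)}
  {var : ∀ j, (X j → ℝ) → ℝ≥0∞} {C : ℝ≥0} {T : ∀ j, X j → X (j + 1)}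

/-- The function `φ` has mean zero, is dominated by `s` times the density `dens j`, and has norm
at most `R * s` in `𝓑_j`. -/
structure QLe (m : ∀ j, Measure (X j)) (var : ∀ j, (X j → ℝ) → ℝ≥0∞) (T : ∀ j, X j → X (j + 1))
    (R : ℝ≥0) (j : ℕ) (φ : X j → ℝ) (s : ℝ≥0) : Prop where
  integral_eq : ∫ x, φ x ∂(m j) = 0
  dom : ∀ᵐ x ∂(m j), |φ x| ≤ s * dens m T j x
  bLe : BLe m var j φ (R * s)

namespace QLe

variable {R : ℝ≥0} {j : ℕ} {φ φ' : X j → ℝ} {s s' : ℝ≥0}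

theorem congr_ae (hv : IsVariation m var) (h : QLe m var T R j φ s) (he : φ =ᵐ[m j] φ') :
    QLe m var T R j φ' s := by
  refine ⟨by rw [← integral_congr_ae he]; exact h.1, ?_, h.3.congr_ae hv he⟩
  filter_upwards [h.2, he] with x h1 h2
  rwa [← h2]

theorem add (hv : IsVariation m var) (h : QLe m var T R j φ s) (h' : QLe m var T R j φ' s') :
    QLe m var T R j (fun x => φ x + φ' x) (s + s') := by
  refine ⟨?_, ?_, (h.3.add hv h'.3).mono (by rw [mul_add])⟩
  · rw [integral_add h.3.1 h'.3.1, h.1, h'.1, add_zero]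
  · filter_upwards [h.2, h'.2] with x h1 h2
    refine (abs_add_le _ _).trans ?_
    push_cast
    linarith

/-- Where the density is at least `c`, the sup-norm bound `C * b` is at most `C * b / c` times the
density. The summand `b` covers the norm, as `1 ≤ R`. -/
theorem of_bLe (hC : IsVarConst m var C) {c b : ℝ≥0} (hc : 0 < c) (hR : 1 ≤ R)
    (hd : ∀ᵐ x ∂(m j), (c : ℝ) ≤ dens m T j x) (hφ : BLe m var j φ b)
    (h0 : ∫ x, φ x ∂(m j) = 0) : QLe m var T R j φ (b + C * b / c) := by
  refine ⟨h0, ?_, hφ.mono ?_⟩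
  · filter_upwards [hφ.ae_abs_le hC, hd] with x h1 h2
    refine h1.trans ?_
    have hc' : (0 : ℝ) < c := hc
    push_cast
    calc (C * b : ℝ) = (C * b / c) * c := by field_simp
      _ ≤ (b + C * b / c) * dens m T j x :=
        mul_le_mul (le_add_of_nonneg_left b.2) h2 hc'.le (by positivity)
  · exact (le_mul_of_one_le_left' hR).trans (by gcongr; exact le_self_add)

end QLe

end QLe

section Decay

variable {X : ℕ → Type*} [∀ j, MeasurableSpace (X j)] {m : ∀ j, Measure (X j)}
  [∀ j, IsProbabilityMeasure (m j)] {var : ∀ j, (X j → ℝ) → ℝ≥0∞} {C : ℝ≥0}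
  {T : ∀ j, X j → X (j + 1)}

theorem transferIter_add (hT : ∀ j, Measure.QuasiMeasurePreserving (T j) (m j) (m (j + 1)))
    {j k : ℕ} (h : j ≤ k) {φ φ' : X j → ℝ} (hφ : Integrable φ (m j))
    (hφ' : Integrable φ' (m j)) :
    transferIter m T h (fun x => φ x + φ' x) =ᵐ[m k]
      fun y => transferIter m T h φ y + transferIter m T h φ' y := by
  filter_upwards [transferIter_ae_eq hT h hφ, transferIter_ae_eq hT h hφ',
    transferIter_ae_eq hT h (hφ.add hφ'),
    transfer_add (quasiMeasurePreserving_orbit hT h) hφ hφ'] with y h1 h2 h3 h4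
  rw [h1, h2, ← h4]
  exact h3

theorem transferIter_const_mul
    (hT : ∀ j, Measure.QuasiMeasurePreserving (T j) (m j) (m (j + 1)))
    {j k : ℕ} (h : j ≤ k) {φ : X j → ℝ} (hφ : Integrable φ (m j)) (c : ℝ) :
    transferIter m T h (fun x => c * φ x) =ᵐ[m k] fun y => c * transferIter m T h φ y := by
  filter_upwards [transferIter_ae_eq hT h hφ, transferIter_ae_eq hT h (hφ.const_mul c),
    transfer_const_mul (quasiMeasurePreserving_orbit hT h) hφ c] with y h1 h2 h3
  rw [h1, ← h3]
  exact h2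

/-- Positivity, together with the fact that the operators carry `dens` at `j` to `dens` at `k`; the
constant `s` is not lost. -/
theorem abs_transferIter_le (hT : ∀ j, Measure.QuasiMeasurePreserving (T j) (m j) (m (j + 1)))
    {j k : ℕ} (h : j ≤ k) {φ : X j → ℝ} (hφ : Integrable φ (m j)) {s : ℝ}
    (hs : ∀ᵐ x ∂(m j), |φ x| ≤ s * dens m T j x) :
    ∀ᵐ y ∂(m k), |transferIter m T h φ y| ≤ s * dens m T k y := by
  have hd := dens_integrable (m := m) (T := T) j
  filter_upwards [transferIter_ae_eq hT h hφ, transferIter_ae_eq hT h (hd.const_mul s),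
    transferIter_const_mul hT h hd s,
    abs_transfer_le (quasiMeasurePreserving_orbit hT h) hφ (hd.const_mul s) hs]
    with y h1 h2 h3 h4
  rw [h1]
  rw [h2, transferIter_dens] at h3
  exact h4.trans h3.le

theorem eLpNorm_one_le_of_abs_le_dens
    (hT : ∀ j, Measure.QuasiMeasurePreserving (T j) (m j) (m (j + 1))) {j : ℕ} {φ : X j → ℝ}
    (hφ : Integrable φ (m j)) {s : ℝ≥0} (hs : ∀ᵐ x ∂(m j), |φ x| ≤ s * dens m T j x) :
    eLpNorm φ 1 (m j) ≤ s := by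
  rw [eLpNorm_one_eq_lintegral_enorm, ← ofReal_integral_norm_eq_lintegral_enorm hφ]
  have h1 : ∫ x, ‖φ x‖ ∂(m j) ≤ ∫ x, s * dens m T j x ∂(m j) :=
    integral_mono_ae hφ.norm ((dens_integrable j).const_mul _) hs
  rw [integral_const_mul, integral_dens hT, mul_one] at h1
  exact (ENNReal.ofReal_le_ofReal h1).trans (by simp)

theorem exists_bLe_transfer (hadm : IsAdmissible m var T) :
    ∃ K : ℝ≥0, 1 ≤ K ∧ ∀ j (φ : X j → ℝ) (a : ℝ≥0), BLe m var j φ a →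
      BLe m var (j + 1) (transfer (m j) (m (j + 1)) (T j) φ) (K * a) := by
  obtain ⟨K, -, hK⟩ := hadm.bounded
  refine ⟨max K 1, le_max_right _ _, fun j φ a h => ⟨transfer_integrable h.1, ?_⟩⟩
  refine (hK j φ h.memB).trans ?_
  push_cast
  exact mul_le_mul' (by exact_mod_cast le_max_left K 1) h.2

/-- The densities have `L¹` norm one, so the Lasota–Yorke inequality keeps a common bound in steps
of `N`; the first `N` densities are handled by the one-step bound. -/
theorem exists_bLe_dens (hT : ∀ j, Measure.QuasiMeasurePreserving (T j) (m j) (m (j + 1)))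
    (hv : IsVariation m var) (hadm : IsAdmissible m var T) :
    ∃ b : ℝ≥0, ∀ j, BLe m var j (dens m T j) b := by
  obtain ⟨K, hK1, hK⟩ := exists_bLe_transfer hadm
  obtain ⟨N, α, β, hN, -, hα, -, hLY⟩ := hadm.lasotaYorke
  obtain ⟨b0, hb0⟩ := BLe.const_one hv 0
  obtain ⟨b, hb, hb'⟩ := exists_le_and_mul_add_le hα (K ^ N * b0) β
  have crude : ∀ j, BLe m var j (dens m T j) (K ^ j * b0) := by
    intro j
    induction j with
    | zero => rw [dens_zero]; simpa using hb0
    | succ j ih =>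
      rw [dens_succ]
      exact (hK j _ _ ih).mono (by rw [pow_succ', mul_assoc])
  refine ⟨b, fun j => ?_⟩
  induction j using Nat.strong_induction_on with
  | _ j ih =>
    rcases lt_or_ge j N with hj | hj
    · refine (crude j).mono (le_trans ?_ hb)
      gcongr
    · obtain ⟨i, rfl⟩ := Nat.exists_eq_add_of_le' hj
      have hi := ih i (by omega)
      refine ⟨dens_integrable _, ?_⟩
      have h1 := hLY i (dens m T i) hi.memB
      rw [transferIter_dens] at h1
      refine h1.trans (le_trans ?_ (ENNReal.coe_le_coe.2 hb'))
      have h2 : eLpNorm (dens m T i) 1 (m i) ≤ (1 : ℝ≥0) := by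
        refine eLpNorm_one_le_of_abs_le_dens hT hi.1 ?_
        filter_upwards [dens_nonneg hT i] with x hx
        rw [abs_of_nonneg hx]; simp
      push_cast
      refine add_le_add (mul_le_mul_right hi.2 _) ?_
      exact (mul_le_mul_right h2 _).trans (by simp)

/-- Domination by `s * dens` keeps the `L¹` norm below `s` along the iteration, so the weak terms
add up to at most `B * s` with `α * B + β ≤ B`. The target index is a variable `k` with an equation,
which avoids casts between the types `X k`. -/
theorem exists_iterated_lasotaYorke
    (hT : ∀ j, Measure.QuasiMeasurePreserving (T j) (m j) (m (j + 1)))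
    (hadm : IsAdmissible m var T) :
    ∃ (N : ℕ) (α B : ℝ≥0), 1 ≤ N ∧ α < 1 ∧ ∀ (q j : ℕ) (φ : X j → ℝ) (a s : ℝ≥0),
      BLe m var j φ a → (∀ᵐ x ∂(m j), |φ x| ≤ s * dens m T j x) →
      ∀ k (h : j ≤ k), k = j + q * N →
        BLe m var k (transferIter m T h φ) (α ^ q * a + B * s) := by
  obtain ⟨N, α, β, hN, -, hα, -, hLY⟩ := hadm.lasotaYorke
  obtain ⟨B, -, hB⟩ := exists_le_and_mul_add_le hα 0 β
  refine ⟨N, α, B, hN, hα, fun q => ?_⟩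
  induction q with
  | zero =>
    intro j φ a s hφ _ k h hk
    obtain rfl : k = j := by omega
    rw [transferIter_self]
    exact hφ.mono (by rw [pow_zero, one_mul]; exact le_self_add)
  | succ q ih =>
    intro j φ a s hφ hs k h hk
    have hk' : k = (j + q * N) + N := by rw [hk]; ring
    subst hk'
    have h1 : j ≤ j + q * N := Nat.le_add_right _ _
    have h2 := ih j φ a s hφ hs _ h1 rfl
    rw [transferIter_trans T m h1 (Nat.le_add_right _ _)]
    refine ⟨transferIter_integrable _ h2.1, (hLY _ _ h2.memB).trans ?_⟩
    have h3 := eLpNorm_one_le_of_abs_le_dens hT h2.1 (abs_transferIter_le hT h1 hφ.1 hs)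
    have h4 : α * (α ^ q * a + B * s) + β * s ≤ α ^ (q + 1) * a + B * s := by
      calc _ = α ^ (q + 1) * a + (α * B + β) * s := by ring
        _ ≤ _ := by gcongr
    refine le_trans ?_ (ENNReal.coe_le_coe.2 h4)
    push_cast
    refine add_le_add (mul_le_mul_right ?_ _) (mul_le_mul_right h3 _)
    exact_mod_cast h2.2

namespace QLe

variable {R : ℝ≥0} {j : ℕ} {φ φ' : X j → ℝ} {s s' : ℝ≥0}

theorem mono (hT : ∀ j, Measure.QuasiMeasurePreserving (T j) (m j) (m (j + 1)))
    (h : QLe m var T R j φ s) (hs : s ≤ s') : QLe m var T R j φ s' := by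
  refine ⟨h.1, ?_, h.3.mono (by gcongr)⟩
  filter_upwards [h.2, dens_nonneg hT j] with x h1 h2
  exact h1.trans (mul_le_mul_of_nonneg_right (by exact_mod_cast hs) h2)

theorem zero (hv : IsVariation m var) : QLe m var T R j (fun _ => 0) 0 := by
  refine ⟨by simp, by simp, ?_⟩
  obtain ⟨a, ha⟩ := BLe.const_one hv j
  simpa using ha.const_mul hv 0

theorem transfer (hT : ∀ j, Measure.QuasiMeasurePreserving (T j) (m j) (m (j + 1)))
    {K : ℝ≥0} (hK1 : 1 ≤ K)
    (hK : ∀ j (φ : X j → ℝ) (a : ℝ≥0), BLe m var j φ a →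
      BLe m var (j + 1) (transfer (m j) (m (j + 1)) (T j) φ) (K * a))
    (h : QLe m var T R j φ s) :
    QLe m var T R (j + 1) (SeqLivsic.transfer (m j) (m (j + 1)) (T j) φ) (K * s) := by
  refine ⟨by rw [integral_transfer (hT j) h.3.1, h.1], ?_,
    (hK j φ _ h.3).mono (le_of_eq (by ring))⟩
  have h1 := abs_transferIter_le hT (Nat.le_succ j) h.3.1 h.2
  rw [transferIter_succ T m le_rfl, transferIter_self] at h1
  filter_upwards [h1, dens_nonneg hT (j + 1)] with y h1 h2
  refine h1.trans (mul_le_mul_of_nonneg_right ?_ h2)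
  exact_mod_cast le_mul_of_one_le_left' hK1

end QLe

/-- Contraction of mean-zero functions under a fixed number of transfer operators. -/
theorem exists_contraction (hT : ∀ j, Measure.QuasiMeasurePreserving (T j) (m j) (m (j + 1)))
    (hv : IsVariation m var) (hC : IsVarConst m var C) (hadm : IsAdmissible m var T) :
    ∃ (R : ℝ≥0) (n : ℕ) (γ : ℝ≥0), 1 ≤ R ∧ 1 ≤ n ∧ γ < 1 ∧ ∀ j (φ : X j → ℝ) (s : ℝ≥0),
      QLe m var T R j φ s →
      QLe m var T R (j + n) (transferIter m T (Nat.le_add_right j n) φ) (γ * s) := by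
  obtain ⟨N, α, B, hN, hα, hLY⟩ := exists_iterated_lasotaYorke hT hadm
  obtain ⟨b, hb⟩ := exists_bLe_dens hT hv hadm
  -- This weight gives `B * s ≤ R * s / 4`; with `α ^ q ≤ 1 / 4` the norm is at least halved.
  set R : ℝ≥0 := 4 * B + 1 with hR
  have hR1 : 1 ≤ R := le_add_self
  have hR1' : (1 : ℝ) ≤ R := by exact_mod_cast hR1
  -- The functions `s * dens ± φ` have integral `s` and variation at most `(b + R) * s`.
  obtain ⟨c, n0, hc, hcov⟩ := hadm.covering (b + R) (by positivity)
  obtain ⟨q0, hq0⟩ := exists_pow_lt_of_lt_one (by norm_num : (0 : ℝ≥0) < 1 / 4) hα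
  set q : ℕ := q0 + n0 + 1 with hq
  have hαq : α ^ q ≤ 1 / 4 :=
    (pow_le_pow_of_le_one zero_le hα.le (by omega : q0 ≤ q)).trans hq0.le
  have hn0 : n0 ≤ q * N := by nlinarith
  -- An upper bound for the densities, so that `c ≥ (c / M) * dens`. No lower bound on `dens`
  -- enters.
  set M : ℝ := C * b + 1 with hM
  have hM0 : 0 < M := by positivity
  set γ : ℝ≥0 := max (1 / 2) (Real.toNNReal (1 - c / M)) with hγ
  have hγ1 : γ < 1 := by
    refine max_lt ?_ ?_
    · rw [← NNReal.coe_lt_coe]; push_cast; norm_num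
    · rw [Real.toNNReal_lt_one]
      have : 0 < c / M := div_pos hc hM0
      linarith
  have hγc : 1 - c / M ≤ (γ : ℝ) :=
    (Real.le_coe_toNNReal _).trans (by exact_mod_cast le_max_right _ _)
  have hγ2 : 1 / 2 ≤ γ := le_max_left _ _
  refine ⟨R, q * N, γ, hR1, by nlinarith, hγ1, fun j φ s h => ?_⟩
  set k := j + q * N with hk
  have hjk : j ≤ k := Nat.le_add_right j (q * N)
  have hd := dens_integrable (m := m) (T := T) j
  -- the two nonnegative functions `s * dens ± φ`
  have key : ∀ t : ℝ, |t| = 1 → ∀ᵐ y ∂(m k),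
      c * s ≤ s * dens m T k y + t * transferIter m T hjk φ y := by
    intro t ht
    set ψ : X j → ℝ := fun x => s * dens m T j x + t * φ x with hψ
    have hψB : BLe m var j ψ (s * b + R * s) := by
      have := ((hb j).const_mul hv (s : ℝ)).add hv (h.3.const_mul hv t)
      refine this.mono ?_
      have e1 : ‖(s : ℝ)‖₊ = s := by ext; simp
      have e2 : ‖t‖₊ = 1 := by ext; simpa using ht
      rw [e1, e2, one_mul]
    have hψ0 : 0 ≤ᵐ[m j] ψ := by
      filter_upwards [h.2] with x hx
      have h1 := neg_abs_le (t * φ x)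
      rw [abs_mul, ht, one_mul] at h1
      simp only [hψ, Pi.zero_apply]
      linarith
    have hψi : ∫ x, ψ x ∂(m j) = s := by
      simp only [hψ]
      rw [integral_add (hd.const_mul _) (h.3.1.const_mul t), integral_const_mul,
        integral_const_mul, h.1, integral_dens hT]
      simp
    have hvarψ : var j ψ ≤ ENNReal.ofReal ((b + R) * ∫ x, ψ x ∂(m j)) := by
      rw [hψi]
      refine hψB.var_le.trans (le_of_eq ?_)
      have e : ((b : ℝ) + R) * s = ((s * b + R * s : ℝ≥0) : ℝ) := by push_cast; ring
      rw [e, ENNReal.ofReal_coe_nnreal]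
    have habs : ∫ x, |ψ x| ∂(m j) = s := by
      rw [← hψi]
      exact integral_congr_ae (hψ0.mono fun x hx => abs_of_nonneg hx)
    have h1 := hcov j (q * N) hn0 ψ hψB.memB hψ0 hvarψ
    rw [habs] at h1
    filter_upwards [h1, transferIter_add hT hjk (hd.const_mul (s : ℝ)) (h.3.1.const_mul t),
      transferIter_const_mul hT hjk hd (s : ℝ), transferIter_const_mul hT hjk h.3.1 t]
      with y h1 h2 h3 h4
    rw [h3, h4, transferIter_dens] at h2
    rw [← h2]
    exact h1
  refine ⟨?_, ?_, ?_⟩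
  · have h1 := integral_transferIter_mul hT hjk h.3.1 (memLp_const (1 : ℝ))
    simpa [h.1] using h1
  · filter_upwards [key 1 (by simp), key (-1) (by simp), (hb k).ae_abs_le hC, dens_nonneg hT k]
      with y h1 h2 h3 h4
    have h5 : dens m T k y ≤ M := by
      rw [hM]; linarith [le_abs_self (dens m T k y)]
    have h6 : c / M * dens m T k y ≤ c := by
      rw [div_mul_eq_mul_div, div_le_iff₀ hM0]
      exact mul_le_mul_of_nonneg_left h5 hc.le
    -- Both signs in `key` together leave `|𝓛φ| ≤ s * (dens - c)`, which is at most `s * (1 - c / M)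
    -- * dens`.
    have h7 : |transferIter m T hjk φ y| ≤ s * (dens m T k y - c) :=
      abs_le.2 ⟨by linarith [h1.out], by linarith [h2.out]⟩
    refine h7.trans ?_
    push_cast
    have h8 : dens m T k y - c ≤ γ * dens m T k y := by
      have := mul_le_mul_of_nonneg_right hγc h4
      linarith
    calc (s : ℝ) * (dens m T k y - c) ≤ s * (γ * dens m T k y) :=
          mul_le_mul_of_nonneg_left h8 s.2
      _ = _ := by ring
  · refine (hLY q j φ _ s h.3 h.2 k hjk rfl).mono ?_
    have h1 : α ^ q * (R * s) + B * s ≤ 1 / 2 * (R * s) := by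
      have h2 : α ^ q * (R * s) ≤ 1 / 4 * (R * s) := by gcongr
      have h3 : B * s ≤ 1 / 4 * (R * s) := by
        rw [← mul_assoc]
        gcongr
        rw [hR, ← NNReal.coe_le_coe]; push_cast; linarith
      refine (add_le_add h2 h3).trans (le_of_eq ?_)
      rw [← NNReal.coe_inj]; push_cast; ring
    refine h1.trans ?_
    calc _ ≤ γ * (R * s) := by gcongr
      _ = _ := by ring

/-- The solution of `W_{k+1} = 𝓛_k (W_k + φ_k)` with `W_0 = 0`. -/
noncomputable def cum (m : ∀ j, Measure (X j)) (T : ∀ j, X j → X (j + 1)) (φ : ∀ k, X k → ℝ) :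
    ∀ k, X k → ℝ
  | 0 => fun _ => 0
  | k + 1 => transfer (m k) (m (k + 1)) (T k) fun x => cum m T φ k x + φ k x

/-- The value at `j + n` is the contracted value at `j` plus the effect of the last `n` sources,
which is bounded independently of `j`; hence a bound `s` with `γ * s + D n ≤ s` propagates. -/
theorem exists_qLe_cum (hT : ∀ j, Measure.QuasiMeasurePreserving (T j) (m j) (m (j + 1)))
    (hv : IsVariation m var) (hadm : IsAdmissible m var T) {R γ : ℝ≥0} {n : ℕ} (hn : 1 ≤ n)
    (hγ : γ < 1)
    (hcon : ∀ j (φ : X j → ℝ) (s : ℝ≥0), QLe m var T R j φ s →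
      QLe m var T R (j + n) (transferIter m T (Nat.le_add_right j n) φ) (γ * s)) (s₀ : ℝ≥0) :
    ∃ s : ℝ≥0, ∀ φ : ∀ k, X k → ℝ, (∀ k, QLe m var T R k (φ k) s₀) →
      ∀ k, QLe m var T R k (cum m T φ k) s := by
  obtain ⟨K, hK1, hK⟩ := exists_bLe_transfer hadm
  -- The crude bound over `i` steps from zero, each adding `s₀` and multiplying by the operator
  -- bound `K`.
  let D : ℕ → ℝ≥0 := fun i => Nat.rec 0 (fun _ d => K * (d + s₀)) i
  have hD0 : D 0 = 0 := rfl
  have hDs : ∀ i, D (i + 1) = K * (D i + s₀) := fun _ => rfl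
  have hDm : Monotone D := monotone_nat_of_le_succ fun i => by
    rw [hDs]
    exact le_self_add.trans (le_mul_of_one_le_left' hK1)
  obtain ⟨s, hs, hs'⟩ := exists_le_and_mul_add_le hγ (D n) (D n)
  refine ⟨s, fun φ hφ => ?_⟩
  have crude : ∀ k, QLe m var T R k (cum m T φ k) (D k) := by
    intro k
    induction k with
    | zero => exact QLe.zero hv
    | succ k ih => exact QLe.transfer hT hK1 hK (ih.add hv (hφ k))
  have hdiff : ∀ j i, QLe m var T R (j + i) (fun x => cum m T φ (j + i) x -
      transferIter m T (Nat.le_add_right j i) (cum m T φ j) x) (D i) := by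
    intro j i
    induction i with
    | zero =>
      have : (fun x => cum m T φ (j + 0) x -
          transferIter m T (Nat.le_add_right j 0) (cum m T φ j) x) = fun _ => 0 := by
        ext x
        rw [sub_eq_zero]
        exact (congrFun (transferIter_self T m (Nat.le_refl j) (cum m T φ j)) x).symm
      rw [this]
      exact QLe.zero hv
    | succ i ih =>
      have h1 := QLe.transfer hT hK1 hK (ih.add hv (hφ (j + i)))
      refine h1.congr_ae hv ?_
      have hi1 := (crude (j + i)).3.1
      have hi2 := transferIter_integrable (T := T) (Nat.le_add_right j i) (crude j).3.1
      have h2 := transfer_sub (hT (j + i)) (hi1.add (hφ (j + i)).3.1) hi2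
      have e : (fun x => (cum m T φ (j + i) + φ (j + i)) x -
            transferIter m T (Nat.le_add_right j i) (cum m T φ j) x) =
          fun x => cum m T φ (j + i) x -
            transferIter m T (Nat.le_add_right j i) (cum m T φ j) x + φ (j + i) x := by
        ext x; simp only [Pi.add_apply]; ring
      rw [e] at h2
      refine h2.trans (Eventually.of_forall fun y => ?_)
      change _ = cum m T φ (j + i + 1) y - transferIter m T _ (cum m T φ j) y
      rw [transferIter_succ T m (Nat.le_add_right j i)]
      rfl
  intro k
  induction k using Nat.strong_induction_on with
  | _ k ih =>
    rcases lt_or_ge k n with hk | hk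
    · exact (crude k).mono hT ((hDm hk.le).trans hs)
    · obtain ⟨j, rfl⟩ := Nat.exists_eq_add_of_le' hk
      have h1 := (hdiff j n).add hv (hcon j _ s (ih j (by omega)))
      refine (h1.mono hT (by rw [add_comm]; exact hs')).congr_ae hv
        (Eventually.of_forall fun y => ?_)
      simp

end Decay

end SeqLivsic

/-! ### The martingale-coboundary decomposition. -/

namespace SeqLivsic

/-- The martingale estimates need functions that are measurable and bounded everywhere; truncating a
measurable representative provides them. -/
theorem exists_measurable_bounded_ae_eq {Y : Type*} [MeasurableSpace Y] {μ : Measure Y}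
    {f : Y → ℝ} (hf : AEStronglyMeasurable f μ) {D : ℝ} (hD : 0 ≤ D)
    (hfD : ∀ᵐ y ∂μ, |f y| ≤ D) :
    ∃ g : Y → ℝ, Measurable g ∧ (∀ y, |g y| ≤ D) ∧ f =ᵐ[μ] g := by
  refine ⟨fun y => max (-D) (min D (hf.mk f y)),
    measurable_const.max (measurable_const.min hf.stronglyMeasurable_mk.measurable),
    fun y => abs_le.2 ⟨le_max_left _ _, max_le (by linarith) (min_le_left _ _)⟩, ?_⟩
  filter_upwards [hf.ae_eq_mk, hfD] with y h1 h2
  rw [← h1, min_eq_right (abs_le.1 h2).2, max_eq_right (abs_le.1 h2).1]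

section Decomposition

variable {X : ℕ → Type*} {T : ∀ j, X j → X (j + 1)}

/-- `X a` and `X b` are different types even when `a = b` is provable, so points of orbits are
compared through real values. -/
theorem apply_orbit_congr (g : ∀ k, X k → ℝ) {j a b : ℕ} (hab : a = b) (ha : j ≤ a) (hb : j ≤ b)
    (x : X j) : g a (orbit T ha x) = g b (orbit T hb x) := by
  subst hab; rfl

theorem apply_orbit_add_succ (g : ∀ k, X k → ℝ) (j i : ℕ) (x : X j) :
    g (j + (i + 1)) (orbit T (Nat.le_add_right j (i + 1)) x) =
      g (j + 1 + i) (orbit T (Nat.le_add_right (j + 1) i) (T j x)) := by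
  rw [← orbit_succ_left T (by omega : j ≤ j + 1 + i)]
  exact apply_orbit_congr g (by omega) _ _ x

theorem apply_orbit_add_zero (g : ∀ k, X k → ℝ) (j : ℕ) (x : X j) :
    g (j + 0) (orbit T (Nat.le_add_right j 0) x) = g j x :=
  congrArg (g j) (orbit_self T (Nat.le_refl j) x)

/-- The functions `V_j` for `j ≥ n₀`, continued to `j < n₀` by `U_j = U_{j+1} ∘ T_j - f_j` with
`U_{n₀} = 0`. -/
def extendBelow (T : ∀ j, X j → X (j + 1)) (n₀ : ℕ) (f V : ∀ k, X k → ℝ) (j : ℕ) : X j → ℝ :=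
  if n₀ ≤ j then V j else
    fun x => - ∑ i ∈ Finset.range (n₀ - j), f (j + i) (orbit T (Nat.le_add_right j i) x)

theorem extendBelow_of_le {n₀ j : ℕ} (f V : ∀ k, X k → ℝ) (h : n₀ ≤ j) :
    extendBelow T n₀ f V j = V j := by
  simp [extendBelow, h]

variable [∀ j, MeasurableSpace (X j)] {m : ∀ j, Measure (X j)}

theorem extendBelow_of_lt (hT : ∀ j, Measure.QuasiMeasurePreserving (T j) (m j) (m (j + 1)))
    {n₀ j : ℕ} (f V : ∀ k, X k → ℝ) (h : j < n₀) (hV : V n₀ =ᵐ[m n₀] fun _ => 0) :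
    ∀ᵐ x ∂(m j), extendBelow T n₀ f V j x = extendBelow T n₀ f V (j + 1) (T j x) - f j x := by
  have hj : extendBelow T n₀ f V j =
      fun x => - ∑ i ∈ Finset.range (n₀ - j), f (j + i) (orbit T (Nat.le_add_right j i) x) := by
    simp [extendBelow, not_le.2 h]
  obtain ⟨d, rfl⟩ := Nat.exists_eq_add_of_lt h
  have hd : j + d + 1 - j = d + 1 := by omega
  have hsum : ∀ x, extendBelow T (j + d + 1) f V j x =
      - ∑ i ∈ Finset.range d, f (j + 1 + i) (orbit T (Nat.le_add_right (j + 1) i) (T j x))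
        - f j x := by
    intro x
    rw [hj]
    simp only [hd, Finset.sum_range_succ', apply_orbit_add_succ f, apply_orbit_add_zero f]
    ring
  -- For `d = 0` the next function is `V` at `n₀`, which vanishes almost everywhere only; otherwise
  -- the recursion is an identity of sums.
  rcases Nat.eq_zero_or_pos d with rfl | hd0
  · have h1 : extendBelow T (j + 0 + 1) f V (j + 1) = V (j + 1) := extendBelow_of_le f V (by omega)
    filter_upwards [(hT j).ae hV] with x hx
    rw [hsum, h1, hx]
    simp
  · refine Eventually.of_forall fun x => ?_
    have h1 : extendBelow T (j + d + 1) f V (j + 1) = fun x => - ∑ i ∈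
        Finset.range (j + d + 1 - (j + 1)),
        f (j + 1 + i) (orbit T (Nat.le_add_right (j + 1) i) x) := by
      simp only [extendBelow]
      rw [if_neg (by omega)]
    rw [hsum, h1, show j + d + 1 - (j + 1) = d by omega]

variable [∀ j, IsProbabilityMeasure (m j)]

theorem cum_ae_eq_zero (hT : ∀ j, Measure.QuasiMeasurePreserving (T j) (m j) (m (j + 1)))
    {φ : ∀ k, X k → ℝ} {n : ℕ} (h : ∀ k < n, φ k =ᵐ[m k] fun _ => 0) :
    cum m T φ n =ᵐ[m n] fun _ => 0 := by
  induction n with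
  | zero => exact Filter.EventuallyEq.rfl
  | succ n ih =>
    have h1 : (fun x => cum m T φ n x + φ n x) =ᵐ[m n] fun _ => (0 : ℝ) * 1 := by
      filter_upwards [ih fun k hk => h k (by omega), h n (by omega)] with x h1 h2
      rw [h1, h2]; simp
    have h2 := transfer_const_mul (hT n) (integrable_const (1 : ℝ)) 0
    rw [cum, transfer_congr h1]
    simpa using h2

variable {var : ∀ j, (X j → ℝ) → ℝ≥0∞} {C : ℝ≥0}

/-- The covering condition for the constant `1` on `X 0`. -/
theorem exists_le_dens (hv : IsVariation m var) (hadm : IsAdmissible m var T) :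
    ∃ (c : ℝ≥0) (n₀ : ℕ), 0 < c ∧ ∀ j ≥ n₀, ∀ᵐ x ∂(m j), (c : ℝ) ≤ dens m T j x := by
  obtain ⟨a, ha⟩ := BLe.const_one hv 0
  obtain ⟨c, n₀, hc, h⟩ := hadm.covering (a + 1) (by positivity)
  refine ⟨c.toNNReal, n₀, Real.toNNReal_pos.2 hc, fun j hj => ?_⟩
  obtain ⟨n, rfl⟩ : ∃ n, j = 0 + n := ⟨j, by simp⟩
  have h1 := h 0 n (by omega) (fun _ => 1) ha.memB (Eventually.of_forall fun _ => zero_le_one) (by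
    refine ha.var_le.trans ?_
    simp only [integral_const, probReal_univ, smul_eq_mul, mul_one]
    rw [ENNReal.ofReal_add a.coe_nonneg zero_le_one]
    simp)
  filter_upwards [h1] with x hx
  rw [Real.coe_toNNReal _ hc.le]
  simpa [dens] using hx

theorem integrable_comp_orbit
    (hT : ∀ j, Measure.QuasiMeasurePreserving (T j) (m j) (m (j + 1))) (hC : IsVarConst m var C)
    {j : ℕ} {f : X j → ℝ} {a : ℝ≥0} (hf : BLe m var j f a) :
    Integrable (fun x => f (orbit T (Nat.zero_le j) x)) (m 0) := by
  have hq := quasiMeasurePreserving_orbit hT (Nat.zero_le j)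
  exact Integrable.of_bound (hf.1.1.comp_quasiMeasurePreserving hq) _ (hq.ae (hf.ae_abs_le hC))

theorem abs_integral_comp_orbit_le
    (hT : ∀ j, Measure.QuasiMeasurePreserving (T j) (m j) (m (j + 1))) (hC : IsVarConst m var C)
    {j : ℕ} {f : X j → ℝ} {a : ℝ≥0} (hf : BLe m var j f a) :
    |∫ x, f (orbit T (Nat.zero_le j) x) ∂(m 0)| ≤ C * a := by
  have hq := quasiMeasurePreserving_orbit hT (Nat.zero_le j)
  have h1 := norm_integral_le_of_norm_le_const (μ := m 0)
    (f := fun x => f (orbit T (Nat.zero_le j) x)) (hq.ae (hf.ae_abs_le hC))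
  simpa using h1

/-- The martingale-coboundary decomposition. -/
theorem exists_decomposition
    (hT : ∀ j, Measure.QuasiMeasurePreserving (T j) (m j) (m (j + 1)))
    (hv : IsVariation m var) (hC : IsVarConst m var C) (hadm : IsAdmissible m var T)
    {R γ : ℝ≥0} {n : ℕ} (hR : 1 ≤ R) (hn : 1 ≤ n) (hγ : γ < 1)
    (hcon : ∀ j (φ : X j → ℝ) (s : ℝ≥0), QLe m var T R j φ s →
      QLe m var T R (j + n) (transferIter m T (Nat.le_add_right j n) φ) (γ * s))
    {b c₀ : ℝ≥0} {n₀ : ℕ} (hb : ∀ j, BLe m var j (dens m T j) b) (hc₀ : 0 < c₀)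
    (hd : ∀ j ≥ n₀, ∀ᵐ x ∂(m j), (c₀ : ℝ) ≤ dens m T j x)
    {c : ℝ≥0} (hc : ∀ j (h : X (j + 1) → ℝ), Integrable h (m (j + 1)) →
      var (j + 1) h ≤ 1 → var j (fun x => h (T j x)) ≤ c)
    {F : ∀ j, X j → ℝ} {bF : ℝ≥0} (hF : ∀ j, BLe m var j (F j) bF) :
    ∃ (U M : ∀ j, X j → ℝ) (B : ℝ≥0),
      (∀ j, Measurable (U j)) ∧ (∀ j, Measurable (M j)) ∧
      (∀ j x, |U j x| ≤ C * B) ∧ (∀ j x, |M j x| ≤ C * B) ∧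
      (∀ j, BLe m var j (U j) B) ∧ (∀ j, BLe m var j (M j) B) ∧
      (∀ j, ∀ᵐ x ∂(m j), F j x =
        (∫ y, F j (orbit T (Nat.zero_le j) y) ∂(m 0)) + U (j + 1) (T j x) - U j x + M j x) ∧
      (∀ j, ∫ x, dens m T j x * U j x ∂(m j) = 0) ∧
      (∀ j (ψ : X (j + 1) → ℝ), MemLp ψ ∞ (m (j + 1)) →
        ∫ x, dens m T j x * (M j x * ψ (T j x)) ∂(m j) = 0) ∧
      ∀ j < n₀, M j =ᵐ[m j] fun _ => 0 := by
  obtain ⟨K, hK⟩ := exists_bLe_inv hv hC b c₀ hc₀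
  set mean : ℕ → ℝ := fun j => ∫ y, F j (orbit T (Nat.zero_le j) y) ∂(m 0) with hmean
  have hmean_le : ∀ j, |mean j| ≤ C * bF := fun j => abs_integral_comp_orbit_le hT hC (hF j)
  have hmean_le' : ∀ j, ‖mean j‖₊ ≤ C * bF := fun j => by
    rw [← NNReal.coe_le_coe]; push_cast; exact hmean_le j
  set f : ∀ j, X j → ℝ := fun j x => F j x - mean j with hf
  have hd0 : ∀ j ≥ n₀, ∀ᵐ x ∂(m j), 0 < dens m T j x := fun j hj =>
    (hd j hj).mono fun x hx => lt_of_lt_of_le (by exact_mod_cast hc₀) hx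
  have hfone : ∀ j (a : ℝ≥0), BLe m var j (fun _ => (1 : ℝ)) a →
      BLe m var j (f j) (bF + C * bF * a) := by
    intro j a ha
    have := (hF j).sub hv (ha.const_mul hv (mean j))
    simp only [mul_one] at this
    exact this.mono (by gcongr; exact hmean_le' j)
  have hfB : ∀ j, ∃ a, BLe m var j (f j) a := fun j =>
    let ⟨a, ha⟩ := BLe.const_one hv j
    ⟨_, hfone j a ha⟩
  have hdf : ∀ j, BLe m var j (fun x => dens m T j x * f j x)
      (3 * C ^ 2 * (b * bF) + C * bF * b) := by
    intro j
    have := ((hb j).mul hC (hF j)).sub hv ((hb j).const_mul hv (mean j))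
    refine (this.congr_ae hv (Eventually.of_forall fun x => ?_)).mono
      (by gcongr; exact hmean_le' j)
    simp only [hf]; ring
  have hdf0 : ∀ j, ∫ x, dens m T j x * f j x ∂(m j) = 0 := by
    intro j
    have h1 : ∀ x, dens m T j x * f j x = dens m T j x * F j x - mean j * dens m T j x := by
      intro x; simp only [hf]; ring
    simp only [h1]
    rw [integral_sub ((hb j).mul hC (hF j)).1 ((hb j).1.const_mul _), integral_const_mul,
      integral_dens hT, integral_dens_mul hT j ((hF j).memLp_top hC)]
    simp [hmean]
  -- The source is switched off below `n₀`, where the density may degenerate. This makes `W` vanish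
  -- at `n₀` and matches the backward continuation of `U`.
  set φ : ∀ k, X k → ℝ := fun k => if k < n₀ then fun _ => 0 else
    fun x => dens m T k x * f k x with hφ
  set a₀ : ℝ≥0 := 3 * C ^ 2 * (b * bF) + C * bF * b with ha₀
  have hφQ : ∀ k, QLe m var T R k (φ k) (a₀ + C * a₀ / c₀) := by
    intro k
    by_cases hk : k < n₀
    · simp only [hφ, hk, if_true]
      exact (QLe.zero hv).mono hT zero_le
    · simp only [hφ, hk, if_false]
      exact QLe.of_bLe hC hc₀ hR (hd k (not_lt.1 hk)) (hdf k) (hdf0 k)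
  obtain ⟨s, hs⟩ := exists_qLe_cum hT hv hadm hn hγ hcon (a₀ + C * a₀ / c₀)
  have hW := hs φ hφQ
  set W := cum m T φ with hWdef
  set V : ∀ k, X k → ℝ := fun k x => W k x * (dens m T k x)⁻¹ with hV
  have hW0 : W n₀ =ᵐ[m n₀] fun _ => 0 := by
    refine cum_ae_eq_zero hT fun k hk => Eventually.of_forall fun x => ?_
    simp [hφ, hk]
  have hV0 : V n₀ =ᵐ[m n₀] fun _ => 0 := hW0.mono fun x hx => by simp [hV, hx]
  set u := extendBelow T n₀ f V with hu
  have hu_lt : ∀ j < n₀, ∀ᵐ x ∂(m j), u j x = u (j + 1) (T j x) - f j x := fun j hj =>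
    extendBelow_of_lt hT f V hj hV0
  have hu_ge : ∀ j ≥ n₀, u j = V j := fun j hj => extendBelow_of_le f V hj
  have hdV : ∀ j ≥ n₀, ∀ᵐ x ∂(m j), dens m T j x * u j x = W j x := by
    intro j hj
    filter_upwards [hd0 j hj] with x hx
    rw [hu_ge j hj]
    simp only [hV]
    field_simp
  have huB_ge : ∀ j ≥ n₀, BLe m var j (u j) (3 * C ^ 2 * (R * s * K)) := by
    intro j hj
    rw [hu_ge j hj]
    exact (hW j).3.mul hC (hK j _ (hb j) (hd j hj)).2
  -- Membership in `𝓑_j` below `n₀` by downward induction, composing with `T j`. Only finitely many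
  -- `j` occur, so the bounds need no uniformity here.
  have huB : ∀ d j, n₀ ≤ j + d → ∃ a, BLe m var j (u j) a := by
    intro d
    induction d with
    | zero => exact fun j hj => ⟨_, huB_ge j hj⟩
    | succ d ih =>
      intro j hj
      by_cases hj' : n₀ ≤ j
      · exact ⟨_, huB_ge j hj'⟩
      · obtain ⟨a, ha⟩ := ih (j + 1) (by omega)
        obtain ⟨a', ha'⟩ := hfB j
        refine ⟨_, ((ha.comp hT hv hC hc).sub hv ha').congr_ae hv ?_⟩
        filter_upwards [hu_lt j (not_le.1 hj')] with x hx using hx.symm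
  have huB' : ∀ j, ∃ a, BLe m var j (u j) a := fun j => huB n₀ j (by omega)
  choose au hau using huB'
  set B₁ : ℝ≥0 := 3 * C ^ 2 * (R * s * K) + ∑ j ∈ Finset.range n₀, au j with hB₁
  have huB₁ : ∀ j, BLe m var j (u j) B₁ := by
    intro j
    by_cases hj : n₀ ≤ j
    · exact (huB_ge j hj).mono le_self_add
    · refine (hau j).mono (le_trans ?_ le_add_self)
      exact Finset.single_le_sum (fun _ _ => zero_le) (Finset.mem_range.2 (not_le.1 hj))
  set M : ∀ j, X j → ℝ := fun j x => f j x + u j x - u (j + 1) (T j x) with hM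
  have hM_lt : ∀ j < n₀, M j =ᵐ[m j] fun _ => 0 := by
    intro j hj
    filter_upwards [hu_lt j hj] with x hx
    simp only [hM]; rw [hx]; ring
  set B₂ : ℝ≥0 := (bF + C * bF * K) + B₁ + (C * B₁ + (B₁ + 1) * c) with hB₂
  have hMB : ∀ j, BLe m var j (M j) B₂ := by
    intro j
    by_cases hj : n₀ ≤ j
    · exact ((hfone j K (hK j _ (hb j) (hd j hj)).1).add hv (huB₁ j)).sub hv
        ((huB₁ (j + 1)).comp hT hv hC hc)
    · have h1 : BLe m var j (fun _ => (0 : ℝ)) 0 := by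
        simpa using (hau j).const_mul hv 0
      exact (h1.congr_ae hv (hM_lt j (not_le.1 hj)).symm).mono zero_le
  have hdu0 : ∀ d j, n₀ ≤ j + d → ∫ x, dens m T j x * u j x ∂(m j) = 0 := by
    intro d
    have base : ∀ j ≥ n₀, ∫ x, dens m T j x * u j x ∂(m j) = 0 := fun j hj => by
      rw [integral_congr_ae (hdV j hj)]; exact (hW j).1
    induction d with
    | zero => exact base
    | succ d ih =>
      intro j hj
      by_cases hj' : n₀ ≤ j
      · exact base j hj'
      · have h1 := ih (j + 1) (by omega)
        have h2 := transfer_duality (hT j) (hb j).1 ((huB₁ (j + 1)).memLp_top hC)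
        rw [← dens_succ, h1] at h2
        have h3 : ∫ x, dens m T j x * u j x ∂(m j) = ∫ x, (dens m T j x * u (j + 1) (T j x) -
            dens m T j x * f j x) ∂(m j) := by
          refine integral_congr_ae ?_
          filter_upwards [hu_lt j (not_le.1 hj')] with x hx
          rw [hx]; ring
        rw [h3, integral_sub (integrable_mul_comp (hT j) (hb j).1 ((huB₁ (j + 1)).memLp_top hC))
          (hdf j).1, ← h2, hdf0 j, sub_zero]
  -- For `j ≥ n₀` this expresses `𝓛_j (h_j M_j) = 𝓛_j (W_j + φ_j) - h_{j+1} u_{j+1} = W_{j+1} -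
  -- W_{j+1} = 0`.
  have hmart : ∀ j (ψ : X (j + 1) → ℝ), MemLp ψ ∞ (m (j + 1)) →
      ∫ x, dens m T j x * (M j x * ψ (T j x)) ∂(m j) = 0 := by
    intro j ψ hψ
    by_cases hj : n₀ ≤ j
    · have huψ : MemLp (fun y => u (j + 1) y * ψ y) ∞ (m (j + 1)) :=
        hψ.mul ((huB₁ (j + 1)).memLp_top hC)
      have hWφ : Integrable (fun x => W j x + φ j x) (m j) := (hW j).3.1.add (hφQ j).3.1
      have h1 : ∫ x, dens m T j x * (M j x * ψ (T j x)) ∂(m j) =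
          ∫ x, ((W j x + φ j x) * ψ (T j x) -
            dens m T j x * (u (j + 1) (T j x) * ψ (T j x))) ∂(m j) := by
        refine integral_congr_ae ?_
        filter_upwards [hdV j hj] with x hx
        have e : φ j x = dens m T j x * f j x := by simp [hφ, not_lt.2 hj]
        simp only [hM, e, ← hx]
        ring
      rw [h1, integral_sub (integrable_mul_comp (hT j) hWφ hψ)
        (integrable_mul_comp (hT j) (hb j).1 huψ), ← transfer_duality (hT j) hWφ hψ,
        ← transfer_duality (hT j) (hb j).1 huψ, ← dens_succ, sub_eq_zero]
      refine integral_congr_ae ?_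
      filter_upwards [hdV (j + 1) (by omega)] with y hy
      rw [← mul_assoc, hy]
      rfl
    · rw [integral_congr_ae (g := fun _ => (0 : ℝ))]
      · simp
      · filter_upwards [hM_lt j (not_le.1 hj)] with x hx
        rw [hx]; simp
  set B : ℝ≥0 := B₁ + B₂ with hB
  have huBB : ∀ j, BLe m var j (u j) B := fun j => (huB₁ j).mono le_self_add
  have hMBB : ∀ j, BLe m var j (M j) B := fun j => (hMB j).mono le_add_self
  have exU := fun j => exists_measurable_bounded_ae_eq (huBB j).1.1
    (by positivity : (0 : ℝ) ≤ C * B) ((huBB j).ae_abs_le hC)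
  have exM := fun j => exists_measurable_bounded_ae_eq (hMBB j).1.1
    (by positivity : (0 : ℝ) ≤ C * B) ((hMBB j).ae_abs_le hC)
  choose U hUm hUD hUe using exU
  choose M' hMm hMD hMe using exM
  refine ⟨U, M', B, hUm, hMm, hUD, hMD, fun j => (huBB j).congr_ae hv (hUe j),
    fun j => (hMBB j).congr_ae hv (hMe j), fun j => ?_, fun j => ?_, fun j ψ hψ => ?_,
    fun j hj => (hMe j).symm.trans (hM_lt j hj)⟩
  · filter_upwards [hUe j, hMe j, (hT j).ae (hUe (j + 1))] with x h1 h2 h3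
    rw [← h1, ← h2, ← h3]
    simp only [hM, hf, hmean]
    ring
  · rw [← hdu0 n₀ j (by omega)]
    exact integral_congr_ae ((hUe j).mono fun x hx => by simp only [hx])
  · rw [← hmart j ψ hψ]
    exact integral_congr_ae ((hMe j).mono fun x hx => by simp only [hx])

end Decomposition

end SeqLivsic

/-! ### Conditional variances and exactness. -/

namespace SeqLivsic

theorem BddMeas.memLp_top {Y : Type*} [mY : MeasurableSpace Y] {μ : Measure Y} {f : Y → ℝ}
    (hf : BddMeas mY f) : MemLp f ∞ μ := by
  obtain ⟨hm, C, hC⟩ := hf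
  exact memLp_top_of_bound hm.aestronglyMeasurable C (Eventually.of_forall hC)

theorem BddMeas.comp {Y Z : Type*} [mY : MeasurableSpace Y] [mZ : MeasurableSpace Z] {f : Z → ℝ}
    (hf : BddMeas mZ f) {S : Y → Z} (hS : Measurable S) : BddMeas mY fun y => f (S y) :=
  ⟨hf.1.comp hS, hf.2.imp fun _ hC y => hC (S y)⟩

/-- The factor `ψ` is truncated, since a factorisation gives no control off the range of `S`. -/
theorem BddMeas.exists_eq_comp {Y Z : Type*} [mZ : MeasurableSpace Z] {S : Y → Z} {g : Y → ℝ}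
    (hg : BddMeas (MeasurableSpace.comap S mZ) g) :
    ∃ ψ : Z → ℝ, BddMeas mZ ψ ∧ ∀ y, g y = ψ (S y) := by
  obtain ⟨hm, C, hC⟩ := hg
  obtain ⟨h, hh, rfl⟩ := hm.exists_eq_measurable_comp
  refine ⟨fun z => max (-|C|) (min |C| (h z)),
    ⟨measurable_const.max (measurable_const.min hh), |C|, fun z => abs_le.2
      ⟨le_max_left _ _, max_le (by linarith [abs_nonneg C]) (min_le_left _ _)⟩⟩, fun y => ?_⟩
  have h1 := abs_le.1 ((hC y).trans (le_abs_self C))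
  simp only [Function.comp_apply] at h1 ⊢
  rw [min_eq_right h1.2, max_eq_right h1.1]

section Main

variable {X : ℕ → Type*} [mX : ∀ j, MeasurableSpace (X j)] {T : ∀ j, X j → X (j + 1)}
  {m : ∀ j, Measure (X j)}

/-- The σ-algebra on `X_0` generated by `T_0^{(k)}`. -/
abbrev orbitAlgebra (T : ∀ j, X j → X (j + 1)) (k : ℕ) : MeasurableSpace (X 0) :=
  MeasurableSpace.comap (orbit T (Nat.zero_le k)) (mX k)

theorem measurable_orbit (hT : ∀ j, Measurable (T j)) {j k : ℕ} (h : j ≤ k) :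
    Measurable (orbit T h) := by
  induction k, h using Nat.le_induction with
  | base =>
    have : orbit T (le_refl j) = id := by ext x; simp
    rw [this]
    exact measurable_id
  | succ k h ih =>
    have : orbit T (Nat.le_succ_of_le h) = T k ∘ orbit T h := by
      ext x; exact orbit_succ T h _ x
    rw [this]
    exact (hT k).comp ih

theorem antitone_orbitAlgebra (hT : ∀ j, Measurable (T j)) : Antitone (orbitAlgebra T) := by
  refine antitone_nat_of_succ_le fun k => ?_
  have : orbit T (Nat.zero_le (k + 1)) = T k ∘ orbit T (Nat.zero_le k) := by
    ext x; exact orbit_succ T _ _ x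
  rw [orbitAlgebra, this, ← MeasurableSpace.comap_comp]
  exact MeasurableSpace.comap_mono (hT k).comap_le

variable [∀ j, IsProbabilityMeasure (m j)]

theorem isRevMartDiff_comp_orbit
    (hT : ∀ j, Measure.QuasiMeasurePreserving (T j) (m j) (m (j + 1)))
    {M : ∀ j, X j → ℝ} {D : ℝ} (hM : ∀ j, Measurable (M j)) (hMD : ∀ j x, |M j x| ≤ D)
    (hmart : ∀ j (ψ : X (j + 1) → ℝ), MemLp ψ ∞ (m (j + 1)) →
      ∫ x, dens m T j x * (M j x * ψ (T j x)) ∂(m j) = 0) :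
    IsRevMartDiff (m 0) (orbitAlgebra T) (fun k x => M k (orbit T (Nat.zero_le k) x)) D := by
  have hTm := fun j => (hT j).measurable
  refine ⟨antitone_orbitAlgebra hTm, fun k => (measurable_orbit hTm _).comap_le,
    fun k => (hM k).comp (comap_measurable _), fun k x => hMD k _, fun k g hg => ?_⟩
  obtain ⟨ψ, hψ, hgψ⟩ := BddMeas.exists_eq_comp hg
  have h1 : BddMeas (mX k) fun x => M k x * ψ (T k x) :=
    BddMeas.mul ⟨hM k, D, hMD k⟩ (hψ.comp (hTm k))
  rw [← hmart k ψ hψ.memLp_top, integral_dens_mul hT k h1.memLp_top]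
  simp only [hgψ, orbit_succ T (Nat.zero_le k)]

/-- Divided by the density, `cum m T φ n` is the conditional expectation of the centred `qsum` given
`T_0^{(n)}`. One step of the recursion adds the next centred square and passes to the coarser
σ-algebra. -/
theorem integral_qsum_mul_comp_orbit
    (hT : ∀ j, Measure.QuasiMeasurePreserving (T j) (m j) (m (j + 1)))
    {M : ∀ j, X j → ℝ} {D : ℝ} (hM : ∀ j, Measurable (M j)) (hMD : ∀ j x, |M j x| ≤ D)
    {φ : ∀ k, X k → ℝ}
    (hφ : ∀ k x, φ k x = dens m T k x *
      (M k x ^ 2 - ∫ y, M k (orbit T (Nat.zero_le k) y) ^ 2 ∂(m 0)))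
    (hφi : ∀ k, Integrable (φ k) (m k)) (hci : ∀ k, Integrable (cum m T φ k) (m k))
    (n : ℕ) {ψ : X n → ℝ} (hψ : BddMeas (mX n) ψ) :
    ∫ x, qsum (fun k x => M k (orbit T (Nat.zero_le k) x)) n x *
        ψ (orbit T (Nat.zero_le n) x) ∂(m 0)
      - (∫ x, qsum (fun k x => M k (orbit T (Nat.zero_le k) x)) n x ∂(m 0)) *
        ∫ x, ψ (orbit T (Nat.zero_le n) x) ∂(m 0)
      = ∫ y, cum m T φ n y * ψ y ∂(m n) := by
  have hTm := fun j => (hT j).measurable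
  have bM : ∀ k, BddMeas (mX k) (M k) := fun k => ⟨hM k, D, hMD k⟩
  have bξ : ∀ k, BddMeas (mX 0) fun x => M k (orbit T (Nat.zero_le k) x) := fun k =>
    (bM k).comp (measurable_orbit hTm _)
  induction n with
  | zero => simp [qsum, cum]
  | succ n ih =>
    have bψ := hψ.comp (hTm n)
    have h1 := ih bψ
    have bq : BddMeas (mX 0) (qsum (fun k x => M k (orbit T (Nat.zero_le k) x)) n) :=
      BddMeas.sum fun i _ => (bξ i).pow 2
    have bg : BddMeas (mX 0) fun x => ψ (T n (orbit T (Nat.zero_le n) x)) :=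
      bψ.comp (measurable_orbit hTm _)
    set v := ∫ y, M n (orbit T (Nat.zero_le n) y) ^ 2 ∂(m 0) with hv
    have e1 : ∀ x, qsum (fun k x => M k (orbit T (Nat.zero_le k) x)) (n + 1) x
        = qsum (fun k x => M k (orbit T (Nat.zero_le k) x)) n x
          + M n (orbit T (Nat.zero_le n) x) ^ 2 := fun x => by
      simp [qsum, Finset.sum_range_succ]
    simp only [e1, orbit_succ T (Nat.zero_le n), add_mul]
    rw [integral_add (bq.mul bg).integrable (((bξ n).pow 2).mul bg).integrable,
      integral_add bq.integrable ((bξ n).pow 2).integrable, cum,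
      transfer_duality (hT n) ((hci n).fun_add (hφi n)) hψ.memLp_top]
    simp only [add_mul]
    rw [integral_add (integrable_mul_comp (hT n) (hci n) hψ.memLp_top)
      (integrable_mul_comp (hT n) (hφi n) hψ.memLp_top), ← h1]
    have h2 : ∫ x, φ n x * ψ (T n x) ∂(m n) =
        ∫ x, M n (orbit T (Nat.zero_le n) x) ^ 2 * ψ (T n (orbit T (Nat.zero_le n) x)) ∂(m 0)
          - v * ∫ x, ψ (T n (orbit T (Nat.zero_le n) x)) ∂(m 0) := by
      have b2 : BddMeas (mX n) fun x => (M n x ^ 2 - v) * ψ (T n x) :=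
        (((bM n).pow 2).sub (BddMeas.const v)).mul bψ
      have h3 := integral_dens_mul hT n b2.memLp_top
      simp only [hφ, mul_assoc]
      rw [h3]
      simp only [sub_mul]
      rw [integral_sub (((bξ n).pow 2).mul bg).integrable
        ((BddMeas.const v).mul bg).integrable, integral_const_mul]
    rw [h2]
    ring

variable {var : ∀ j, (X j → ℝ) → ℝ≥0∞} {C : ℝ≥0}

/-- Conditional variances of the reverse martingale are comparable to its variances. -/
theorem exists_abs_integral_qsum_sub_le
    (hT : ∀ j, Measure.QuasiMeasurePreserving (T j) (m j) (m (j + 1)))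
    (hv : IsVariation m var) (hC : IsVarConst m var C) (hadm : IsAdmissible m var T)
    {R γ : ℝ≥0} {n₁ : ℕ} (hR : 1 ≤ R) (hn₁ : 1 ≤ n₁) (hγ : γ < 1)
    (hcon : ∀ j (φ : X j → ℝ) (s : ℝ≥0), QLe m var T R j φ s →
      QLe m var T R (j + n₁) (transferIter m T (Nat.le_add_right j n₁) φ) (γ * s))
    {b c₀ : ℝ≥0} {n₀ : ℕ} (hb : ∀ j, BLe m var j (dens m T j) b) (hc₀ : 0 < c₀)
    (hd : ∀ j ≥ n₀, ∀ᵐ x ∂(m j), (c₀ : ℝ) ≤ dens m T j x)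
    {M : ∀ j, X j → ℝ} {B : ℝ≥0} (hM : ∀ j, Measurable (M j)) (hMD : ∀ j x, |M j x| ≤ C * B)
    (hMB : ∀ j, BLe m var j (M j) B) (hM0 : ∀ j < n₀, M j =ᵐ[m j] fun _ => 0) :
    ∃ s : ℝ≥0, ∀ n (g : X 0 → ℝ), BddMeas (orbitAlgebra T n) g → (∀ x, 0 ≤ g x) →
      |∫ x, qsum (fun k x => M k (orbit T (Nat.zero_le k) x)) n x * g x ∂(m 0)
        - (∫ x, qsum (fun k x => M k (orbit T (Nat.zero_le k) x)) n x ∂(m 0)) * ∫ x, g x ∂(m 0)|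
        ≤ s * ∫ x, g x ∂(m 0) := by
  have hTm := fun j => (hT j).measurable
  have bM : ∀ k, BddMeas (mX k) (M k) := fun k => ⟨hM k, _, hMD k⟩
  set v : ℕ → ℝ := fun k => ∫ y, M k (orbit T (Nat.zero_le k) y) ^ 2 ∂(m 0) with hvdef
  set φ : ∀ k, X k → ℝ := fun k x => dens m T k x * (M k x ^ 2 - v k) with hφ
  have hM2 : ∀ k, BLe m var k (fun x => M k x ^ 2) (3 * C ^ 2 * (B * B)) := fun k => by
    simpa only [sq (M k _)] using (hMB k).mul hC (hMB k)
  set B₂ : ℝ≥0 := 3 * C ^ 2 * (B * B) with hB₂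
  have hvle : ∀ k, ‖v k‖₊ ≤ C * B₂ := fun k => by
    rw [← NNReal.coe_le_coe]
    push_cast
    exact_mod_cast abs_integral_comp_orbit_le hT hC (hM2 k)
  set a₀ : ℝ≥0 := 3 * C ^ 2 * (b * B₂) + C * B₂ * b with ha₀
  have hφB : ∀ k, BLe m var k (φ k) a₀ := by
    intro k
    have := ((hb k).mul hC (hM2 k)).sub hv ((hb k).const_mul hv (v k))
    refine (this.congr_ae hv (Eventually.of_forall fun x => ?_)).mono
      (add_le_add le_rfl (mul_le_mul_left (hvle k) b))
    simp only [hφ]; ring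
  have hφQ : ∀ k, QLe m var T R k (φ k) (a₀ + C * a₀ / c₀) := by
    intro k
    by_cases hk : n₀ ≤ k
    · refine QLe.of_bLe hC hc₀ hR (hd k hk) (hφB k) ?_
      simp only [hφ]
      rw [integral_dens_mul hT k (((bM k).pow 2).sub (BddMeas.const (v k))).memLp_top,
        integral_sub (((bM k).comp (measurable_orbit hTm _)).pow 2).integrable
          (integrable_const _)]
      simp [hvdef]
    -- Below `n₀` no lower bound on the density is available, but there `M k` vanishes almost
    -- everywhere and so does `φ k`.
    · have hk' := hM0 k (not_le.1 hk)
      have hv0 : v k = 0 := by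
        have hq := (quasiMeasurePreserving_orbit hT (Nat.zero_le k)).ae hk'
        simp only [hvdef]
        rw [integral_congr_ae (g := fun _ => (0 : ℝ))]
        · simp
        · filter_upwards [hq] with x hx
          rw [hx]; simp
      refine ((QLe.zero hv).mono hT zero_le).congr_ae hv ?_
      filter_upwards [hk'] with x hx
      simp [hφ, hx, hv0]
  obtain ⟨s, hs⟩ := exists_qLe_cum hT hv hadm hn₁ hγ hcon (a₀ + C * a₀ / c₀)
  have hW := hs φ hφQ
  refine ⟨s, fun n g hg hg0 => ?_⟩
  obtain ⟨ψ, hψ, hgψ⟩ := BddMeas.exists_eq_comp hg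
  have h1 := integral_qsum_mul_comp_orbit hT hM hMD (φ := φ) (fun k x => rfl)
    (fun k => (hφQ k).3.1) (fun k => (hW k).3.1) n hψ
  simp only [← hgψ] at h1
  rw [h1]
  have bψ : BddMeas (mX n) fun y => |ψ y| :=
    ⟨measurable_norm.comp hψ.1, hψ.2.imp fun _ h y => by rw [abs_abs]; exact h y⟩
  have h2 := integral_dens_mul hT n bψ.memLp_top
  simp only [← hgψ, abs_of_nonneg (hg0 _)] at h2
  rw [← h2, ← integral_const_mul]
  -- The domination `|W n| ≤ s * dens` is exactly a bound by `s` on the conditional expectation, for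
  -- every `n`.
  refine abs_integral_le_integral_abs.trans ?_
  refine integral_mono_ae ?_ ?_ ?_
  · exact (Integrable.mul_of_top_left (hW n).3.1 hψ.memLp_top).abs
  · exact (Integrable.mul_of_top_left (dens_integrable n) bψ.memLp_top).const_mul _
  · filter_upwards [(hW n).2] with y hy
    rw [abs_mul, ← mul_assoc]
    exact mul_le_mul_of_nonneg_right hy (abs_nonneg _)

/-- Exactness: almost sure limits of functions of `T_0^{(n)}` are constant. -/
theorem exists_ae_eq_const_of_tendsto
    (hT : ∀ j, Measure.QuasiMeasurePreserving (T j) (m j) (m (j + 1)))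
    (hv : IsVariation m var) (hC : IsVarConst m var C)
    {R γ : ℝ≥0} {n₁ : ℕ} (hR : 1 ≤ R) (hn₁ : 1 ≤ n₁) (hγ : γ < 1)
    (hcon : ∀ j (φ : X j → ℝ) (s : ℝ≥0), QLe m var T R j φ s →
      QLe m var T R (j + n₁) (transferIter m T (Nat.le_add_right j n₁) φ) (γ * s))
    {y : ∀ n, X n → ℝ} (hy : ∀ n, Measurable (y n)) {Z : X 0 → ℝ}
    (hZ : ∀ᵐ x ∂(m 0), Tendsto (fun n => y n (orbit T (Nat.zero_le n) x)) atTop (𝓝 (Z x))) :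
    ∃ κ : ℝ, ∀ᵐ x ∂(m 0), Z x = κ := by
  have hTm := fun j => (hT j).measurable
  -- No integrability of the limit is assumed; `arctan` makes everything bounded and is undone by
  -- `tan` at the end.
  have hat : ∀ t : ℝ, |Real.arctan t| ≤ 2 := fun t => abs_le.2
    ⟨by linarith [Real.neg_pi_div_two_lt_arctan t, Real.pi_le_four],
      by linarith [Real.arctan_lt_pi_div_two t, Real.pi_le_four]⟩
  set f : X 0 → ℝ := fun x => Real.arctan (Z x) with hf
  set fn : ∀ n, X n → ℝ := fun n x => Real.arctan (y n x) with hfn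
  have bfn : ∀ n, BddMeas (mX n) (fn n) := fun n =>
    ⟨Real.measurable_arctan.comp (hy n), 2, fun x => hat _⟩
  have hft : ∀ᵐ x ∂(m 0), Tendsto (fun n => fn n (orbit T (Nat.zero_le n) x)) atTop
      (𝓝 (f x)) := by
    filter_upwards [hZ] with x hx
    exact (Real.continuous_arctan.tendsto _).comp hx
  have bo : ∀ n, BddMeas (mX 0) fun x => fn n (orbit T (Nat.zero_le n) x) := fun n =>
    (bfn n).comp (measurable_orbit hTm _)
  have hfm : AEStronglyMeasurable f (m 0) :=
    aestronglyMeasurable_of_tendsto_ae atTop (fun n => (bo n).1.aestronglyMeasurable) hft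
  have hfi : Integrable f (m 0) := Integrable.of_bound hfm 2 (Eventually.of_forall fun x => hat _)
  have hfL : MemLp f ∞ (m 0) := memLp_top_of_bound hfm 2 (Eventually.of_forall fun x => hat _)
  -- `f` is orthogonal to mean-zero functions in `𝓑`
  have horth : ∀ (g : X 0 → ℝ) (a : ℝ≥0), BLe m var 0 g a → ∫ x, g x ∂(m 0) = 0 →
      ∫ x, g x * f x ∂(m 0) = 0 := by
    intro g a hg hg0
    -- At time `0` the density is `1`, so the lower bound `c = 1` applies.
    have hQ : QLe m var T R 0 g (a + C * a / 1) :=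
      QLe.of_bLe hC one_pos hR (by rw [dens_zero]; simp) hg hg0
    set s := a + C * a / 1
    have hQi : ∀ i : ℕ, ∀ k (h : 0 ≤ k), k = i * n₁ →
        QLe m var T R k (transferIter m T h g) (γ ^ i * s) := by
      intro i
      induction i with
      | zero =>
        intro k h hk
        obtain rfl : k = 0 := by simpa using hk
        rw [transferIter_self]
        simpa using hQ
      | succ i ih =>
        intro k h hk
        have hk' : k = i * n₁ + n₁ := by rw [hk]; ring
        subst hk'
        have h1 := hcon _ _ _ (ih (i * n₁) (Nat.zero_le _) rfl)
        rw [← transferIter_trans T m (Nat.zero_le _) (Nat.le_add_right _ _) h] at h1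
        rwa [pow_succ', mul_assoc]
    have hlim : Tendsto (fun n => ∫ x, g x * fn n (orbit T (Nat.zero_le n) x) ∂(m 0)) atTop
        (𝓝 (∫ x, g x * f x ∂(m 0))) := by
      refine tendsto_integral_of_dominated_convergence (fun x => |g x| * 2)
        (fun n => hg.1.1.mul (bo n).1.aestronglyMeasurable) (hg.1.norm.mul_const 2)
        (fun n => Eventually.of_forall fun x => ?_) ?_
      · rw [norm_mul]
        exact mul_le_mul_of_nonneg_left (hat _) (abs_nonneg _)
      · filter_upwards [hft] with x hx
        exact hx.const_mul _
    have hsub : Tendsto (fun i : ℕ => i * n₁) atTop atTop :=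
      tendsto_id.atTop_mul_const' hn₁
    have hlim2 := hlim.comp hsub
    have hz : Tendsto (fun i : ℕ => (((γ ^ i * s : ℝ≥0) : ℝ) * 2)) atTop (𝓝 0) := by
      have h1 : Tendsto (fun i : ℕ => (γ : ℝ) ^ i) atTop (𝓝 0) :=
        tendsto_pow_atTop_nhds_zero_of_lt_one γ.2 (by exact_mod_cast hγ)
      have := (h1.mul_const (s : ℝ)).mul_const 2
      simpa using this
    refine tendsto_nhds_unique hlim2 (squeeze_zero_norm (fun i => ?_) hz)
    simp only [Function.comp_apply]
    have hi := hQi i (i * n₁) (Nat.zero_le _) rfl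
    rw [← integral_transferIter_mul hT (Nat.zero_le (i * n₁)) hg.1 (bfn (i * n₁)).memLp_top]
    calc _ ≤ ∫ x, ‖transferIter m T (Nat.zero_le (i * n₁)) g x * fn (i * n₁) x‖ ∂(m (i * n₁)) :=
          norm_integral_le_integral_norm _
      _ ≤ ∫ x, (((γ ^ i * s : ℝ≥0) : ℝ) * 2) * dens m T (i * n₁) x ∂(m (i * n₁)) := by
          refine integral_mono_ae
            (Integrable.mul_of_top_left hi.3.1 (bfn (i * n₁)).memLp_top).norm
            ((dens_integrable _).const_mul _) ?_
          filter_upwards [hi.2] with x hx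
          rw [norm_mul]
          calc _ ≤ (((γ ^ i * s : ℝ≥0) : ℝ) * dens m T (i * n₁) x) * 2 :=
                mul_le_mul hx (hat _) (abs_nonneg _) ((abs_nonneg _).trans hx)
            _ = _ := by ring
      _ = _ := by rw [integral_const_mul, integral_dens hT, mul_one]
  set e := ∫ x, f x ∂(m 0) with he
  -- The variance of `f` is `∫ (f - e) * f`. Replacing `f - e` by a centred element of `𝓑_0` close
  -- to it in `L¹` gives zero by `horth`, up to an arbitrarily small error.
  have hsq : ∫ x, (f x - e) ^ 2 ∂(m 0) = 0 := by
    have hsqi : ∫ x, (f x - e) ^ 2 ∂(m 0) = ∫ x, (f x - e) * f x ∂(m 0) := by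
      have h1 : ∀ x, (f x - e) ^ 2 = (f x - e) * f x - e * (f x - e) := fun x => by ring
      have i1 : Integrable (fun x => f x - e) (m 0) := hfi.sub (integrable_const _)
      have i2 : Integrable (fun x => (f x - e) * f x) (m 0) := Integrable.mul_of_top_left i1 hfL
      simp only [h1]
      rw [integral_sub i2 (i1.const_mul e), integral_const_mul,
        integral_sub hfi (integrable_const _)]
      simp [he]
    refine le_antisymm (le_of_forall_pos_le_add fun ε hε => ?_)
      (integral_nonneg fun x => sq_nonneg _)
    obtain ⟨g, hg, hfg⟩ := hv.dense 0 f hfi (Real.toNNReal (ε / 4))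
      (Real.toNNReal_pos.2 (by positivity))
    have hfg' : ∫ x, |f x - g x| ∂(m 0) ≤ ε / 4 := by
      have i1 : Integrable (fun x => f x - g x) (m 0) := hfi.sub hg.1
      rw [eLpNorm_one_eq_lintegral_enorm, ← ofReal_integral_norm_eq_lintegral_enorm i1] at hfg
      exact (ENNReal.ofReal_le_ofReal_iff (by positivity)).1 hfg
    obtain ⟨a1, ha1⟩ := BLe.const_one hv 0
    set eg := ∫ x, g x ∂(m 0) with heg
    have hgB := (BLe.of_memB hg).sub hv (ha1.const_mul hv eg)
    simp only [mul_one] at hgB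
    have h0 := horth _ _ hgB (by rw [integral_sub hg.1 (integrable_const _)]; simp [heg])
    have hee : |e - eg| ≤ ε / 4 := by
      rw [he, heg, ← integral_sub hfi hg.1]
      exact (abs_integral_le_integral_abs).trans hfg'
    have i1 : Integrable (fun x => f x - e) (m 0) := hfi.sub (integrable_const _)
    have i2 : Integrable (fun x => (f x - e) * f x) (m 0) := Integrable.mul_of_top_left i1 hfL
    have i3 : Integrable (fun x => (g x - eg) * f x) (m 0) := Integrable.mul_of_top_left hgB.1 hfL
    have i4 : Integrable (fun x => (|f x - g x| + ε / 4) * 2) (m 0) :=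
      ((hfi.sub hg.1).norm.add (integrable_const _)).mul_const 2
    have hsub : ∫ x, (f x - e) * f x ∂(m 0) =
        ∫ x, ((f x - e) * f x - (g x - eg) * f x) ∂(m 0) := by
      rw [integral_sub i2 i3, h0, sub_zero]
    rw [hsqi, zero_add, hsub]
    calc ∫ x, ((f x - e) * f x - (g x - eg) * f x) ∂(m 0)
        ≤ ∫ x, (|f x - g x| + ε / 4) * 2 ∂(m 0) := by
          refine integral_mono (i2.sub i3) i4 fun x => ?_
          have e1 : (f x - e) * f x - (g x - eg) * f x = ((f x - g x) - (e - eg)) * f x := by ring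
          simp only [e1]
          refine (le_abs_self _).trans ?_
          rw [abs_mul]
          refine mul_le_mul ?_ (hat _) (abs_nonneg _) (by positivity)
          exact (abs_sub _ _).trans (by linarith)
      _ ≤ ε := by
          have i5 : Integrable (fun x => |f x - g x|) (m 0) := (hfi.sub hg.1).norm
          rw [integral_mul_const, integral_add i5 (integrable_const _)]
          simp only [integral_const, probReal_univ, smul_eq_mul, one_mul]
          linarith
  have hsq2 : Integrable (fun x => (f x - e) ^ 2) (m 0) := by
    simp only [sq]
    exact Integrable.mul_of_top_left (hfi.sub (integrable_const _))
      (memLp_top_of_bound (hfm.sub aestronglyMeasurable_const) (2 + |e|)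
        (Eventually.of_forall fun x => (norm_sub_le _ _).trans (add_le_add (hat _) le_rfl)))
  rw [integral_eq_zero_iff_of_nonneg (fun x => sq_nonneg _) hsq2] at hsq
  refine ⟨Real.tan e, ?_⟩
  filter_upwards [hsq] with x hx
  have hx' : f x = e := by
    have : (f x - e) ^ 2 = 0 := hx
    linarith [pow_eq_zero_iff (two_ne_zero) |>.1 this]
  rw [← hx']
  exact (Real.tan_arctan _).symm

/-- A density bounded below makes `m n` absolutely continuous with respect to the law of
`T_0^{(n)}`. -/
theorem ae_of_ae_comp_orbit (hT : ∀ j, Measure.QuasiMeasurePreserving (T j) (m j) (m (j + 1)))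
    {n : ℕ} {c₀ : ℝ≥0} (hc₀ : 0 < c₀) (hd : ∀ᵐ x ∂(m n), (c₀ : ℝ) ≤ dens m T n x)
    {p : X n → Prop} (hp : MeasurableSet {x | p x})
    (h : ∀ᵐ x ∂(m 0), p (orbit T (Nat.zero_le n) x)) : ∀ᵐ x ∂(m n), p x := by
  set A : Set (X n) := {x | p x}ᶜ with hA
  have hAm : MeasurableSet A := hp.compl
  have h1 := integral_dens_mul hT n (memLp_top_indicator (ν := m n) hAm)
  have h2 : ∫ x, A.indicator (fun _ => (1 : ℝ)) (orbit T (Nat.zero_le n) x) ∂(m 0) = 0 := by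
    rw [integral_congr_ae (g := fun _ => (0 : ℝ))]
    · simp
    · filter_upwards [h] with x hx
      exact Set.indicator_of_notMem (Set.notMem_compl_iff.2 hx) _
  rw [h2] at h1
  have hi : Integrable (fun y => dens m T n y * A.indicator (fun _ => (1 : ℝ)) y) (m n) :=
    Integrable.mul_of_top_left (dens_integrable n) (memLp_top_indicator hAm)
  have hc : (0 : ℝ) < c₀ := hc₀
  rw [integral_eq_zero_iff_of_nonneg_ae (hd.mono fun x hx => mul_nonneg (hc.le.trans hx)
    (Set.indicator_nonneg (fun _ _ => zero_le_one) _)) hi] at h1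
  filter_upwards [h1, hd] with x h1 h2
  by_contra hx
  have hxA : x ∈ A := hx
  simp only [Set.indicator_of_mem hxA, mul_one, Pi.zero_apply] at h1
  linarith

end Main

end SeqLivsic

/-! ### Coboundaries along orbits and the proof of the theorem. -/

namespace SeqLivsic

theorem IsRevMartDiff.condExp_ae_eq_zero {Ω : Type*} [mΩ : MeasurableSpace Ω] {P : Measure Ω}
    [IsProbabilityMeasure P] {𝓖 : ℕ → MeasurableSpace Ω} {ξ : ℕ → Ω → ℝ} {D : ℝ}
    (h : IsRevMartDiff P 𝓖 ξ D) (k : ℕ) : P[ξ k | 𝓖 (k + 1)] =ᵐ[P] 0 := by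
  refine (ae_eq_condExp_of_forall_setIntegral_eq (h.le _) (h.bddMeas k).integrable
    (fun s _ _ => integrableOn_zero) (fun s hs _ => ?_) aestronglyMeasurable_zero).symm
  have h1 : BddMeas (𝓖 (k + 1)) (s.indicator fun _ => (1 : ℝ)) :=
    ⟨measurable_const.indicator hs, 1, fun ω => by
      by_cases hω : ω ∈ s <;> simp [hω]⟩
  have h2 := h.orth k _ h1
  simp only [mul_indicator_one] at h2
  rw [integral_indicator (h.le _ _ hs)] at h2
  simp [h2]

section Coboundary

variable {X : ℕ → Type*} {T : ∀ j, X j → X (j + 1)} {M y : ∀ j, X j → ℝ}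

/-- Telescoping of a coboundary along an orbit. -/
theorem sum_apply_orbit {x : X 0}
    (hx : ∀ k, M k (orbit T (Nat.zero_le k) x) =
      y (k + 1) (T k (orbit T (Nat.zero_le k) x)) - y k (orbit T (Nat.zero_le k) x)) (n N : ℕ) :
    ∑ i ∈ Finset.range N, M (n + i) (orbit T (Nat.le_add_right n i) (orbit T (Nat.zero_le n) x))
      = y (n + N) (orbit T (Nat.zero_le (n + N)) x) - y n (orbit T (Nat.zero_le n) x) := by
  induction N with
  | zero => simp
  | succ N ih =>
    rw [Finset.sum_range_succ, ih, ← orbit_trans T _ _ (Nat.zero_le (n + N)), hx,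
      ← orbit_succ T (Nat.zero_le (n + N)) (Nat.zero_le (n + N + 1))]
    exact sub_add_sub_cancel' _ _ _

variable [∀ j, MeasurableSpace (X j)] {m : ∀ j, Measure (X j)} [∀ j, IsProbabilityMeasure (m j)]

/-- If `M` is the coboundary of `y` and `y` converges to a constant along orbits, then `y` is that
constant minus the sum of `M` along the forward orbit. -/
theorem ae_tendsto_sum_of_coboundary
    (hT : ∀ j, Measure.QuasiMeasurePreserving (T j) (m j) (m (j + 1)))
    (hM : ∀ j, Measurable (M j)) (hy : ∀ j, Measurable (y j))
    (hMy : ∀ j, ∀ᵐ x ∂(m j), M j x = y (j + 1) (T j x) - y j x)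
    {c₀ : ℝ≥0} {n₀ : ℕ} (hc₀ : 0 < c₀) (hd : ∀ j ≥ n₀, ∀ᵐ x ∂(m j), (c₀ : ℝ) ≤ dens m T j x)
    {κ : ℝ}
    (hκ : ∀ᵐ x ∂(m 0), Tendsto (fun n => y n (orbit T (Nat.zero_le n) x)) atTop (𝓝 κ)) (n : ℕ) :
    ∀ᵐ x ∂(m n), Tendsto
      (fun N => ∑ i ∈ Finset.range N, M (n + i) (orbit T (Nat.le_add_right n i) x))
      atTop (𝓝 (κ - y n x)) := by
  have hTm := fun j => (hT j).measurable
  -- Along the orbit of a point of `X 0` the sum telescopes; the conclusion passes to `m n` because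
  -- the density is bounded below there.
  have hlarge : ∀ n ≥ n₀, ∀ᵐ x ∂(m n), Tendsto
      (fun N => ∑ i ∈ Finset.range N, M (n + i) (orbit T (Nat.le_add_right n i) x))
      atTop (𝓝 (κ - y n x)) := by
    intro n hn
    refine ae_of_ae_comp_orbit hT hc₀ (hd n hn) (measurableSet_tendsto_fun
      (fun N => Finset.measurable_sum _ fun i _ => (hM _).comp (measurable_orbit hTm _))
      (measurable_const.sub (hy n))) ?_
    have hall : ∀ᵐ x ∂(m 0), ∀ k, M k (orbit T (Nat.zero_le k) x) =
        y (k + 1) (T k (orbit T (Nat.zero_le k) x)) - y k (orbit T (Nat.zero_le k) x) :=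
      ae_all_iff.2 fun k => (quasiMeasurePreserving_orbit hT (Nat.zero_le k)).ae (hMy k)
    filter_upwards [hall, hκ] with x hx hxκ
    simp only [sum_apply_orbit hx]
    refine Tendsto.sub_const (hxκ.comp (f := fun N => n + N) ?_) _
    exact tendsto_atTop_mono (fun N => Nat.le_add_left N n) tendsto_id
  -- Below `n₀` the statement is pulled back along `T n`: one term `M n x` is added in front, and
  -- `hMy` turns the limit into `κ - y n x`.
  have hdown : ∀ d n, n + d = n₀ → ∀ᵐ x ∂(m n), Tendsto
      (fun N => ∑ i ∈ Finset.range N, M (n + i) (orbit T (Nat.le_add_right n i) x))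
      atTop (𝓝 (κ - y n x)) := by
    intro d
    induction d with
    | zero => exact fun n hn => hlarge n hn.ge
    | succ d ih =>
      intro n hn
      filter_upwards [(hT n).ae (ih (n + 1) (by omega)), hMy n] with x hx hxM
      rw [← tendsto_add_atTop_iff_nat 1]
      simp only [Finset.sum_range_succ', apply_orbit_add_succ M, apply_orbit_add_zero M]
      have := hx.add_const (M n x)
      rwa [hxM, show κ - y (n + 1) (T n x) + (y (n + 1) (T n x) - y n x) = κ - y n x by ring,
        ← hxM] at this
  rcases le_total n₀ n with h | h
  · exact hlarge n h
  · exact hdown (n₀ - n) n (by omega)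

end Coboundary

end SeqLivsic

theorem mainTheorem2 {X : ℕ → Type*} [∀ j, MeasurableSpace (X j)]
    (m : ∀ j, Measure (X j)) [∀ j, IsProbabilityMeasure (m j)]
    (var : ∀ j, (X j → ℝ) → ℝ≥0∞) (hvar : IsVariation m var)
    (T : ∀ j, X j → X (j + 1))
    (hT : ∀ j, Measure.QuasiMeasurePreserving (T j) (m j) (m (j + 1)))
    (hcomp : ∃ C : ℝ≥0, ∀ j (h : X (j + 1) → ℝ), Integrable h (m (j + 1)) →
      var (j + 1) h ≤ 1 → var j (fun x => h (T j x)) ≤ C)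
    (hadm : IsAdmissible m var T)
    (F : ∀ j, X j → ℝ) (hF : ∀ j, MemB (m j) (var j) (F j))
    (hFbdd : ∃ C : ℝ≥0, ∀ j, bNorm (m j) (var j) (F j) ≤ C)
    (H : ∀ j, X j → ℝ) (hH : ∀ j, Measurable (H j))
    (hFH : ∀ j, ∀ᵐ x ∂(m j), F j x = H (j + 1) (T j x) - H j x) :
    ∃ U M : ∀ j, X j → ℝ,
      -- the decomposition of `F_j`
      (∀ j, Integrable (fun x => F j (orbit T (Nat.zero_le j) x)) (m 0) ∧
        ∀ᵐ x ∂(m j), F j x =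
          (∫ y, F j (orbit T (Nat.zero_le j) y) ∂(m 0)) + U (j + 1) (T j x) - U j x + M j x) ∧
      -- regularity of `U_j` and `M_j`
      (∀ j, MemB (m j) (var j) (U j) ∧ MemB (m j) (var j) (M j)) ∧
      (∃ C : ℝ≥0, ∀ j, bNorm (m j) (var j) (U j) ≤ C) ∧
      (∀ j, Integrable (fun x => U j (orbit T (Nat.zero_le j) x)) (m 0) ∧
        ∫ x, U j (orbit T (Nat.zero_le j) x) ∂(m 0) = 0) ∧
      (∃ C : ℝ≥0, ∀ j, bNorm (m j) (var j) (M j) ≤ C) ∧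
      -- reverse martingale differences
      (∀ j, Integrable (fun x => M j (orbit T (Nat.zero_le j) x)) (m 0) ∧
        (m 0)[fun x => M j (orbit T (Nat.zero_le j) x) |
          MeasurableSpace.comap (orbit T (Nat.zero_le (j + 1))) inferInstance] =ᵐ[m 0] 0) ∧
      -- convergence of the martingale almost surely and in every `L^p`
      (∃ S : X 0 → ℝ,
        (∀ᵐ x ∂(m 0), Tendsto
          (fun n => ∑ k ∈ Finset.range n, M k (orbit T (Nat.zero_le k) x)) atTop (𝓝 (S x))) ∧
        ∀ p : ℝ≥0∞, 1 ≤ p → p ≠ ∞ → MemLp S p (m 0) ∧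
          Tendsto (fun n => eLpNorm
            (fun x => (∑ k ∈ Finset.range n, M k (orbit T (Nat.zero_le k) x)) - S x) p (m 0))
            atTop (𝓝 0)) ∧
      -- moments of `H_n`
      (∀ (n : ℕ) (p : ℝ≥0∞), 1 ≤ p → p ≠ ∞ →
        MemLp (fun x => H n (orbit T (Nat.zero_le n) x)) p (m 0)) ∧
      (∀ p : ℝ≥0∞, 1 ≤ p → p ≠ ∞ → ∃ C : ℝ≥0, ∀ j,
        eLpNorm (fun x => H j (orbit T (Nat.zero_le j) x) -
          ∫ y, H j (orbit T (Nat.zero_le j) y) ∂(m 0)) p (m 0) ≤ C) ∧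
      -- the formula for `H_n`
      (∀ n, ∀ᵐ x ∂(m n), ∃ s : ℝ,
        Tendsto (fun N => ∑ i ∈ Finset.range N, M (n + i) (orbit T (Nat.le_add_right n i) x))
          atTop (𝓝 s) ∧
        H n x = (∫ y, H n (orbit T (Nat.zero_le n) y) ∂(m 0)) + U n x - s) ∧
      -- the limit of `(H_n - U_n) ∘ T_0^{(n)} - q_n`
      (∀ᵐ x ∂(m 0), Tendsto
        (fun n => H n (orbit T (Nat.zero_le n) x) - U n (orbit T (Nat.zero_le n) x) -
          ∫ y, H n (orbit T (Nat.zero_le n) y) ∂(m 0)) atTop (𝓝 0)) ∧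
      (∀ p : ℝ≥0∞, 1 ≤ p → p ≠ ∞ → Tendsto
        (fun n => eLpNorm
          (fun x => H n (orbit T (Nat.zero_le n) x) - U n (orbit T (Nat.zero_le n) x) -
            ∫ y, H n (orbit T (Nat.zero_le n) y) ∂(m 0)) p (m 0)) atTop (𝓝 0)) := by
  have hTm := fun j => (hT j).measurable
  obtain ⟨C, hC⟩ := hvar.exists_isVarConst
  obtain ⟨b, hb⟩ := exists_bLe_dens hT hvar hadm
  obtain ⟨R, n₁, γ, hR, hn₁, hγ, hcon⟩ := exists_contraction hT hvar hC hadm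
  obtain ⟨c₀, n₀, hc₀, hd⟩ := exists_le_dens hvar hadm
  obtain ⟨c, hc⟩ := hcomp
  obtain ⟨bF, hbF⟩ := hFbdd
  have hFB : ∀ j, BLe m var j (F j) bF := fun j => ⟨(hF j).1, hbF j⟩
  obtain ⟨U, M, B, hUm, hMm, hUb, hMb, hUB, hMB, hdec, hU0, hmart, hM0⟩ :=
    exists_decomposition hT hvar hC hadm hR hn₁ hγ hcon hb hc₀ hd hc hFB
  have hrev := isRevMartDiff_comp_orbit hT hMm hMb hmart
  obtain ⟨s, hs⟩ := exists_abs_integral_qsum_sub_le hT hvar hC hadm hR hn₁ hγ hcon hb hc₀ hd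
    hMm hMb hMB hM0
  set ξ : ℕ → X 0 → ℝ := fun k x => M k (orbit T (Nat.zero_le k) x) with hξ
  set Q : ℕ → ℝ := fun n => ∑ k ∈ Finset.range n, ∫ y, F k (orbit T (Nat.zero_le k) y) ∂(m 0)
    with hQ
  -- Subtracting the accumulated means makes `M` an exact coboundary of `y`.
  set y : ∀ n, X n → ℝ := fun n x => H n x - U n x - Q n with hy
  have hym : ∀ n, Measurable (y n) := fun n => ((hH n).sub (hUm n)).sub_const _
  have hMy : ∀ j, ∀ᵐ x ∂(m j), M j x = y (j + 1) (T j x) - y j x := by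
    intro j
    filter_upwards [hdec j, hFH j] with x h1 h2
    simp only [hy, hQ, Finset.sum_range_succ]
    linarith
  have hall : ∀ᵐ x ∂(m 0), ∀ k, M k (orbit T (Nat.zero_le k) x) =
      y (k + 1) (T k (orbit T (Nat.zero_le k) x)) - y k (orbit T (Nat.zero_le k) x) :=
    ae_all_iff.2 fun k => (quasiMeasurePreserving_orbit hT (Nat.zero_le k)).ae (hMy k)
  have hpsum : ∀ᵐ x ∂(m 0), ∀ n,
      psum ξ n x = y n (orbit T (Nat.zero_le n) x) - y 0 (orbit T (Nat.zero_le 0) x) := by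
    filter_upwards [hall] with x hx n
    induction n with
    | zero => simp [psum]
    | succ n ih =>
      have : psum ξ (n + 1) x = psum ξ n x + ξ n x := Finset.sum_range_succ _ _
      rw [this, ih, orbit_succ T (Nat.zero_le n)]
      simp only [hξ, hx n]
      ring
  -- The fixed function `y 0` equals `y n ∘ T_0^{(n)}` minus the martingale sum for every `n`, which
  -- is what forces bounded variances.
  obtain ⟨S, hSlim, hSp⟩ := hrev.exists_limit s.2 hs
    (G := fun x => y 0 (orbit T (Nat.zero_le 0) x)) ((hym 0).comp (measurable_orbit hTm _))
    (Y := fun n x => y n (orbit T (Nat.zero_le n) x))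
    (fun n => (hym n).comp (comap_measurable _))
    (fun n => hpsum.mono fun x hx => by rw [hx n]; ring)
  have hZ : ∀ᵐ x ∂(m 0), Tendsto (fun n => y n (orbit T (Nat.zero_le n) x)) atTop
      (𝓝 (S x + y 0 (orbit T (Nat.zero_le 0) x))) := by
    filter_upwards [hSlim, hpsum] with x h1 h2
    refine (h1.add_const (y 0 (orbit T (Nat.zero_le 0) x))).congr fun n => ?_
    rw [h2 n]; ring
  obtain ⟨κ, hκ⟩ := exists_ae_eq_const_of_tendsto hT hvar hC hR hn₁ hγ hcon hym hZ
  have hyκ : ∀ᵐ x ∂(m 0), Tendsto (fun n => y n (orbit T (Nat.zero_le n) x)) atTop (𝓝 κ) := by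
    filter_upwards [hZ, hκ] with x h1 h2
    rwa [h2] at h1
  have hyS : ∀ᵐ x ∂(m 0), ∀ n, y n (orbit T (Nat.zero_le n) x) = psum ξ n x - S x + κ := by
    filter_upwards [hpsum, hκ] with x h1 h2 n
    rw [h1 n, ← h2]; ring
  have hpL : ∀ n p, MemLp (psum ξ n) p (m 0) := fun n p =>
    (hrev.bddMeas_psum n).memLp_top.mono_exponent le_top
  have hUL : ∀ n p, MemLp (fun x => U n (orbit T (Nat.zero_le n) x)) p (m 0) := fun n p =>
    (BddMeas.comp ⟨hUm n, _, hUb n⟩ (measurable_orbit hTm _)).memLp_top.mono_exponent le_top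
  have hUi : ∀ n, ∫ x, U n (orbit T (Nat.zero_le n) x) ∂(m 0) = 0 := fun n => by
    rw [← hU0 n, integral_dens_mul hT n (BddMeas.memLp_top ⟨hUm n, _, hUb n⟩)]
  have hpi : ∀ n, ∫ x, psum ξ n x ∂(m 0) = 0 := fun n => by
    simpa using hrev.integral_psum_mul (n := n) (BddMeas.const 1)
  have hSi : Integrable S (m 0) :=
    memLp_one_iff_integrable.1 (hSp 1 le_rfl ENNReal.one_ne_top).1
  -- Convergence in `L¹` carries the zero mean of the partial sums to `S`.
  have hS0 : ∫ x, S x ∂(m 0) = 0 := by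
    have h1 := tendsto_integral_of_L1' S hSi.1
      (Eventually.of_forall fun n => memLp_one_iff_integrable.1 (hpL n 1))
      (hSp 1 le_rfl ENNReal.one_ne_top).2.2
    simp only [hpi] at h1
    exact (tendsto_nhds_unique h1 tendsto_const_nhds)
  have hHeq : ∀ᵐ x ∂(m 0), ∀ n, H n (orbit T (Nat.zero_le n) x) =
      psum ξ n x - S x + U n (orbit T (Nat.zero_le n) x) + (κ + Q n) := by
    filter_upwards [hyS] with x hx n
    have := hx n
    simp only [hy] at this
    linarith
  -- This identifies `κ + Q n` with the mean `q_n`: the martingale sum, its limit and `U n` all have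
  -- mean zero under `m 0`.
  have hq : ∀ n, ∫ x, H n (orbit T (Nat.zero_le n) x) ∂(m 0) = κ + Q n := by
    intro n
    have i1 := memLp_one_iff_integrable.1 (hpL n 1)
    have i2 := memLp_one_iff_integrable.1 (hUL n 1)
    have i3 : Integrable (fun x => psum ξ n x - S x) (m 0) := i1.sub hSi
    rw [integral_congr_ae (hHeq.mono fun x hx => hx n), integral_add (i3.fun_add i2)
      (integrable_const _), integral_add i3 i2, integral_sub i1 hSi, hpi, hS0, hUi]
    simp
  have hHU : ∀ᵐ x ∂(m 0), ∀ n, H n (orbit T (Nat.zero_le n) x) - U n (orbit T (Nat.zero_le n) x) -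
      ∫ y, H n (orbit T (Nat.zero_le n) y) ∂(m 0) = psum ξ n x - S x := by
    filter_upwards [hHeq] with x hx n
    rw [hq, hx n]; ring
  refine ⟨U, M, fun j => ⟨integrable_comp_orbit hT hC (hFB j), hdec j⟩,
    fun j => ⟨(hUB j).memB, (hMB j).memB⟩, ⟨B, fun j => (hUB j).2⟩,
    fun j => ⟨memLp_one_iff_integrable.1 (hUL j 1), hUi j⟩, ⟨B, fun j => (hMB j).2⟩,
    fun j => ⟨(hrev.bddMeas j).integrable, hrev.condExp_ae_eq_zero j⟩,
    ⟨S, hSlim, fun p h1 hp => ⟨(hSp p h1 hp).1, (hSp p h1 hp).2.2⟩⟩, ?_, ?_, ?_, ?_, ?_⟩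
  · intro n p h1 hp
    exact ((((hpL n p).sub (hSp p h1 hp).1).add (hUL n p)).add (memLp_const (κ + Q n))).ae_eq
      (hHeq.mono fun x hx => (hx n).symm)
  · intro p h1 hp
    obtain ⟨hSL, ⟨K, hK⟩, -⟩ := hSp p h1 hp
    refine ⟨K + (eLpNorm S p (m 0)).toNNReal + C * B, fun n => ?_⟩
    have e : (fun x => H n (orbit T (Nat.zero_le n) x) -
        ∫ y, H n (orbit T (Nat.zero_le n) y) ∂(m 0)) =ᵐ[m 0]
        (psum ξ n - S) + fun x => U n (orbit T (Nat.zero_le n) x) := by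
      filter_upwards [hHeq] with x hx
      simp only [Pi.add_apply, Pi.sub_apply]
      rw [hq, hx n]; ring
    rw [eLpNorm_congr_ae e]
    push_cast
    rw [ENNReal.coe_toNNReal hSL.2.ne]
    refine (eLpNorm_add_le ((hpL n p).sub hSL).1 (hUL n p).1 h1).trans (add_le_add
      ((eLpNorm_sub_le (hpL n p).1 hSL.1 h1).trans (add_le_add (hK n) le_rfl)) ?_)
    exact_mod_cast eLpNorm_le_coe_of_ae_abs_le (a := C * B)
      (Eventually.of_forall fun x => by push_cast; exact hUb n _) p
  · intro n
    filter_upwards [ae_tendsto_sum_of_coboundary hT hMm hym hMy hc₀ hd hyκ n] with x hx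
    refine ⟨_, hx, ?_⟩
    rw [hq]
    simp only [hy]
    ring
  · filter_upwards [hHU, hSlim] with x h1 h2
    simp only [h1]
    simpa using h2.sub_const (S x)
  · intro p h1 hp
    refine (hSp p h1 hp).2.2.congr fun n => eLpNorm_congr_ae ?_
    filter_upwards [hHU] with x hx
    exact (hx n).symm
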